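/- **Setting.** Let $d,n,k\ge 1$, let $\Omega\subset\mathbb R^d$ be compact with nonempty interior and smooth boundary with exterior unit normal $\nu$, and let $Q=[0,1]\times\Omega$. Matrix spaces carry the Frobenius inner product $A\cdot B=\operatorname{tr}(A^{T}B)$; $\mathbb M^n$, $\mathbb S^n$, $\mathbb A^n$, $\mathbb S^n_+$ are the square, symmetric, antisymmetric and positive semidefinite matrices. Let $\mathsf D^*\Phi=\mathsf D_0^*\Phi+\mathsf D_1^*\Phi$ be a first-order constant-coefficient linear operator from $\mathbb S^n$-valued to $\mathbb R^{n\times k}$-valued fields ($\mathsf D_j^*$ homogeneous of order $j$) with $\mathsf D^*(I)=0$, and let $\mathsf D=\mathsf D_0+\mathsf D_1$ be the adjoint of $-\mathsf D^*$. Put $J(X,Y,Z)=\frac12 Y\cdot X^\dagger Y+\frac12 Z\cdot X^\dagger Z$ if $X\in\mathbb S^n_+$ and $\operatorname{Ran}[Y,Z]\subset\operatorname{Ran}X$, and $J=+\infty$ otherwise. For a measure $\mu=(\mathsf G,\mathsf q,\mathsf R)$ on $\mathcal X\in\{\Omega,Q\}$ with values in $\mathbb S^n\times\mathbb R^{n\times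 k}\times\mathbb M^n$ let $\mathcal J_{\mathcal X}(\mu)=\int_{\mathcal X} J(\frac{d\mu}{d\lambda})\,d\lambda$ for any positive finite measure $\lambda$ with $|\mu|\ll\lambda$. For $\mathsf G_0,\mathsf G_1\in\mathcal M(\Omega,\mathbb S^n_+)$, $\mathcal{CE}_\infty([0,1];\mathsf G_0,\mathsf G_1)$ is the set of such $\mu$ on $Q$ with $\mathcal J_Q(\mu)<\infty$ and $$\int_Q\partial_t\Phi\cdot d\mathsf G+\mathsf D^*\Phi\cdot d\mathsf q+\Phi\cdot d\mathsf R=\int_\Omega\Phi_1\cdot d\mathsf G_1-\int_\Omega\Phi_0\cdot d\mathsf G_0\qquad\forall\,\Phi\in C^1(Q,\mathbb S^n).$$ **Discretization.** Let $\Sigma\subset(0,\infty)$ accumulate at $0$. For $\sigma\in\Sigma$ let $\overline X_\sigma$, $Y_\sigma$ be finite-dimensional real spaces, each with a norm $\|\cdot\|_1$ and an inner product $\langle\cdot,\cdot\rangle$; let $X_\sigma\subset\overline X_\sigma$ be a subspace, $X_\sigma^\perp$ its orthogonal complement, $\mathbb P_\sigma$ the orthogonal projection onto $X_\sigma$, and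 $X_{\sigma,+}\subset X_\sigma$ a set closed under multiplication by positive scalars. Let linear reconstructions $\widehat{\mathcal R}_{\overline X_\sigma}:\overline X_\sigma\to\mathcal M(\Omega,\mathbb M^n)$ and $\widehat{\mathcal R}_{Y_\sigma}:Y_\sigma\to\mathcal M(\Omega,\mathbb R^{n\times k})$ be given whose total variation norms are bounded above and below by $\|\cdot\|_1$ up to constants independent of $\sigma$, the first mapping $X_\sigma,X_\sigma^\perp,X_{\sigma,+}$ into measures with values in $\mathbb S^n,\mathbb A^n,\mathbb S^n_+$ respectively. Let $\mathsf D_\sigma:Y_\sigma\to X_\sigma$ be linear and $\mathcal J_\sigma:X_\sigma\times Y_\sigma\times\overline X_\sigma\to[0,\infty]$ be proper, convex, lower semicontinuous, with $\mathcal J_\sigma(aG,q,R)=a^{-1}\mathcal J_\sigma(G,q,R)$ for $a>0$ and $\mathcal J_\sigma(G,aq,aR)=a^2\mathcal J_\sigma(G,q,R)$ for $a\ne0$. For $\tau=1/N$ and $a,b\in X_{\sigma,+}$, $\mathcal{CE}_{\tau,\sigma}([0,1];a,b)$ is the set of $(G,q,R)\in X_\sigma^{N+1}\times Y_\sigma^N\times\overline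 X_\sigma^N$ with $\tau^{-1}(G_j-G_{j-1})=-\mathsf D_\sigma q_j+\mathbb P_\sigma R_j$ $(1\le j\le N)$, $G_0=a$, $G_N=b$ and all $G_j\in X_{\sigma,+}$; and $\mathcal J_{\tau,\sigma}(G,q,R)=\tau\sum_{j=1}^N\mathcal J_\sigma\big(\tfrac{G_{j-1}+G_j}2,q_j,R_j\big)$. Let $\mathsf G_0^\sigma,\mathsf G_1^\sigma\in X_{\sigma,+}$ satisfy $\langle\widehat{\mathcal R}_{\overline X_\sigma}\mathsf G_i^\sigma,\Phi\rangle_\Omega\to\langle\mathsf G_i,\Phi\rangle_\Omega$ as $\sigma\to0$ for all $\Phi\in C(\Omega,\mathbb S^n)$, $i=0,1$. **Consistent sampling operators.** These are bounded linear operators $\mathcal S_{\overline X_\sigma}:C(\Omega,\mathbb M^n)\to\overline X_\sigma$ and $\mathcal S_{Y_\sigma}:C(\Omega,\mathbb R^{n\times k})\to Y_\sigma$ such that $\mathcal S_{\overline X_\sigma}$ maps $C(\Omega,\mathbb S^n)$ into $X_\sigma$, $C(\Omega,\mathbb A^n)$ into $X_\sigma^\perp$, and every smooth $G:\Omega\to\mathbb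 S^n$ with $G\succeq\eta I$ for some $\eta>0$ into $X_{\sigma,+}$, and such that, with $e_{\sigma,q}=\mathsf D_\sigma\mathcal S_{Y_\sigma}(q)-\mathcal S_{\overline X_\sigma}(\mathsf Dq)$ and $\|\cdot\|_{2,\infty}$ the $C^2(\Omega)$ norm: * there is $\varepsilon_\sigma\to0$ such that the norm of $e_{\sigma,\phi}$ on $X_\sigma$ dual to $\|\cdot\|_1$ is at most $\varepsilon_\sigma\|\phi\|_{2,\infty}$ for all $\phi\in C^\infty(\Omega,\mathbb R^{n\times k})$ with $\widehat{\mathsf D_1}(-i\nu)\phi=0$ on $\partial\Omega$; * for all $E,\eta>0$ there are $C_{E,\eta}>0$ and $\varepsilon_\sigma\to0$ such that $\mathcal J_\sigma(\mathcal S_{\overline X_\sigma}G,\mathcal S_{Y_\sigma}q,\mathcal S_{\overline X_\sigma}R+e_{\sigma,q})\le\mathcal J_\Omega((G,q,R)\,dx)+C_{E,\eta}\varepsilon_\sigma$ for all $\sigma$ and all smooth $(G,q,R)$ with $C^2$ norms at most $E$, $G\succeq\eta I$, and $\widehat{\mathsf D_1}(-i\nu)q=0$ on $\partial\Omega$. **Assumptions.**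 * (C.1) $\Omega$ is connected and star-shaped with respect to a set of points with nonempty interior. * (C.2) For some $k=k_1+k_2$, $\mathsf D_0^*$ takes values in the first $k_1$ columns and $\mathsf D_1^*$ in the last $k_2$ columns of $\mathbb R^{n\times k}$. *Regularization.* Fix a point $x_0$ in the interior of the set of points with respect to which $\Omega$ is star-shaped, a Lipschitz constant $L$ of the Minkowski functional of $\Omega-x_0$, smooth radial nonnegative functions $\theta_1$ on $\mathbb R$ and $\theta_d$ on $\mathbb R^d$ of integral $1$ supported in the unit balls, and a smooth $\overline G:\mathbb R^d\to\mathbb S^n_+$ that vanishes at distance $>1$ from $\Omega$ and satisfies $\overline G\succeq I$ at distance $\le\frac12$. With $\theta^\varepsilon_m(x)=\varepsilon^{-m}\theta_m(x/\varepsilon)$, extend $\mu\in\mathcal{CE}_\infty([0,1];\mathsf G_0,\mathsf G_1)$ by $(\mathsf G_0,0,0)$ for $t<0$, by $(\mathsf G_1,0,0)$ for $t>1$ and by zero outside $\Omega$, and let $(\widetilde G,\widetilde q,\widetilde R)$ be the density of the convolution of $((1-\varepsilon)\mathsf G+\varepsilon\overline G\,dt\,dx,(1-\varepsilon)\mathsf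 q,(1-\varepsilon)\mathsf R)$ with $\theta_1^\varepsilon(t)\theta_d^\varepsilon(x)$. The $\varepsilon$-regularization $\mu^\varepsilon$ has, at $(s,x)\in Q$, with $t=(1+2\varepsilon)s-\varepsilon$, $y=x_0+(1+L\varepsilon)(x-x_0)$, the density $$(G^\varepsilon,q^\varepsilon,R^\varepsilon)(s,x)=(1+L\varepsilon)^d\big(\widetilde G,\,(1+2\varepsilon)\,\mathcal T\widetilde q,\,(1+2\varepsilon)\widetilde R\big)(t,y),$$ where $\mathcal T$ multiplies the last $k_2$ columns by $(1+L\varepsilon)^{-1}$. Its endpoints are $G_i^\varepsilon=G^\varepsilon(i,\cdot)$, $i=0,1$. * (A*) For every $\mu\in\mathcal{CE}_\infty([0,1];\mathsf G_0,\mathsf G_1)$ and $i=0,1$ there are, for all small $\varepsilon>0$, curves $\mu_i^{\tau,\sigma}\in\mathcal{CE}_{\tau,\sigma}([0,1];\mathsf G_i^\sigma,\mathcal S_{\overline X_\sigma}G_i^\varepsilon)$ for all $\tau\in\{\frac12,\frac13,\dots\}$, $\sigma\in\Sigma$, such that $\limsup_{(\tau,\sigma)\to0}\mathcal J_{\tau,\sigma}(\mu_i^{\tau,\sigma})\to0$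 as $\varepsilon\to0$. **Theorem (asymptotic upper bound).** Suppose that consistent sampling operators exist and that (C.1), (C.2) and (A*) hold (the latter for the given sampling operators and some choice of the regularization data). Then for every $\mu\in\mathcal{CE}_\infty([0,1];\mathsf G_0,\mathsf G_1)$ and every $\eta>0$ there are discrete curves $\mu^{\tau,\sigma}\in\mathcal{CE}_{\tau,\sigma}([0,1];\mathsf G_0^\sigma,\mathsf G_1^\sigma)$, $\tau\in\{\frac12,\frac13,\dots\}$, $\sigma\in\Sigma$, with $$\limsup_{(\tau,\sigma)\to0}\mathcal J_{\tau,\sigma}(\mu^{\tau,\sigma})\le\mathcal J_Q(\mu)+\eta.$$ -/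

import Mathlib

open Set Filter Topology MeasureTheory
open scoped NNReal ENNReal ContDiff Matrix

noncomputable section

namespace WBScheme

/-! ### Matrices -/

/-- Real `n × m` matrices. -/
abbrev Mat (n m : ℕ) : Type := Matrix (Fin n) (Fin m) ℝ

/-- Euclidean space `ℝ^d`. -/
abbrev Eu (d : ℕ) : Type := EuclideanSpace ℝ (Fin d)

/-- The Frobenius inner product `A · B = tr (Aᵀ B)`. -/
def dot {n m : ℕ} (A B : Mat n m) : ℝ := (Aᵀ * B).trace

/-- The Frobenius norm. -/
def frob {n m : ℕ} (A : Mat n m) : ℝ := Real.sqrt (dot A A)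

open Classical in
/-- The pseudoinverse of a symmetric matrix `O diag(λ) Oᵀ`, namely `O diag(λ⁻¹) Oᵀ` with the
convention `0⁻¹ = 0` on the kernel. (It is only used for symmetric matrices.) -/
def pinv {n : ℕ} (A : Mat n n) : Mat n n :=
  if h : A.IsHermitian then h.cfc (fun x => x⁻¹) else 0

open Classical in
/-- The infinitesimal cost `J(X, Y, Z) = ½ Y · X†Y + ½ Z · X†Z` if `X` is positive semidefinite and
`Ran [Y, Z] ⊆ Ran X`, and `+∞` otherwise (weight matrices equal to the identity). -/
def cost {n k : ℕ} (X : Mat n n) (Y : Mat n k) (Z : Mat n n) : ℝ≥0∞ :=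
  if X.PosSemidef ∧ LinearMap.range Y.mulVecLin ≤ LinearMap.range X.mulVecLin ∧
      LinearMap.range Z.mulVecLin ≤ LinearMap.range X.mulVecLin then
    ENNReal.ofReal (1 / 2 * dot Y (pinv X * Y) + 1 / 2 * dot Z (pinv X * Z))
  else ⊤

/-! ### Matrix-valued measures -/

/-- Matrix-valued Borel measures. On a compact metric space these are exactly the matrix-valued
Radon measures. -/
abbrev MatMeasure (α : Type*) [MeasurableSpace α] (n m : ℕ) : Type _ :=
  VectorMeasure α (Mat n m)

namespace MatMeasure

variable {α : Type*} [MeasurableSpace α] {n m : ℕ}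

/-- The `(i, j)` entry of a matrix-valued measure. -/
def entry (μ : MatMeasure α n m) (i : Fin n) (j : Fin m) : SignedMeasure α :=
  μ.mapRange (Matrix.entryAddMonoidHom ℝ i j) (continuous_id.matrix_elem i j)

/-- The duality pairing `⟨μ, Φ⟩ = ∫ Φ · dμ`. -/
def pair (μ : MatMeasure α n m) (Φ : α → Mat n m) : ℝ :=
  ∑ i, ∑ j, (μ.entry i j).integral (fun x => Φ x i j) (ContinuousLinearMap.lsmul ℝ ℝ).flip

/-- The matrix `∫ f dμ` for a scalar function `f`. -/
def scalarIntegral (μ : MatMeasure α n m) (f : α → ℝ) : Mat n m :=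
  Matrix.of fun i j => (μ.entry i j).integral f (ContinuousLinearMap.lsmul ℝ ℝ).flip

/-- A finite positive measure dominating all entries. -/
def dom (μ : MatMeasure α n m) : Measure α :=
  ∑ i, ∑ j, (μ.entry i j).totalVariation

/-- The density of a matrix-valued measure with respect to a positive measure. -/
def density (μ : MatMeasure α n m) (lam : Measure α) (x : α) : Mat n m :=
  Matrix.of fun i j => (μ.entry i j).rnDeriv lam x

/-- The total variation norm (with respect to the Frobenius norm of matrices). -/
def tv (μ : MatMeasure α n m) : ℝ := ∫ x, frob (μ.density μ.dom x) ∂μ.dom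

/-- `𝕊ⁿ`-valued measures. -/
def IsSymm (μ : MatMeasure α n n) : Prop := ∀ E, MeasurableSet E → (μ E)ᵀ = μ E

/-- Measures with antisymmetric values. -/
def IsAntisymm (μ : MatMeasure α n n) : Prop := ∀ E, MeasurableSet E → (μ E)ᵀ = -μ E

/-- `𝕊ⁿ₊`-valued measures. -/
def IsPosSemidef (μ : MatMeasure α n n) : Prop := ∀ E, MeasurableSet E → (μ E).PosSemidef

end MatMeasure

/-! ### The spatial domain -/

variable {d n k : ℕ}

/-- `φ` is a smooth defining function of `Ω` near the point `x`. -/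
def IsDefiningFunction (Ω : Set (Eu d)) (x : Eu d) (φ : Eu d → ℝ) : Prop :=
  ContDiff ℝ ∞ φ ∧ gradient φ x ≠ 0 ∧ ∀ᶠ y in 𝓝 x, (y ∈ Ω ↔ φ y ≤ 0)

/-- A compact set with nonempty interior and smooth boundary. -/
structure IsSmoothCompact (Ω : Set (Eu d)) : Prop where
  isCompact : IsCompact Ω
  nonempty_interior : (interior Ω).Nonempty
  smooth_boundary : ∀ x ∈ frontier Ω, ∃ φ, IsDefiningFunction Ω x φ

/-- `ν` is the exterior unit normal to `Ω` at the boundary point `x`. -/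
def IsOuterUnitNormal (Ω : Set (Eu d)) (x ν : Eu d) : Prop :=
  ∃ φ, IsDefiningFunction Ω x φ ∧ ν = ‖gradient φ x‖⁻¹ • gradient φ x

/-- `Ω` is connected and star-shaped with respect to a set of points with nonempty interior. -/
def IsStarShapedDomain (Ω : Set (Eu d)) : Prop :=
  IsConnected Ω ∧ (interior {x | StarConvex ℝ x Ω}).Nonempty

/-- Entrywise `C^∞` matrix fields. A smooth field on `Ω` up to the boundary is the restriction
to `Ω` of such a field. -/
def SmoothField {n m : ℕ} (f : Eu d → Mat n m) : Prop :=
  ∀ i j, ContDiff ℝ ∞ fun x => f x i j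

/-- The partial derivative `∂_c f`, entry by entry. -/
def pd {n m : ℕ} (c : Fin d) (f : Eu d → Mat n m) (x : Eu d) : Mat n m :=
  Matrix.of fun i j => fderiv ℝ (fun y => f y i j) x (EuclideanSpace.single c 1)

/-- `sup_{x ∈ Ω} ‖f x‖_F`. -/
def supNorm {n m : ℕ} (Ω : Set (Eu d)) (f : Eu d → Mat n m) : ℝ := ⨆ x : Ω, frob (f x)

/-- `‖f‖_{2,∞} = ∑_{|α| ≤ 2} sup_Ω ‖D^α f‖_F`; the multi-indices of length two are the unordered
pairs `{c, c'}`. -/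
def norm2 {n m : ℕ} (Ω : Set (Eu d)) (f : Eu d → Mat n m) : ℝ :=
  supNorm Ω f + ∑ c, supNorm Ω (pd c f) + ∑ c, ∑ c' ∈ Finset.Ici c, supNorm Ω (pd c (pd c' f))

/-- The restriction to `Ω` of a field that is continuous on `Ω`, as an element of `C(Ω, ·)`. -/
def toC {n m : ℕ} (Ω : Set (Eu d)) (f : Eu d → Mat n m) : C(Ω, Mat n m) :=
  ContinuousMap.mkD (fun x : Ω => f x) 0

/-! ### The differential operator -/

/-- A first-order constant-coefficient operator
`D* Φ = zeroth Φ + ∑_c first_c (∂_c Φ)` from `𝕊ⁿ`-valued to `ℝ^{n × k}`-valued fields with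
`D* I = 0`. A linear map on `𝕊ⁿ` is represented by its unique extension to all square matrices
that vanishes on the antisymmetric ones. -/
structure DiffOp (d n k : ℕ) where
  zeroth : Mat n n →ₗ[ℝ] Mat n k
  first : Fin d → Mat n n →ₗ[ℝ] Mat n k
  zeroth_transpose : ∀ A, zeroth Aᵀ = zeroth A
  first_transpose : ∀ c A, first c Aᵀ = first c A
  zeroth_one : zeroth 1 = 0

/-- The adjoint of a linear map of matrices for the Frobenius inner products. -/
def adj (L : Mat n n →ₗ[ℝ] Mat n k) (q : Mat n k) : Mat n n :=
  Matrix.of fun i j => dot q (L (Matrix.single i j 1))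

namespace DiffOp

/-- The operator `D*`. -/
def star (P : DiffOp d n k) (Φ : Eu d → Mat n n) (x : Eu d) : Mat n k :=
  P.zeroth (Φ x) + ∑ c, P.first c (pd c Φ x)

/-- The operator `D`, the formal adjoint of `-D*`. -/
def D (P : DiffOp d n k) (q : Eu d → Mat n k) (x : Eu d) : Mat n n :=
  -adj P.zeroth (q x) + ∑ c, adj (P.first c) (pd c q x)

/-- The boundary condition `D̂₁(-iν) q = 0` on `∂Ω`, where `D₁` is the first-order part of `D`. -/
def BoundaryCondition (P : DiffOp d n k) (Ω : Set (Eu d)) (q : Eu d → Mat n k) : Prop :=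
  ∀ x ∈ frontier Ω, ∀ ν, IsOuterUnitNormal Ω x ν → ∑ c, ν c • adj (P.first c) (q x) = 0

/-- `D* Φ = (D₀* Φ, D₁* Φ)`: the zeroth-order part of `D*` takes values in the first `k₁` columns
and the first-order part in the other `k - k₁` columns. -/
def SplitsAt (P : DiffOp d n k) (k₁ : ℕ) : Prop :=
  k₁ ≤ k ∧ (∀ A i (j : Fin k), k₁ ≤ (j : ℕ) → P.zeroth A i j = 0) ∧
    ∀ c A i (j : Fin k), (j : ℕ) < k₁ → P.first c A i j = 0

end DiffOp

/-! ### The continuity equation and the action -/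

/-- The time-space domain `Q = [0,1] × Ω`. -/
abbrev TimeSpace (Ω : Set (Eu d)) : Type := unitInterval × Ω

/-- A triple `(G, q, R)` of matrix-valued measures on `Q` with `G` symmetric. -/
structure CurveMeasure (Ω : Set (Eu d)) (n k : ℕ) where
  G : MatMeasure (TimeSpace Ω) n n
  q : MatMeasure (TimeSpace Ω) n k
  R : MatMeasure (TimeSpace Ω) n n
  symm : G.IsSymm

namespace CurveMeasure

variable {Ω : Set (Eu d)}

/-- A reference measure dominating `G`, `q` and `R`. -/
def dom (μ : CurveMeasure Ω n k) : Measure (TimeSpace Ω) := μ.G.dom + μ.q.dom + μ.R.dom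

/-- The action `𝒥_Q(μ) = ∫_Q J(dμ/dλ) dλ`. -/
def action (μ : CurveMeasure Ω n k) : ℝ≥0∞ :=
  ∫⁻ z, cost (μ.G.density μ.dom z) (μ.q.density μ.dom z) (μ.R.density μ.dom z) ∂μ.dom

/-- The continuity equation `∂_t G + D q = R^sym` with endpoints `G₀`, `G₁`, tested against
all `Φ ∈ C¹(Q, 𝕊ⁿ)`. -/
def ContinuityEquation (P : DiffOp d n k) (G : Fin 2 → MatMeasure Ω n n)
    (μ : CurveMeasure Ω n k) : Prop :=
  ∀ Φ : ℝ → Eu d → Mat n n, (∀ t x, (Φ t x)ᵀ = Φ t x) →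
    (∀ i j, ContDiff ℝ 1 fun z : ℝ × Eu d => Φ z.1 z.2 i j) →
    μ.G.pair (fun z => Matrix.of fun i j => deriv (fun s => Φ s z.2 i j) (z.1 : ℝ)) +
        μ.q.pair (fun z => P.star (Φ z.1) z.2) + μ.R.pair (fun z => Φ z.1 z.2) =
      (G 1).pair (fun x => Φ 1 x) - (G 0).pair (fun x => Φ 0 x)

/-- `μ ∈ 𝒞ℰ_∞([0,1]; G₀, G₁)`. -/
def MemCEInfty (P : DiffOp d n k) (G : Fin 2 → MatMeasure Ω n n) (μ : CurveMeasure Ω n k) : Prop :=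
  μ.ContinuityEquation P G ∧ μ.action < ⊤

end CurveMeasure

/-- The action `𝒥_Ω(μ)` of a triple `μ = (G, q, R) dx` with densities with respect to the Lebesgue
measure. -/
def spatialAction (Ω : Set (Eu d)) (G : Eu d → Mat n n) (q : Eu d → Mat n k)
    (R : Eu d → Mat n n) : ℝ≥0∞ :=
  ∫⁻ x in Ω, cost (G x) (q x) (R x)

/-! ### The regularization of a curve -/

/-- A smooth radial nonnegative function supported in the unit ball with integral one. -/
structure IsMollifier {F : Type*} [NormedAddCommGroup F] [NormedSpace ℝ F] [MeasureSpace F]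
    (θ : F → ℝ) : Prop where
  smooth : ContDiff ℝ ∞ θ
  nonneg : ∀ x, 0 ≤ θ x
  radial : ∀ x y, ‖x‖ = ‖y‖ → θ x = θ y
  support : ∀ x, 1 < ‖x‖ → θ x = 0
  integral_eq_one : ∫ x, θ x = 1

/-- `θ^ε(x) = ε^{-dim} θ(x/ε)`. -/
def rescale {F : Type*} [NormedAddCommGroup F] [NormedSpace ℝ F] (θ : F → ℝ) (ε : ℝ) (x : F) : ℝ :=
  (ε ^ Module.finrank ℝ F)⁻¹ * θ (ε⁻¹ • x)

/-- The choices that enter the `ε`-regularization: a point `center` in the interior of the kernel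
of the star-shaped set `Ω`, a Lipschitz constant `L` of the Minkowski functional of `Ω` relative to
that point, mollifiers in time and space, and a smooth field `lift` that is supported in the
`1`-neighbourhood of `Ω` and satisfies `lift ⪰ I` on the `1/2`-neighbourhood. -/
structure RegularizationData (Ω : Set (Eu d)) (n : ℕ) where
  center : Eu d
  center_mem : center ∈ interior {x | StarConvex ℝ x Ω}
  L : ℝ≥0
  lipschitz : LipschitzWith L (gauge ((fun x => x - center) '' Ω))
  molT : ℝ → ℝ
  molT_spec : IsMollifier molT
  molX : Eu d → ℝ
  molX_spec : IsMollifier molX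
  lift : Eu d → Mat n n
  lift_smooth : SmoothField lift
  lift_posSemidef : ∀ x, (lift x).PosSemidef
  lift_support : ∀ x, 1 < Metric.infDist x Ω → lift x = 0
  lift_ge_one : ∀ x, Metric.infDist x Ω ≤ 1 / 2 → (lift x - 1).PosSemidef

namespace RegularizationData

variable {Ω : Set (Eu d)}

/-- The space-time convolution of a measure on `Q` (extended by zero) with
`θ₁^ε(t) θ_d^ε(x)`, evaluated at `(t, y)`. -/
def mollQ {m : ℕ} (reg : RegularizationData Ω n) (ε : ℝ) (ν : MatMeasure (TimeSpace Ω) n m)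
    (t : ℝ) (y : Eu d) : Mat n m :=
  ν.scalarIntegral fun z => rescale reg.molT ε (t - z.1) * rescale reg.molX ε (y - z.2)

/-- The convolution of a measure on `Ω` with `θ_d^ε`, evaluated at `y`. -/
def mollΩ {m : ℕ} (reg : RegularizationData Ω n) (ε : ℝ) (ν : MatMeasure Ω n m) (y : Eu d) :
    Mat n m :=
  ν.scalarIntegral fun x => rescale reg.molX ε (y - x)

/-- The density at `(t, y)` of the mollification of `(1 - ε) G + ε lift`, where the measure `G`
on `Q` has been extended by `G₀` for times `t < 0` and by `G₁` for times `t > 1`. -/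
def preG (reg : RegularizationData Ω n) (ε : ℝ) (G : Fin 2 → MatMeasure Ω n n)
    (μ : CurveMeasure Ω n k) (t : ℝ) (y : Eu d) : Mat n n :=
  (1 - ε) • (reg.mollQ ε μ.G t y
      + (∫ s in Iio (0 : ℝ), rescale reg.molT ε (t - s)) • reg.mollΩ ε (G 0) y
      + (∫ s in Ioi (1 : ℝ), rescale reg.molT ε (t - s)) • reg.mollΩ ε (G 1) y)
    + ε • Matrix.of fun i j => ∫ z, rescale reg.molX ε (y - z) * reg.lift z i j

/-- The inverse of the time scaling `s^ε(t) = (1 + 2ε)⁻¹ (t + ε)`. -/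
def time (ε s : ℝ) : ℝ := (1 + 2 * ε) * s - ε

/-- The inverse of the contraction `T^ε` by the factor `(1 + Lε)⁻¹` towards the centre. -/
def expand (reg : RegularizationData Ω n) (ε : ℝ) (x : Eu d) : Eu d :=
  reg.center + (1 + reg.L * ε) • (x - reg.center)

/-- The density `G^ε` of the `ε`-regularization: the push-forward under the time-space contraction
of the mollified curve. -/
def regG (reg : RegularizationData Ω n) (ε : ℝ) (G : Fin 2 → MatMeasure Ω n n)
    (μ : CurveMeasure Ω n k) (s : ℝ) (x : Eu d) : Mat n n :=
  (1 + reg.L * ε) ^ d • reg.preG ε G μ (time ε s) (reg.expand ε x)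

/-- The density `q^ε` of the `ε`-regularization. The columns `j ≥ k₁`, on which the first-order
part of `D*` acts, carry the additional factor `(1 + Lε)⁻¹`. -/
def regq (reg : RegularizationData Ω n) (k₁ : ℕ) (ε : ℝ) (μ : CurveMeasure Ω n k)
    (s : ℝ) (x : Eu d) : Mat n k :=
  Matrix.of fun i j => (1 + reg.L * ε) ^ d * (1 + 2 * ε) * (1 - ε) *
    (if (j : ℕ) < k₁ then 1 else (1 + reg.L * ε)⁻¹) * reg.mollQ ε μ.q (time ε s) (reg.expand ε x) i j

/-- The density `R^ε` of the `ε`-regularization. -/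
def regR (reg : RegularizationData Ω n) (ε : ℝ) (μ : CurveMeasure Ω n k)
    (s : ℝ) (x : Eu d) : Mat n n :=
  ((1 + reg.L * ε) ^ d * (1 + 2 * ε) * (1 - ε)) • reg.mollQ ε μ.R (time ε s) (reg.expand ε x)

end RegularizationData

/-! ### Discrete modules -/

/-- An inner product on a real vector space (independent of any norm). -/
structure InnerForm (V : Type*) [AddCommGroup V] [Module ℝ V] where
  form : LinearMap.BilinForm ℝ V
  symm : ∀ x y, form x y = form y x
  pos : ∀ x, x ≠ 0 → 0 < form x x

namespace InnerForm

variable {V : Type*} [AddCommGroup V] [Module ℝ V]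

/-- The orthogonal complement of a subspace. -/
def orth (B : InnerForm V) (W : Submodule ℝ V) : Submodule ℝ V := B.form.orthogonal W

theorem isCompl_orth [FiniteDimensional ℝ V] (B : InnerForm V) (W : Submodule ℝ V) :
    IsCompl W (B.orth W) := by
  have hr : B.form.IsRefl := fun x y h => by rw [B.symm, h]
  rw [orth, LinearMap.BilinForm.isCompl_orthogonal_iff_disjoint hr, Submodule.disjoint_def]
  intro x hx hx'
  by_contra h0
  have h1 : B.form x x = 0 := hx' x hx
  exact absurd (B.pos x h0) (by rw [h1]; exact lt_irrefl _)

/-- The orthogonal projection onto a subspace. -/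
def proj [FiniteDimensional ℝ V] (B : InnerForm V) (W : Submodule ℝ V) : V →ₗ[ℝ] W :=
  Submodule.projectionOnto W (B.orth W) (B.isCompl_orth W)

end InnerForm

/-- The norm `‖f‖_*` on the subspace `W` dual to the norm of the ambient space with respect to the
inner product `B`. -/
def dualNorm {V : Type*} [NormedAddCommGroup V] [NormedSpace ℝ V] (B : InnerForm V)
    (W : Submodule ℝ V) (f : V) : ℝ :=
  sSup {r | ∃ g ∈ W, ‖g‖ ≤ 1 ∧ r = B.form f g}

/-- The filter `σ → 0` on the set of mesh parameters. -/
def meshFilter (Sg : Set ℝ) : Filter Sg := comap (fun σ : Sg => (σ : ℝ)) (𝓝 0)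

/-- A family of linear reconstruction operators is quasi-isometric for the discrete `L¹` norm and
the total variation norm, uniformly in the mesh parameter. -/
def QuasiIsometric {ι α : Type*} [MeasurableSpace α] {n m : ℕ} {V : ι → Type*}
    [∀ σ, NormedAddCommGroup (V σ)] [∀ σ, NormedSpace ℝ (V σ)]
    (rec : ∀ σ, V σ →ₗ[ℝ] MatMeasure α n m) : Prop :=
  ∃ C : ℝ, 0 < C ∧ ∀ σ f, C⁻¹ * ‖f‖ ≤ (rec σ f).tv ∧ (rec σ f).tv ≤ C * ‖f‖

section Discrete

variable {Ω : Set (Eu d)} {Sg : Set ℝ} {Xb Y : Sg → Type*}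
  [∀ σ, NormedAddCommGroup (Xb σ)] [∀ σ, NormedSpace ℝ (Xb σ)] [∀ σ, FiniteDimensional ℝ (Xb σ)]
  [∀ σ, NormedAddCommGroup (Y σ)] [∀ σ, NormedSpace ℝ (Y σ)] [∀ σ, FiniteDimensional ℝ (Y σ)]

/-- The spatial discrete modules. The norms of `Xb σ` (the space `X̄_σ`) and `Y σ` are the discrete
`L¹` norms. -/
structure DiscreteModules (Ω : Set (Eu d)) (n k : ℕ) (Sg : Set ℝ) (Xb Y : Sg → Type*)
    [∀ σ, NormedAddCommGroup (Xb σ)] [∀ σ, NormedSpace ℝ (Xb σ)] [∀ σ, FiniteDimensional ℝ (Xb σ)]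
    [∀ σ, NormedAddCommGroup (Y σ)] [∀ σ, NormedSpace ℝ (Y σ)]
    [∀ σ, FiniteDimensional ℝ (Y σ)] where
  /-- the inner product of `X̄_σ` -/
  ipX : ∀ σ, InnerForm (Xb σ)
  /-- the inner product of `Y_σ` -/
  ipY : ∀ σ, InnerForm (Y σ)
  /-- the subspace `X_σ` of `X̄_σ` -/
  X : ∀ σ, Submodule ℝ (Xb σ)
  /-- the linear cone `X_{σ,+}` in `X_σ` -/
  Xpos : ∀ σ, Set (Xb σ)
  Xpos_subset : ∀ σ, Xpos σ ⊆ X σ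
  Xpos_cone : ∀ σ, ∀ x ∈ Xpos σ, ∀ c : ℝ, 0 < c → c • x ∈ Xpos σ
  /-- the quasi-isometric reconstruction on `X̄_σ` -/
  recX : ∀ σ, Xb σ →ₗ[ℝ] MatMeasure Ω n n
  /-- the quasi-isometric reconstruction on `Y_σ` -/
  recY : ∀ σ, Y σ →ₗ[ℝ] MatMeasure Ω n k
  recX_quasi : QuasiIsometric recX
  recY_quasi : QuasiIsometric recY
  recX_symm : ∀ σ, ∀ x ∈ X σ, (recX σ x).IsSymm
  recX_antisymm : ∀ σ, ∀ x ∈ (ipX σ).orth (X σ), (recX σ x).IsAntisymm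
  recX_pos : ∀ σ, ∀ x ∈ Xpos σ, (recX σ x).IsPosSemidef
  /-- the discrete cost `𝒥_σ` -/
  J : ∀ σ, X σ × Y σ × Xb σ → ℝ≥0∞
  J_proper : ∀ σ, ∃ u, J σ u ≠ ⊤
  J_lsc : ∀ σ, LowerSemicontinuous (J σ)
  J_convex : ∀ σ u v (a b : ℝ), 0 ≤ a → 0 ≤ b → a + b = 1 →
    J σ (a • u + b • v) ≤ ENNReal.ofReal a * J σ u + ENNReal.ofReal b * J σ v
  J_homog_first : ∀ σ G q R (a : ℝ), 0 < a →
    J σ (a • G, q, R) = ENNReal.ofReal a⁻¹ * J σ (G, q, R)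
  J_homog_second : ∀ σ G q R (a : ℝ), a ≠ 0 →
    J σ (G, a • q, a • R) = ENNReal.ofReal (a ^ 2) * J σ (G, q, R)
  /-- the discrete derivation `D_σ` -/
  D : ∀ σ, Y σ →ₗ[ℝ] X σ

/-- Elements `(G, q, R)` of `X_σ^{N+1} × Y_σ^N × X̄_σ^N`. -/
structure DiscreteCurve (M : DiscreteModules Ω n k Sg Xb Y) (N : ℕ) (σ : Sg) where
  G : Fin (N + 1) → M.X σ
  q : Fin N → Y σ
  R : Fin N → Xb σ

namespace DiscreteCurve

variable {M : DiscreteModules Ω n k Sg Xb Y} {N : ℕ} {σ : Sg}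

/-- The discrete action functional with time step `τ = 1/N`. -/
def action (c : DiscreteCurve M N σ) : ℝ≥0∞ :=
  (N : ℝ≥0∞)⁻¹ *
    ∑ j : Fin N, M.J σ ((1 / 2 : ℝ) • (c.G j.castSucc + c.G j.succ), c.q j, c.R j)

/-- Membership in `𝒞ℰ_{τ,σ}([0,1]; a, b)` with `τ = 1/N`: the discrete continuity equation, the
endpoint conditions and `G_i ∈ X_{σ,+}`. -/
structure Connects (c : DiscreteCurve M N σ) (a b : Xb σ) : Prop where
  equation : ∀ j : Fin N, (N : ℝ) • (c.G j.succ - c.G j.castSucc) =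
    -M.D σ (c.q j) + (M.ipX σ).proj (M.X σ) (c.R j)
  start : (c.G 0 : Xb σ) = a
  finish : (c.G (Fin.last N) : Xb σ) = b
  pos : ∀ i, (c.G i : Xb σ) ∈ M.Xpos σ

end DiscreteCurve

/-- The limit superior, as `(τ, σ) → 0`, of the discrete actions of a family of discrete curves
indexed by `(τ, σ) = (1/N, σ)`. -/
def limsupAction {M : DiscreteModules Ω n k Sg Xb Y}
    (γ : ∀ (N : ℕ) (σ : Sg), DiscreteCurve M N σ) : ℝ≥0∞ :=
  limsup (fun p : ℕ × Sg => (γ p.1 p.2).action) (atTop ×ˢ meshFilter Sg)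

/-- Families of sampling operators. -/
structure Sampling (M : DiscreteModules Ω n k Sg Xb Y) where
  SX : ∀ σ, C(Ω, Mat n n) →L[ℝ] Xb σ
  SY : ∀ σ, C(Ω, Mat n k) →L[ℝ] Y σ
  SX_symm : ∀ σ (Φ : C(Ω, Mat n n)), (∀ x, (Φ x)ᵀ = Φ x) → SX σ Φ ∈ M.X σ
  SX_antisymm : ∀ σ (Φ : C(Ω, Mat n n)), (∀ x, (Φ x)ᵀ = -Φ x) →
    SX σ Φ ∈ (M.ipX σ).orth (M.X σ)
  /-- smooth uniformly positive definite fields are sampled to elements of the cone `X_{σ,+}` -/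
  SX_pos : ∀ σ (f : Eu d → Mat n n), SmoothField f → ∀ η : ℝ, 0 < η →
    (∀ x ∈ Ω, (f x - η • (1 : Mat n n)).PosSemidef) → SX σ (toC Ω f) ∈ M.Xpos σ

namespace Sampling

variable {M : DiscreteModules Ω n k Sg Xb Y}

/-- The consistency error `e_{σ,q} = D_σ S_Y q - S_X D q`. -/
def err (S : Sampling M) (P : DiffOp d n k) (σ : Sg) (q : Eu d → Mat n k) : Xb σ :=
  (M.D σ (S.SY σ (toC Ω q)) : Xb σ) - S.SX σ (toC Ω (P.D q))

/-- Consistency of sampling operators. -/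
structure Consistent (S : Sampling M) (P : DiffOp d n k) : Prop where
  derivation : ∃ ε : Sg → ℝ, (∀ σ, 0 ≤ ε σ) ∧ Tendsto ε (meshFilter Sg) (𝓝 0) ∧
    ∀ (φ : Eu d → Mat n k), SmoothField φ → P.BoundaryCondition Ω φ → ∀ σ,
      dualNorm (M.ipX σ) (M.X σ) (S.err P σ φ) ≤ ε σ * norm2 Ω φ
  action : ∀ E η : ℝ, 0 < E → 0 < η → ∃ (C : ℝ) (ε : Sg → ℝ), 0 < C ∧ (∀ σ, 0 ≤ ε σ) ∧
    Tendsto ε (meshFilter Sg) (𝓝 0) ∧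
    ∀ (G : Eu d → Mat n n) (q : Eu d → Mat n k) (R : Eu d → Mat n n),
      SmoothField G → SmoothField q → SmoothField R →
      norm2 Ω G ≤ E → norm2 Ω q ≤ E → norm2 Ω R ≤ E →
      (∀ x ∈ Ω, (G x - η • (1 : Mat n n)).PosSemidef) → P.BoundaryCondition Ω q →
      ∀ (σ : Sg) (g : M.X σ), (g : Xb σ) = S.SX σ (toC Ω G) →
        M.J σ (g, S.SY σ (toC Ω q), S.SX σ (toC Ω R) + S.err P σ q) ≤
          spatialAction Ω G q R + ENNReal.ofReal (C * ε σ)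

end Sampling

/-- The assumption on the endpoints: for every curve `μ ∈ 𝒞ℰ_∞([0,1]; G₀, G₁)` and `i = 0, 1`, for
small `ε > 0` there are discrete curves connecting the discrete endpoint `Gσ i` to the sample of the
endpoint `G^ε(i, ·)` of the `ε`-regularization of `μ`, and the limit superior `ω_{ε,i}` of their
actions tends to zero as `ε → 0`. -/
def EndpointAssumption (P : DiffOp d n k) (M : DiscreteModules Ω n k Sg Xb Y) (S : Sampling M)
    (G : Fin 2 → MatMeasure Ω n n) (Gσ : Fin 2 → ∀ σ, Xb σ) (reg : RegularizationData Ω n) : Prop :=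
  ∀ μ : CurveMeasure Ω n k, μ.MemCEInfty P G → ∀ i : Fin 2,
    ∃ ε₀ : ℝ, 0 < ε₀ ∧ ∃ γ : ℝ → ∀ (N : ℕ) (σ : Sg), DiscreteCurve M N σ,
      (∀ ε ∈ Ioo 0 ε₀, ∀ N ≥ 2, ∀ σ,
        (γ ε N σ).Connects (Gσ i σ) (S.SX σ (toC Ω (reg.regG ε G μ ((i : ℕ) : ℝ))))) ∧
      Tendsto (fun ε => limsupAction (γ ε)) (𝓝[>] 0) (𝓝 0)

end Discrete

end WBScheme

end

open WBScheme

noncomputable section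

namespace WBScheme

variable {d n k : ℕ}

/-! Regularize `μ`, sample the smooth curve in time and space, and repair the endpoints with the
curves from (A*).

Fix a small `ε`. The regularized curve is smooth and satisfies `G^ε ⪰ ε I`. The dilation by `1 + Lε`
moves every boundary point to distance at least `ε` from `Ω`, where the mollifier no longer sees the
measure; hence the regularized flux vanishes on `∂Ω` (`le_norm_expand_sub`, `kerq_eq_zero`). So the
consistency of the sampling operators applies.

The discrete flux and reaction come from averaging over a time step, that is, from replacing the
time mollifier by its average `κ` over `[a, b]` (`avgKernel`). The derivative of `κ` is a finite
difference of the mollifier, so testing the weak continuity equation with `κ(t) g(y - x) A` gives an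
exact time-discrete equation (`regG_sub_regG`). The dilation multiplies derivatives by `1 + Lε`; by
(C.2) this can be undone on the columns seen by the first-order part alone. After sampling, the
remaining defect of `D_σ` is added to the reaction, and the discrete continuity equation holds
exactly (`exists_discrete_regularized`).

For the action, `J` is bounded below by the functions `lin B C`, which are linear in `(X, Y, Z)`,
and at positive definite `X` one of them attains it. This yields Jensen's inequality for integrals
against nonnegative kernels (`ofReal_lin_scalarIntegral_le`, `cost_le_lin`). Integration in `x` and
summation over the time steps use up the mass of the mollifiers, which leaves the bound `(1 + 2ε)
𝒥_Q(μ)` (`eventually_sum_spatialAction_le`). The discrete action evaluates `G` at the midpoint of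
two time values and not at the time average; the difference is of order `τ` and is absorbed by the
`ε I` coming from the lift (`quad_midpoint_ge`).

Finally the (A*) curve at the start, the sampled curve and the time-reversed (A*) curve at the end
are concatenated, the outer two receiving about `1/(p + 2)` of the time each. By homogeneity the
middle action is multiplied by at most `1 + 2/p` and the outer ones by at most `2(p + 2)`
(`exists_glued_family`). Choosing `p` large and then `ε` small in dependence on `p` keeps the total
excess in the limit `(τ, σ) → 0` below `η`. -/

/-! ### Smoothing by a smooth kernel -/

section Smoothing

variable {Z : Type*} [MeasurableSpace Z]

/-- The superposition `y ↦ ∫ w(z) g(y - p(z)) dλ(z)` of translates of `g`. -/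
def smooth {F : Type} [NormedAddCommGroup F] [NormedSpace ℝ F] (lam : Measure Z) (w : Z → ℝ)
    (p : Z → Eu d) (g : Eu d → F) (y : Eu d) : F :=
  ∫ z, w z • g (y - p z) ∂lam

variable {lam : Measure Z} {w : Z → ℝ} {p : Z → Eu d}

theorem integrable_smooth {F : Type} [NormedAddCommGroup F] [NormedSpace ℝ F]
    [FiniteDimensional ℝ F]
    (hw : Integrable w lam) (hp : Measurable p) {g : Eu d → F} (hg : Continuous g)
    (hgc : HasCompactSupport g) (y : Eu d) : Integrable (fun z => w z • g (y - p z)) lam := by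
  obtain ⟨C, hC⟩ := hg.bounded_above_of_compact_support hgc
  let _ : MeasurableSpace F := borel F
  have : BorelSpace F := ⟨rfl⟩
  refine hw.smul_of_top_left (memLp_top_of_bound
    (hg.measurable.comp (measurable_const.sub hp)).aestronglyMeasurable C
    (Eventually.of_forall fun z => hC _))

/-- The derivative falls on `g` and is dominated by `‖w‖` times the supremum of `‖fderiv ℝ g‖`. The
weight only has to be integrable, so densities of arbitrary finite measures are admissible. -/
theorem hasFDerivAt_smooth {F : Type} [NormedAddCommGroup F] [NormedSpace ℝ F]
    [FiniteDimensional ℝ F]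
    (hw : Integrable w lam) (hp : Measurable p) {g : Eu d → F} (hg : ContDiff ℝ ∞ g)
    (hgc : HasCompactSupport g) (y : Eu d) :
    HasFDerivAt (smooth lam w p g) (smooth lam w p (fderiv ℝ g) y) y := by
  have hg' : Continuous (fderiv ℝ g) := hg.continuous_fderiv (by simp)
  obtain ⟨C, hC⟩ := hg'.bounded_above_of_compact_support (hgc.fderiv ℝ)
  refine hasFDerivAt_integral_of_dominated_of_fderiv_le (bound := fun z => ‖w z‖ * C)
    (F' := fun x z => w z • fderiv ℝ g (x - p z))
    (s := univ) univ_mem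
    (Eventually.of_forall fun x => (integrable_smooth hw hp hg.continuous hgc x).1)
    (integrable_smooth hw hp hg.continuous hgc y) (integrable_smooth hw hp hg' (hgc.fderiv ℝ) y).1
    (Eventually.of_forall fun z x _ => ?_) (hw.norm.mul_const C)
    (Eventually.of_forall fun z x _ => ?_)
  · rw [norm_smul]
    exact mul_le_mul_of_nonneg_left (hC _) (norm_nonneg _)
  · have h1 : HasFDerivAt (fun x => g (x - p z)) (fderiv ℝ g (x - p z)) x := by
      have := ((hg.differentiable (by simp)) (x - p z)).hasFDerivAt.comp x
        ((hasFDerivAt_id x).sub_const (p z))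
      simpa [Function.comp_def] using this
    exact h1.const_smul (w z)

theorem contDiff_smooth {g : Eu d → ℝ}
    (hw : Integrable w lam) (hp : Measurable p) (hg : ContDiff ℝ ∞ g)
    (hgc : HasCompactSupport g) : ContDiff ℝ ∞ (smooth lam w p g) := by
  -- The target space varies in the induction, since the derivative of an `F`-valued field takes
  -- values in the linear maps into `F`.
  have key : ∀ (m : ℕ) (F : Type) [NormedAddCommGroup F] [NormedSpace ℝ F] [FiniteDimensional ℝ F]
      (g : Eu d → F), ContDiff ℝ ∞ g → HasCompactSupport g → ContDiff ℝ m (smooth lam w p g) := by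
    intro m
    induction m with
    | zero =>
      intro F _ _ _ g hg hgc
      exact contDiff_zero.2 (continuous_iff_continuousAt.2 fun y =>
        (hasFDerivAt_smooth hw hp hg hgc y).continuousAt)
    | succ m ih =>
      intro F _ _ _ g hg hgc
      rw [Nat.cast_add, Nat.cast_one, contDiff_succ_iff_hasFDerivAt]
      exact ⟨_, ih _ _ (hg.fderiv_right (by simp)) (hgc.fderiv ℝ),
        hasFDerivAt_smooth hw hp hg hgc⟩
  exact contDiff_infty.2 fun m => key m ℝ g hg hgc

end Smoothing

/-! ### Partial derivatives and uniform bounds up to order two. -/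

/-- The directional derivative `∂_c f` of a scalar function. -/
def dd (c : Fin d) (f : Eu d → ℝ) (x : Eu d) : ℝ := fderiv ℝ f x (EuclideanSpace.single c 1)

theorem pd_apply {n m : ℕ} (c : Fin d) (f : Eu d → Mat n m) (x : Eu d) (i : Fin n) (j : Fin m) :
    pd c f x i j = dd c (fun y => f y i j) x := rfl

theorem contDiff_dd {f : Eu d → ℝ} (hf : ContDiff ℝ ∞ f) (c : Fin d) : ContDiff ℝ ∞ (dd c f) :=
  (hf.fderiv_right (by simp)).clm_apply contDiff_const

theorem hasCompactSupport_dd {f : Eu d → ℝ} (hf : HasCompactSupport f) (c : Fin d) :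
    HasCompactSupport (dd c f) :=
  (hf.fderiv ℝ).comp_left (g := fun T : Eu d →L[ℝ] ℝ => T (EuclideanSpace.single c 1)) (by simp)

theorem dd_add {f g : Eu d → ℝ} (hf : ContDiff ℝ ∞ f) (hg : ContDiff ℝ ∞ g) (c : Fin d) :
    dd c (fun x => f x + g x) = fun x => dd c f x + dd c g x := by
  funext x
  unfold dd
  rw [fderiv_fun_add (hf.differentiable (by simp) x) (hg.differentiable (by simp) x)]
  rfl

theorem dd_const_mul {f : Eu d → ℝ} (hf : ContDiff ℝ ∞ f) (a : ℝ) (c : Fin d) :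
    dd c (fun x => a * f x) = fun x => a * dd c f x := by
  funext x
  unfold dd
  rw [fderiv_const_mul (hf.differentiable (by simp) x)]
  rfl

theorem dd_comp_affine {f : Eu d → ℝ} (hf : ContDiff ℝ ∞ f) (z : Eu d) (a : ℝ) (c : Fin d) :
    dd c (fun x => f (z + a • (x - z))) = fun x => a * dd c f (z + a • (x - z)) := by
  funext x
  have h1 : HasFDerivAt (fun x : Eu d => z + a • (x - z)) (a • ContinuousLinearMap.id ℝ (Eu d)) x :=
    (((hasFDerivAt_id x).sub_const z).const_smul a).const_add z
  have h2 := ((hf.differentiable (by simp)) (z + a • (x - z))).hasFDerivAt.comp x h1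
  unfold dd
  rw [show (fun x => f (z + a • (x - z))) = f ∘ fun x : Eu d => z + a • (x - z) from rfl,
    h2.fderiv]
  simp

theorem dd_comp_sub {f : Eu d → ℝ} (hf : ContDiff ℝ ∞ f) (y x : Eu d) (c : Fin d) :
    dd c (fun x => f (y - x)) x = - dd c f (y - x) := by
  have h1 : HasFDerivAt (fun x : Eu d => y - x) (-ContinuousLinearMap.id ℝ (Eu d)) x :=
    (hasFDerivAt_id x).const_sub y
  have h2 := ((hf.differentiable (by simp)) (y - x)).hasFDerivAt.comp x h1
  unfold dd
  rw [show (fun x => f (y - x)) = f ∘ fun x : Eu d => y - x from rfl, h2.fderiv]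
  simp

theorem dd_smooth {Z : Type*} [MeasurableSpace Z] {lam : Measure Z} {w : Z → ℝ} {p : Z → Eu d}
    (hw : Integrable w lam) (hp : Measurable p) {g : Eu d → ℝ} (hg : ContDiff ℝ ∞ g)
    (hgc : HasCompactSupport g) (c : Fin d) :
    dd c (smooth lam w p g) = smooth lam w p (dd c g) := by
  funext y
  unfold dd
  rw [(hasFDerivAt_smooth hw hp hg hgc y).fderiv]
  unfold smooth
  rw [ContinuousLinearMap.integral_apply
    (integrable_smooth hw hp (hg.continuous_fderiv (by simp)) (hgc.fderiv ℝ) y)]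
  rfl

/-- A smooth function whose partial derivatives of order at most two are bounded by `B`. -/
structure SmoothBdd (f : Eu d → ℝ) (B : ℝ) : Prop where
  smooth : ContDiff ℝ ∞ f
  zero : ∀ x, |f x| ≤ B
  one : ∀ c x, |dd c f x| ≤ B
  two : ∀ c c' x, |dd c (dd c' f) x| ≤ B

namespace SmoothBdd

theorem nonneg {f : Eu d → ℝ} {B : ℝ} (h : SmoothBdd f B) : 0 ≤ B :=
  (abs_nonneg _).trans (h.zero 0)

theorem mono {f : Eu d → ℝ} {B B' : ℝ} (h : SmoothBdd f B) (hB : B ≤ B') : SmoothBdd f B' :=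
  ⟨h.smooth, fun x => (h.zero x).trans hB, fun c x => (h.one c x).trans hB,
    fun c c' x => (h.two c c' x).trans hB⟩

theorem add {f g : Eu d → ℝ} {A B : ℝ} (hf : SmoothBdd f A) (hg : SmoothBdd g B) :
    SmoothBdd (fun x => f x + g x) (A + B) := by
  refine ⟨hf.smooth.add hg.smooth, fun x => ?_, fun c x => ?_, fun c c' x => ?_⟩
  · exact (abs_add_le _ _).trans (add_le_add (hf.zero x) (hg.zero x))
  · rw [dd_add hf.smooth hg.smooth]
    exact (abs_add_le _ _).trans (add_le_add (hf.one c x) (hg.one c x))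
  · rw [dd_add hf.smooth hg.smooth, dd_add (contDiff_dd hf.smooth c') (contDiff_dd hg.smooth c')]
    exact (abs_add_le _ _).trans (add_le_add (hf.two c c' x) (hg.two c c' x))

theorem const_mul {f : Eu d → ℝ} {A : ℝ} (hf : SmoothBdd f A) (a : ℝ) :
    SmoothBdd (fun x => a * f x) (|a| * A) := by
  refine ⟨contDiff_const.mul hf.smooth, fun x => ?_, fun c x => ?_, fun c c' x => ?_⟩
  · rw [abs_mul]
    exact mul_le_mul_of_nonneg_left (hf.zero x) (abs_nonneg a)
  · rw [dd_const_mul hf.smooth, abs_mul]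
    exact mul_le_mul_of_nonneg_left (hf.one c x) (abs_nonneg a)
  · rw [dd_const_mul hf.smooth, dd_const_mul (contDiff_dd hf.smooth c'), abs_mul]
    exact mul_le_mul_of_nonneg_left (hf.two c c' x) (abs_nonneg a)

/-- Each derivative brings out one factor `a`; since `1 ≤ a`, the factor `a ^ 2` serves all orders
up to two. -/
theorem comp_affine {f : Eu d → ℝ} {A : ℝ} (hf : SmoothBdd f A) (z : Eu d) {a : ℝ} (ha : 1 ≤ a) :
    SmoothBdd (fun x => f (z + a • (x - z))) (a ^ 2 * A) := by
  have h0 := hf.nonneg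
  refine ⟨hf.smooth.comp (contDiff_const.add ((contDiff_id.sub contDiff_const).const_smul a)),
    fun x => (hf.zero _).trans ?_, fun c x => ?_, fun c c' x => ?_⟩
  · exact le_mul_of_one_le_left h0 (one_le_pow₀ ha)
  · rw [dd_comp_affine hf.smooth, abs_mul, abs_of_nonneg (by linarith)]
    exact mul_le_mul (by nlinarith) (hf.one _ _) (abs_nonneg _) (by positivity)
  · rw [dd_comp_affine hf.smooth, dd_const_mul (f := fun x => dd c' f (z + a • (x - z)))
      ((contDiff_dd hf.smooth c').comp
        (contDiff_const.add ((contDiff_id.sub contDiff_const).const_smul a))),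
      dd_comp_affine (contDiff_dd hf.smooth c'), abs_mul, abs_mul, abs_of_nonneg (by linarith),
      ← mul_assoc, ← pow_two]
    exact mul_le_mul_of_nonneg_left (hf.two _ _ _) (by positivity)

theorem of_compactSupport {g : Eu d → ℝ} (hg : ContDiff ℝ ∞ g) (hgc : HasCompactSupport g) :
    ∃ B, SmoothBdd g B := by
  obtain ⟨C0, h0⟩ := hg.continuous.bounded_above_of_compact_support hgc
  choose C1 h1 using fun c => (contDiff_dd hg c).continuous.bounded_above_of_compact_support
    (hasCompactSupport_dd hgc c)
  choose C2 h2 using fun c c' => (contDiff_dd (contDiff_dd hg c') c).continuous.bounded_above_of_compact_support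
    (hasCompactSupport_dd (hasCompactSupport_dd hgc c') c)
  have p0 : 0 ≤ C0 := (norm_nonneg _).trans (h0 0)
  have p1 : ∀ c, 0 ≤ C1 c := fun c => (norm_nonneg _).trans (h1 c 0)
  have p2 : ∀ c c', 0 ≤ C2 c c' := fun c c' => (norm_nonneg _).trans (h2 c c' 0)
  have s1 : 0 ≤ ∑ c, C1 c := Finset.sum_nonneg fun c _ => p1 c
  have s2 : 0 ≤ ∑ c, ∑ c', C2 c c' :=
    Finset.sum_nonneg fun c _ => Finset.sum_nonneg fun c' _ => p2 c c'
  refine ⟨C0 + ∑ c, C1 c + ∑ c, ∑ c', C2 c c', hg, fun x => ?_, fun c x => ?_, fun c c' x => ?_⟩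
  · have := h0 x
    rw [Real.norm_eq_abs] at this
    linarith
  · have := h1 c x
    rw [Real.norm_eq_abs] at this
    have := Finset.single_le_sum (fun c _ => p1 c) (Finset.mem_univ c)
    linarith
  · have := h2 c c' x
    rw [Real.norm_eq_abs] at this
    have h3 := Finset.single_le_sum (fun c' _ => p2 c c') (Finset.mem_univ c')
    have h4 := Finset.single_le_sum (f := fun c => ∑ c', C2 c c')
      (fun c _ => Finset.sum_nonneg fun c' _ => p2 c c') (Finset.mem_univ c)
    linarith

/-- The weight enters only through its `L¹` mass. This is the source of bounds on the regularized
fields that are uniform over the time steps. -/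
theorem smoothing {Z : Type*} [MeasurableSpace Z] {lam : Measure Z} {w : Z → ℝ} {p : Z → Eu d}
    (hw : Integrable w lam) (hp : Measurable p) {g : Eu d → ℝ} {B : ℝ} (hg : SmoothBdd g B)
    (hgc : HasCompactSupport g) :
    SmoothBdd (WBScheme.smooth lam w p g) (B * ∫ z, |w z| ∂lam) := by
  have key : ∀ h : Eu d → ℝ, (∀ x, |h x| ≤ B) → ∀ y, |WBScheme.smooth lam w p h y| ≤
      B * ∫ z, |w z| ∂lam := by
    intro h hh y
    rw [← integral_const_mul, ← Real.norm_eq_abs]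
    unfold WBScheme.smooth
    refine norm_integral_le_of_norm_le (hw.norm.const_mul B)
      (Eventually.of_forall fun z => ?_)
    rw [norm_smul, mul_comm]
    exact mul_le_mul_of_nonneg_right (hh _) (norm_nonneg _)
  refine ⟨contDiff_smooth hw hp hg.smooth hgc, key _ hg.zero, fun c x => ?_, fun c c' x => ?_⟩
  · rw [dd_smooth hw hp hg.smooth hgc]
    exact key _ (hg.one c) x
  · rw [dd_smooth hw hp hg.smooth hgc, dd_smooth hw hp (contDiff_dd hg.smooth c')
      (hasCompactSupport_dd hgc c')]
    exact key _ (hg.two c c') x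

end SmoothBdd

/-! ### From entrywise bounds to the `C²` norm. -/

theorem dot_eq_sum {n m : ℕ} (A B : Mat n m) : dot A B = ∑ i, ∑ j, A i j * B i j := by
  rw [dot, Matrix.trace, Finset.sum_comm]
  simp [Matrix.mul_apply]

/-- The sharp constant would be `√(n m)`; the cruder one is enough and keeps square roots out of the
estimates. -/
theorem frob_le {n m : ℕ} (A : Mat n m) {B : ℝ} (hB : 0 ≤ B) (h : ∀ i j, |A i j| ≤ B) :
    frob A ≤ (n * m + 1) * B := by
  unfold frob
  apply Real.sqrt_le_iff.2 ⟨by positivity, ?_⟩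
  rw [dot_eq_sum]
  have h1 : ∑ i, ∑ j, A i j * A i j ≤ ∑ _i : Fin n, ∑ _j : Fin m, B * B := by
    refine Finset.sum_le_sum fun i _ => Finset.sum_le_sum fun j _ => ?_
    rw [← abs_mul_abs_self]
    exact mul_le_mul (h i j) (h i j) (abs_nonneg _) hB
  refine h1.trans ?_
  simp only [Finset.sum_const, Finset.card_univ, Fintype.card_fin, nsmul_eq_mul]
  nlinarith [mul_nonneg hB hB, mul_nonneg (Nat.cast_nonneg (α := ℝ) n) (Nat.cast_nonneg (α := ℝ) m),
    mul_nonneg (mul_nonneg (Nat.cast_nonneg (α := ℝ) n) (Nat.cast_nonneg (α := ℝ) m))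
      (mul_nonneg hB hB), mul_nonneg (sq_nonneg ((n:ℝ) * m)) (mul_nonneg hB hB)]

theorem supNorm_le {n m : ℕ} (Ω : Set (Eu d)) (f : Eu d → Mat n m) {B : ℝ} (hB : 0 ≤ B)
    (h : ∀ i j x, |f x i j| ≤ B) : supNorm Ω f ≤ (n * m + 1) * B :=
  Real.iSup_le (fun x => frob_le _ hB fun i j => h i j x) (by positivity)

theorem norm2_le {n m : ℕ} (Ω : Set (Eu d)) (f : Eu d → Mat n m) {B : ℝ} (hB : 0 ≤ B)
    (h : ∀ i j, SmoothBdd (fun x => f x i j) B) :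
    norm2 Ω f ≤ (1 + d + d * d) * ((n * m + 1) * B) := by
  unfold norm2
  have hK : 0 ≤ (n * m + 1) * B := by positivity
  have h0 := supNorm_le Ω f hB fun i j x => (h i j).zero x
  have h1 : ∑ c, supNorm Ω (pd c f) ≤ d * ((n * m + 1) * B) := by
    refine (Finset.sum_le_sum fun c _ => supNorm_le Ω (pd c f) hB
      fun i j x => (h i j).one c x).trans ?_
    simp
  have h2 : ∑ c, ∑ c' ∈ Finset.Ici c, supNorm Ω (pd c (pd c' f)) ≤
      d * d * ((n * m + 1) * B) := by
    calc _ ≤ ∑ _c : Fin d, ∑ _c' : Fin d, ((n * m + 1) * B) := by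
          refine Finset.sum_le_sum fun c _ => ?_
          refine (Finset.sum_le_sum fun c' _ => supNorm_le Ω (pd c (pd c' f)) hB
            fun i j x => (h i j).two c c' x).trans ?_
          exact Finset.sum_le_sum_of_subset_of_nonneg (Finset.subset_univ _) fun _ _ _ => hK
      _ = _ := by simp [mul_assoc]
  linarith

/-! ### The Frobenius inner product -/

section Dot

variable {m : ℕ}

theorem dot_comm (A B : Mat n m) : dot A B = dot B A := by
  simp [dot_eq_sum, mul_comm]

theorem dot_add_left (A B C : Mat n m) : dot (A + B) C = dot A C + dot B C := by
  simp [dot, Matrix.add_mul]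

theorem dot_sub_right (A B C : Mat n m) : dot A (B - C) = dot A B - dot A C := by
  simp [dot, Matrix.mul_sub]

theorem dot_sub_left (A B C : Mat n m) : dot (A - B) C = dot A C - dot B C := by
  simp [dot, Matrix.sub_mul]

theorem dot_neg_left (A B : Mat n m) : dot (-A) B = -dot A B := by
  simp [dot]

theorem dot_smul_right (a : ℝ) (A B : Mat n m) : dot A (a • B) = a * dot A B := by
  simp [dot]

theorem dot_smul_left (a : ℝ) (A B : Mat n m) : dot (a • A) B = a * dot A B := by
  simp [dot]

theorem dot_sum_left {ι : Type*} (s : Finset ι) (f : ι → Mat n m) (B : Mat n m) :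
    dot (∑ c ∈ s, f c) B = ∑ c ∈ s, dot (f c) B := by
  simp [dot, Matrix.sum_mul, Matrix.transpose_sum, Matrix.trace_sum]

theorem dot_mul_right_symm {X : Mat n n} (hX : Xᵀ = X) (A B : Mat n m) :
    dot A (X * B) = dot (X * A) B := by
  simp [dot, Matrix.transpose_mul, hX, Matrix.mul_assoc]

theorem dot_transpose (A B : Mat n m) : dot Aᵀ Bᵀ = dot A B := by
  simp only [dot_eq_sum, Matrix.transpose_apply]
  exact Finset.sum_comm

theorem dot_adj (L : Mat n n →ₗ[ℝ] Mat n k) (q : Mat n k) (A : Mat n n) :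
    dot (adj L q) A = dot q (L A) := by
  conv_rhs => rw [Matrix.matrix_eq_sum_single A]
  rw [dot_eq_sum]
  have h : ∀ s : Finset (Fin n), ∀ f : Fin n → Mat n k,
      dot q (∑ i ∈ s, f i) = ∑ i ∈ s, dot q (f i) := by
    intro s f
    rw [dot_comm, dot_sum_left]
    simp [dot_comm]
  rw [map_sum, h]
  refine Finset.sum_congr rfl fun i _ => ?_
  rw [map_sum, h]
  refine Finset.sum_congr rfl fun j _ => ?_
  rw [show Matrix.single i j (A i j) = A i j • Matrix.single i j (1 : ℝ) by
    simp [Matrix.smul_single], map_smul, dot_smul_right, mul_comm]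
  rfl

/-- Test with `S = A - B`. The weak continuity equation only sees symmetric test fields, and this
recovers matrix identities from it. -/
theorem eq_of_dot_symm {A B : Mat n n} (hA : Aᵀ = A) (hB : Bᵀ = B)
    (h : ∀ S : Mat n n, Sᵀ = S → dot A S = dot B S) : A = B := by
  have h1 : dot (A - B) (A - B) = 0 := by
    rw [dot_sub_left, h _ (by rw [Matrix.transpose_sub, hA, hB]), sub_self]
  rw [dot, ← Matrix.conjTranspose_eq_transpose_of_trivial,
    Matrix.trace_conjTranspose_mul_self_eq_zero_iff] at h1
  exact sub_eq_zero.1 h1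

theorem posSemidef_iff {X : Mat n n} :
    X.PosSemidef ↔ Xᵀ = X ∧ ∀ v : Fin n → ℝ, 0 ≤ v ⬝ᵥ (X *ᵥ v) := by
  rw [Matrix.posSemidef_iff_dotProduct_mulVec, Matrix.IsHermitian,
    Matrix.conjTranspose_eq_transpose_of_trivial]
  simp

theorem dot_mul_self_nonneg {X : Mat n n} (hX : X.PosSemidef) (B : Mat n m) :
    0 ≤ dot B (X * B) := by
  have := (hX.conjTranspose_mul_mul_same B).trace_nonneg
  rwa [Matrix.conjTranspose_eq_transpose_of_trivial, Matrix.mul_assoc] at this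

theorem dotProduct_mulVec_eq_sum (X : Mat n n) (v : Fin n → ℝ) :
    v ⬝ᵥ (X *ᵥ v) = ∑ i, ∑ j, v i * v j * X i j := by
  simp only [dotProduct, Matrix.mulVec, Finset.mul_sum]
  refine Finset.sum_congr rfl fun i _ => Finset.sum_congr rfl fun j _ => ?_
  ring

/-- By `2 |v i v j| ≤ v i ^ 2 + v j ^ 2`. It turns an entrywise error into a multiple of the
identity, which the lift can absorb. -/
theorem abs_dotProduct_mulVec_le {X : Mat n n} {K : ℝ} (h : ∀ i j, |X i j| ≤ K)
    (v : Fin n → ℝ) : |v ⬝ᵥ (X *ᵥ v)| ≤ n * K * (v ⬝ᵥ v) := by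
  have h0 : ∀ i j, |v i * v j * X i j| ≤ K * ((v i ^ 2 + v j ^ 2) / 2) := by
    intro i j
    have h1 : |v i * v j| ≤ (v i ^ 2 + v j ^ 2) / 2 := by
      rw [abs_le]
      constructor <;> nlinarith [sq_nonneg (v i + v j), sq_nonneg (v i - v j)]
    rw [abs_mul, mul_comm]
    exact mul_le_mul (h i j) h1 (abs_nonneg _) ((abs_nonneg _).trans (h i j))
  rw [dotProduct_mulVec_eq_sum]
  calc _ ≤ ∑ i, ∑ j, |v i * v j * X i j| :=
        (Finset.abs_sum_le_sum_abs _ _).trans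
          (Finset.sum_le_sum fun i _ => Finset.abs_sum_le_sum_abs _ _)
    _ ≤ ∑ i, ∑ j, K * ((v i ^ 2 + v j ^ 2) / 2) :=
        Finset.sum_le_sum fun i _ => Finset.sum_le_sum fun j _ => h0 i j
    _ = _ := by
        simp only [← Finset.mul_sum, add_div, Finset.sum_add_distrib, Finset.sum_const,
          Finset.card_univ, Fintype.card_fin, nsmul_eq_mul, dotProduct, ← pow_two,
          ← Finset.sum_div]
        ring

end Dot

/-! ### Duality for the infinitesimal cost -/

theorem transpose_of_isHermitian {X : Mat n n} (hX : X.IsHermitian) : Xᵀ = X := by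
  rwa [Matrix.IsHermitian, Matrix.conjTranspose_eq_transpose_of_trivial] at hX

/-- In an eigenbasis this is `x * x⁻¹ * x = x`, which also holds at `x = 0`. -/
theorem mul_pinv_mul {X : Mat n n} (hX : X.IsHermitian) : X * pinv X * X = X := by
  have h1 := hX.spectral_theorem
  rw [pinv, dif_pos hX, Matrix.IsHermitian.cfc]
  generalize hX.eigenvectorUnitary = U at *
  generalize hX.eigenvalues = l at *
  subst h1
  rw [← map_mul, ← map_mul, Matrix.diagonal_mul_diagonal, Matrix.diagonal_mul_diagonal]
  congr 2
  funext i
  simp only [Function.comp_apply]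
  by_cases h : l i = 0
  · simp [h]
  · simp [h]

/-- The affine minorants of the infinitesimal cost. -/
def lin (B : Mat n k) (C : Mat n n) (X : Mat n n) (Y : Mat n k) (Z : Mat n n) : ℝ :=
  dot B Y + dot C Z - 1 / 2 * (dot B (X * B) + dot C (X * C))

theorem exists_mul_of_range_le {m : ℕ} {X : Mat n n} {Y : Mat n m}
    (h : LinearMap.range Y.mulVecLin ≤ LinearMap.range X.mulVecLin) : ∃ W : Mat n m, Y = X * W := by
  have h1 : ∀ j : Fin m, ∃ w : Fin n → ℝ, X *ᵥ w = Y *ᵥ Pi.single j 1 := by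
    intro j
    have : Y.mulVecLin (Pi.single j 1) ∈ LinearMap.range X.mulVecLin := h ⟨_, rfl⟩
    obtain ⟨w, hw⟩ := this
    exact ⟨w, hw⟩
  choose w hw using h1
  refine ⟨Matrix.of fun i j => w j i, ?_⟩
  ext i j
  have := congrFun (hw j) i
  rw [Matrix.mulVec_single_one] at this
  rw [Matrix.mul_apply]
  exact this.symm

/-- With `Y = X * W` the right-hand side is `½ W · X W`, and the claim is the expansion of `0 ≤ (B -
W) · X (B - W)`. -/
theorem dot_sub_half_le {m : ℕ} {X : Mat n n} (hX : X.PosSemidef) {Y : Mat n m}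
    (h : LinearMap.range Y.mulVecLin ≤ LinearMap.range X.mulVecLin) (B : Mat n m) :
    dot B Y - 1 / 2 * dot B (X * B) ≤ 1 / 2 * dot Y (pinv X * Y) := by
  obtain ⟨W, rfl⟩ := exists_mul_of_range_le h
  have hs := transpose_of_isHermitian hX.1
  have h1 : dot (X * W) (pinv X * (X * W)) = dot W (X * W) := by
    rw [← dot_mul_right_symm hs, ← Matrix.mul_assoc, ← Matrix.mul_assoc, mul_pinv_mul hX.1]
  have h2 := dot_mul_self_nonneg hX (B - W)
  rw [Matrix.mul_sub, dot_sub_left, dot_sub_right, dot_sub_right] at h2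
  have h3 : dot W (X * B) = dot B (X * W) := by
    rw [dot_mul_right_symm hs, dot_comm]
  rw [h1]
  linarith

theorem lin_le_cost (B : Mat n k) (C : Mat n n) (X : Mat n n) (Y : Mat n k) (Z : Mat n n) :
    ENNReal.ofReal (lin B C X Y Z) ≤ cost X Y Z := by
  unfold cost
  split_ifs with h
  · apply ENNReal.ofReal_le_ofReal
    have h1 := dot_sub_half_le h.1 h.2.1 B
    have h2 := dot_sub_half_le h.1 h.2.2 C
    unfold lin
    linarith
  · exact le_top

/-- The optimal dual variables are `X⁻¹ Y` and `X⁻¹ Z`. Attainment is needed only for the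
regularized curve, which is positive definite; for the given curve, possibly degenerate, the
inequality `lin_le_cost` suffices. -/
theorem exists_cost_eq_lin {X : Mat n n} (hX : X.PosDef) (Y : Mat n k) (Z : Mat n n) :
    ∃ B C, cost X Y Z = ENNReal.ofReal (lin B C X Y Z) := by
  have hu := hX.isUnit
  have hdet := (Matrix.isUnit_iff_isUnit_det X).1 hu
  have hp : X * pinv X = 1 := by
    have h1 := mul_pinv_mul hX.isHermitian
    calc X * pinv X = X * pinv X * X * X⁻¹ := by
          rw [Matrix.mul_assoc (X * pinv X), Matrix.mul_nonsing_inv X hdet, Matrix.mul_one]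
      _ = 1 := by rw [h1, Matrix.mul_nonsing_inv X hdet]
  have hr : LinearMap.range X.mulVecLin = ⊤ := by
    rw [LinearMap.range_eq_top]
    intro v
    refine ⟨pinv X *ᵥ v, ?_⟩
    rw [Matrix.mulVecLin_apply, Matrix.mulVec_mulVec, hp, Matrix.one_mulVec]
  refine ⟨pinv X * Y, pinv X * Z, ?_⟩
  rw [cost, if_pos ⟨hX.posSemidef, by rw [hr]; exact le_top, by rw [hr]; exact le_top⟩]
  congr 1
  unfold lin
  rw [← Matrix.mul_assoc, ← Matrix.mul_assoc, hp, Matrix.one_mul, Matrix.one_mul,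
    dot_comm (pinv X * Y), dot_comm (pinv X * Z)]
  ring

/-- The supremum of the affine minorants of the infinitesimal cost. -/
def costReg (X : Mat n n) (Y : Mat n k) (Z : Mat n n) : ℝ≥0∞ :=
  ⨆ (B : Mat n k) (C : Mat n n), ENNReal.ofReal (lin B C X Y Z)

theorem costReg_le_cost (X : Mat n n) (Y : Mat n k) (Z : Mat n n) : costReg X Y Z ≤ cost X Y Z :=
  iSup₂_le fun B C => lin_le_cost B C X Y Z

theorem lin_le_costReg (B : Mat n k) (C : Mat n n) (X : Mat n n) (Y : Mat n k) (Z : Mat n n) :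
    ENNReal.ofReal (lin B C X Y Z) ≤ costReg X Y Z :=
  le_iSup₂ (f := fun B C => ENNReal.ofReal (lin B C X Y Z)) B C

/-- For fixed `B` and `C` the minorant is linear in `(X, Y, Z)`, the coefficient of `X` being `-½ (B
Bᵀ + C Cᵀ)`. In this form it commutes with integration. -/
theorem lin_eq_sum (B : Mat n k) (C : Mat n n) (X : Mat n n) (Y : Mat n k) (Z : Mat n n) :
    lin B C X Y Z = ∑ i, ∑ j, B i j * Y i j + ∑ i, ∑ j, C i j * Z i j +
      ∑ i, ∑ j, (-(1 / 2) * ((B * Bᵀ) i j + (C * Cᵀ) i j)) * X i j := by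
  have key : ∀ {m : ℕ} (B : Mat n m), dot B (X * B) = ∑ i, ∑ j, (B * Bᵀ) i j * X i j := by
    intro m B
    rw [dot, Matrix.trace_mul_comm, Matrix.mul_assoc, Matrix.trace_mul_comm,
      ← dot_eq_sum, dot, Matrix.transpose_mul, Matrix.transpose_transpose]
  have h3 : ∑ i, ∑ j, (-(1 / 2) * ((B * Bᵀ) i j + (C * Cᵀ) i j)) * X i j =
      -(1 / 2) * (∑ i, ∑ j, (B * Bᵀ) i j * X i j + ∑ i, ∑ j, (C * Cᵀ) i j * X i j) := by
    rw [mul_add, Finset.mul_sum, Finset.mul_sum, ← Finset.sum_add_distrib]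
    refine Finset.sum_congr rfl fun i _ => ?_
    rw [Finset.mul_sum, Finset.mul_sum, ← Finset.sum_add_distrib]
    refine Finset.sum_congr rfl fun j _ => ?_
    ring
  rw [lin, key, key, dot_eq_sum, dot_eq_sum, h3]
  ring

/-- A supremum of continuous functions is lower semicontinuous, even over an uncountable family.
Working with `costReg` instead of `cost` thus avoids any discussion of the measurability of the
pseudoinverse. -/
theorem measurable_costReg {Z : Type*} [MeasurableSpace Z] {g : Z → Mat n n} {q : Z → Mat n k}
    {r : Z → Mat n n} (hg : ∀ i j, Measurable fun z => g z i j)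
    (hq : ∀ i j, Measurable fun z => q z i j) (hr : ∀ i j, Measurable fun z => r z i j) :
    Measurable fun z => costReg (g z) (q z) (r z) := by
  let ι := (Fin n × Fin n) ⊕ (Fin n × Fin k) ⊕ (Fin n × Fin n)
  have h1 : LowerSemicontinuous fun p : ι → ℝ =>
      costReg (Matrix.of fun i j => p (.inl (i, j))) (Matrix.of fun i j => p (.inr (.inl (i, j))))
        (Matrix.of fun i j => p (.inr (.inr (i, j)))) := by
    unfold costReg
    refine lowerSemicontinuous_iSup fun B => lowerSemicontinuous_iSup fun C => ?_
    refine Continuous.lowerSemicontinuous (ENNReal.continuous_ofReal.comp ?_)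
    simp only [lin_eq_sum, Matrix.of_apply]
    fun_prop
  have h2 : Measurable fun z => (Sum.elim (fun a => g z a.1 a.2)
      (Sum.elim (fun a => q z a.1 a.2) fun a => r z a.1 a.2) : ι → ℝ) := by
    refine measurable_pi_lambda _ fun a => ?_
    rcases a with a | a | a
    · exact hg _ _
    · exact hq _ _
    · exact hr _ _
  obtain ⟨Φ, hΦ, hm⟩ : ∃ Φ : (ι → ℝ) → ℝ≥0∞, Measurable Φ ∧ ∀ X Y Z,
      Φ (Sum.elim (fun a => X a.1 a.2) (Sum.elim (fun a => Y a.1 a.2) fun a => Z a.1 a.2)) =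
        costReg (Matrix.of X) (Matrix.of Y) (Matrix.of Z) :=
    ⟨_, h1.measurable, fun X Y Z => by simp only [Sum.elim_inl, Sum.elim_inr]⟩
  have h3 : (fun z => costReg (g z) (q z) (r z)) = fun z => Φ (Sum.elim (fun a => g z a.1 a.2)
      (Sum.elim (fun a => q z a.1 a.2) fun a => r z a.1 a.2)) := by
    funext z
    exact (hm (fun i j => g z i j) (fun i j => q z i j) fun i j => r z i j).symm
  rw [h3]
  exact hΦ.comp h2

/-- If `v ⬝ᵥ X v < 0`, the minorants with `B = 0` and `C = s v vᵀ` grow quadratically in `s`, so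
their supremum is infinite. -/
theorem quadratic_nonneg_of_costReg_lt_top {X : Mat n n} {Y : Mat n k} {Z : Mat n n}
    (h : costReg X Y Z < ⊤) (v : Fin n → ℝ) : 0 ≤ v ⬝ᵥ (X *ᵥ v) := by
  by_contra! hneg
  set K := (costReg X Y Z).toReal
  set V : Mat n n := Matrix.vecMulVec v v
  have hV : dot V (X * V) = (v ⬝ᵥ (X *ᵥ v)) * (v ⬝ᵥ v) := by
    rw [dot, Matrix.mul_vecMulVec, Matrix.transpose_vecMulVec, Matrix.vecMulVec_mul_vecMulVec,
      Matrix.vecMulVec_smul, Matrix.trace_smul, Matrix.trace_vecMulVec, smul_eq_mul]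
  have hv : 0 < v ⬝ᵥ v := by
    refine lt_of_le_of_ne (Finset.sum_nonneg fun i _ => mul_self_nonneg (v i)) fun h => ?_
    rw [dotProduct_self_eq_zero.1 h.symm] at hneg
    simp at hneg
  have hb : 0 < -(dot V (X * V)) := by
    rw [hV]
    nlinarith
  have hle : ∀ s : ℝ, s * dot V Z + s ^ 2 * (1 / 2 * -(dot V (X * V))) ≤ K := by
    intro s
    have h1 := lin_le_costReg 0 (s • V) X Y Z
    have h2 := (ENNReal.ofReal_le_iff_le_toReal h.ne).1 h1
    have h3 : lin 0 (s • V) X Y Z = s * dot V Z + s ^ 2 * (1 / 2 * -(dot V (X * V))) := by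
      unfold lin
      rw [Matrix.mul_smul, dot_smul_left, dot_smul_left, dot_smul_right]
      simp [dot]
      ring
    rwa [h3] at h2
  set b := 1 / 2 * -(dot V (X * V)) with hbdef
  have hb' : 0 < b := by rw [hbdef]; positivity
  set a := dot V Z
  have hK : 0 ≤ K := ENNReal.toReal_nonneg
  -- This `s` satisfies `s ≥ 1` and `s b + a ≥ K + 1`, whence `s a + s ^ 2 b > K`.
  have h4 := hle ((|a| + K + 1) / b + 1)
  have h5 : ((|a| + K + 1) / b + 1) * b = |a| + K + 1 + b := by
    field_simp
  have h6 : 0 ≤ (|a| + K + 1) / b := by positivity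
  nlinarith [neg_abs_le a, mul_nonneg h6 hK, mul_nonneg h6 hb'.le,
    mul_nonneg h6 (sub_nonneg.2 (neg_abs_le a)), abs_nonneg a]

/-- Multiplication of the columns of a matrix by scalars. -/
def scaleCols {m : ℕ} (c : Fin m → ℝ) (Y : Mat n m) : Mat n m := Matrix.of fun i j => c j * Y i j

theorem dot_scaleCols {m : ℕ} (c : Fin m → ℝ) (B Y : Mat n m) :
    dot B (scaleCols c Y) = dot (scaleCols c B) Y := by
  simp only [dot_eq_sum, scaleCols, Matrix.of_apply]
  refine Finset.sum_congr rfl fun i _ => Finset.sum_congr rfl fun j _ => ?_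
  ring

theorem dot_mul_eq_sum_cols {m : ℕ} (X : Mat n n) (B : Mat n m) :
    dot B (X * B) = ∑ j, (fun i => B i j) ⬝ᵥ (X *ᵥ fun i => B i j) := rfl

/-- The quadratic form splits into columns, and column `j` is multiplied by `c j ^ 2 ≤ 1`. Hence the
factor `(1 + Lε)⁻¹` on some columns of the flux does not increase the action. -/
theorem dot_mul_scaleCols_le {m : ℕ} {X : Mat n n} (hX : X.PosSemidef) {c : Fin m → ℝ}
    (hc : ∀ j, |c j| ≤ 1) (B : Mat n m) :
    dot (scaleCols c B) (X * scaleCols c B) ≤ dot B (X * B) := by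
  rw [dot_mul_eq_sum_cols, dot_mul_eq_sum_cols]
  refine Finset.sum_le_sum fun j _ => ?_
  have h1 : (fun i => scaleCols c B i j) = c j • fun i => B i j := rfl
  rw [h1, Matrix.mulVec_smul, dotProduct_smul, smul_dotProduct, smul_eq_mul, smul_eq_mul,
    ← mul_assoc]
  refine mul_le_of_le_one_left ((posSemidef_iff.1 hX).2 _) ?_
  have := hc j
  rw [← abs_mul_abs_self]
  nlinarith [abs_nonneg (c j)]

/-! ### Integration against signed and matrix-valued measures -/

section Measures

variable {α : Type*} [MeasurableSpace α]

theorem posPart_absolutelyContinuous {s : SignedMeasure α} {lam : Measure α}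
    (h : s.totalVariation ≪ lam) : s.toJordanDecomposition.posPart ≪ lam :=
  (Measure.absolutelyContinuous_of_le (Measure.le_add_right le_rfl)).trans h

theorem negPart_absolutelyContinuous {s : SignedMeasure α} {lam : Measure α}
    (h : s.totalVariation ≪ lam) : s.toJordanDecomposition.negPart ≪ lam :=
  (Measure.absolutelyContinuous_of_le (Measure.le_add_left le_rfl)).trans h

/-- Jordan decomposition followed by Radon–Nikodym on each part. It allows `G`, `q` and `R` to be
integrated against one common positive measure. -/
theorem signedMeasure_integral_eq (s : SignedMeasure α) (lam : Measure α) [IsFiniteMeasure lam]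
    (h : s.totalVariation ≪ lam) {f : α → ℝ} (hf : Measurable f) {C : ℝ} (hC : ∀ x, |f x| ≤ C) :
    s.integral f (ContinuousLinearMap.lsmul ℝ ℝ).flip = ∫ x, f x * s.rnDeriv lam x ∂lam := by
  have hfi : ∀ m : Measure α, IsFiniteMeasure m → Integrable f m := fun m _ =>
    Integrable.of_bound hf.aestronglyMeasurable C (Eventually.of_forall hC)
  have hi : ∀ m : Measure α, SigmaFinite m → m ≪ lam → IsFiniteMeasure m →
      Integrable (fun x => (m.rnDeriv lam x).toReal • f x) lam := fun m _ hm _ =>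
    (integrable_rnDeriv_smul_iff hm).2 (hfi m inferInstance)
  have hs : s = s.toJordanDecomposition.posPart.toSignedMeasure -
      s.toJordanDecomposition.negPart.toSignedMeasure :=
    s.toSignedMeasure_toJordanDecomposition.symm
  have hp := posPart_absolutelyContinuous h
  have hn := negPart_absolutelyContinuous h
  calc s.integral f (ContinuousLinearMap.lsmul ℝ ℝ).flip
      = (s.toJordanDecomposition.posPart.toSignedMeasure -
        s.toJordanDecomposition.negPart.toSignedMeasure).integral f
          (ContinuousLinearMap.lsmul ℝ ℝ).flip := by rw [← hs]
    _ = ∫ x, f x ∂s.toJordanDecomposition.posPart - ∫ x, f x ∂s.toJordanDecomposition.negPart := by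
        rw [VectorMeasure.integral_sub_vectorMeasure, VectorMeasure.integral_toSignedMeasure,
          VectorMeasure.integral_toSignedMeasure]
        · rw [VectorMeasure.Integrable, Measure.variation_toSignedMeasure]
          exact hfi _ inferInstance
        · rw [VectorMeasure.Integrable, Measure.variation_toSignedMeasure]
          exact hfi _ inferInstance
    _ = ∫ x, f x * s.rnDeriv lam x ∂lam := by
        rw [← integral_rnDeriv_smul hp, ← integral_rnDeriv_smul hn, ← integral_sub
          (hi _ inferInstance hp inferInstance) (hi _ inferInstance hn inferInstance)]
        refine integral_congr_ae (Eventually.of_forall fun x => ?_)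
        simp only [SignedMeasure.rnDeriv_def, smul_eq_mul]
        ring

theorem signedMeasure_apply_eq (s : SignedMeasure α) (lam : Measure α) [IsFiniteMeasure lam]
    (h : s.totalVariation ≪ lam) {E : Set α} (hE : MeasurableSet E) :
    s E = ∫ x in E, s.rnDeriv lam x ∂lam := by
  have hp := posPart_absolutelyContinuous h
  have hn := negPart_absolutelyContinuous h
  have hi : ∀ m : Measure α, IsFiniteMeasure m →
      Integrable (fun x => (m.rnDeriv lam x).toReal) (lam.restrict E) := fun m _ =>
    Measure.integrable_toReal_rnDeriv.restrict
  rw [s.apply_eq_posPart_real_sub_negPart_real hE, SignedMeasure.rnDeriv_def,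
    integral_sub (hi _ inferInstance) (hi _ inferInstance),
    Measure.setIntegral_toReal_rnDeriv hp, Measure.setIntegral_toReal_rnDeriv hn]

namespace MatMeasure

variable {m : ℕ}

/-- All entries of the matrix-valued measure `ν` are absolutely continuous with respect to `lam`. -/
def AC (ν : MatMeasure α n m) (lam : Measure α) : Prop :=
  ∀ i j, (ν.entry i j).totalVariation ≪ lam

theorem ac_of_dom_le {ν : MatMeasure α n m} {lam : Measure α} (h : ν.dom ≤ lam) : ν.AC lam := by
  intro i j
  refine Measure.absolutelyContinuous_of_le (le_trans ?_ h)
  unfold dom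
  refine (Finset.single_le_sum (f := fun j => (ν.entry i j).totalVariation)
    (fun _ _ => Measure.zero_le _) (Finset.mem_univ j)).trans ?_
  exact Finset.single_le_sum (f := fun i => ∑ j, (ν.entry i j).totalVariation)
    (fun _ _ => Measure.zero_le _) (Finset.mem_univ i)

instance (ν : MatMeasure α n m) : IsFiniteMeasure ν.dom := by
  unfold dom
  infer_instance

theorem measurable_density (ν : MatMeasure α n m) (lam : Measure α) (i : Fin n) (j : Fin m) :
    Measurable fun z => ν.density lam z i j :=
  SignedMeasure.measurable_rnDeriv _ _

theorem integrable_density (ν : MatMeasure α n m) (lam : Measure α) (i : Fin n) (j : Fin m) :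
    Integrable (fun z => ν.density lam z i j) lam :=
  SignedMeasure.integrable_rnDeriv _ _

theorem integrable_mul_density (ν : MatMeasure α n m) (lam : Measure α) {f : α → ℝ}
    (hf : Measurable f) {C : ℝ} (hC : ∀ x, |f x| ≤ C) (i : Fin n) (j : Fin m) :
    Integrable (fun z => f z * ν.density lam z i j) lam :=
  (ν.integrable_density lam i j).bdd_mul hf.aestronglyMeasurable (Eventually.of_forall hC)

variable {ν : MatMeasure α n m} {lam : Measure α} [IsFiniteMeasure lam]

theorem scalarIntegral_apply (h : ν.AC lam) {f : α → ℝ} (hf : Measurable f) {C : ℝ}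
    (hC : ∀ x, |f x| ≤ C) (i : Fin n) (j : Fin m) :
    ν.scalarIntegral f i j = ∫ z, f z * ν.density lam z i j ∂lam :=
  signedMeasure_integral_eq _ lam (h i j) hf hC

theorem sum_mul_scalarIntegral (h : ν.AC lam) {f : α → ℝ} (hf : Measurable f) {C : ℝ}
    (hC : ∀ x, |f x| ≤ C) (A : Fin n → Fin m → ℝ) :
    ∑ i, ∑ j, A i j * ν.scalarIntegral f i j =
      ∫ z, f z * ∑ i, ∑ j, A i j * ν.density lam z i j ∂lam := by
  have hi : ∀ i j, Integrable (fun z => A i j * (f z * ν.density lam z i j)) lam := fun i j =>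
    (integrable_mul_density ν lam hf hC i j).const_mul _
  have h1 : (fun z => f z * ∑ i, ∑ j, A i j * ν.density lam z i j) =
      fun z => ∑ i, ∑ j, A i j * (f z * ν.density lam z i j) := by
    funext z
    rw [Finset.mul_sum]
    refine Finset.sum_congr rfl fun i _ => ?_
    rw [Finset.mul_sum]
    refine Finset.sum_congr rfl fun j _ => ?_
    ring
  rw [h1, integral_finsetSum _ fun i _ => integrable_finsetSum _ fun j _ => hi i j]
  refine Finset.sum_congr rfl fun i _ => ?_
  rw [integral_finsetSum _ fun j _ => hi i j]
  refine Finset.sum_congr rfl fun j _ => ?_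
  rw [integral_const_mul, scalarIntegral_apply h hf hC]

theorem integrable_mul_sum_density (ν : MatMeasure α n m) (lam : Measure α) {f : α → ℝ}
    (hf : Measurable f) {C : ℝ} (hC : ∀ x, |f x| ≤ C) (A : Fin n → Fin m → ℝ) :
    Integrable (fun z => f z * ∑ i, ∑ j, A i j * ν.density lam z i j) lam :=
  (integrable_finsetSum _ fun i _ => integrable_finsetSum _ fun j _ =>
    (ν.integrable_density lam i j).const_mul (A i j)).bdd_mul hf.aestronglyMeasurable
      (Eventually.of_forall hC)

theorem abs_scalarIntegral_le (h : ν.AC lam) {f : α → ℝ} (hf : Measurable f) {C : ℝ}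
    (hC : ∀ x, |f x| ≤ C) (i : Fin n) (j : Fin m) :
    |ν.scalarIntegral f i j| ≤ C * ∫ z, |ν.density lam z i j| ∂lam := by
  rw [scalarIntegral_apply h hf hC, ← integral_const_mul, ← Real.norm_eq_abs]
  refine norm_integral_le_of_norm_le ((ν.integrable_density lam i j).norm.const_mul C)
    (Eventually.of_forall fun z => ?_)
  rw [norm_mul]
  exact mul_le_mul_of_nonneg_right (hC z) (norm_nonneg _)

theorem scalarIntegral_sub (h : ν.AC lam) {f g : α → ℝ} (hf : Measurable f) (hg : Measurable g)
    {C : ℝ} (hC : ∀ x, |f x| ≤ C) (hC' : ∀ x, |g x| ≤ C) :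
    ν.scalarIntegral (fun z => f z - g z) = ν.scalarIntegral f - ν.scalarIntegral g := by
  ext i j
  rw [Matrix.sub_apply, scalarIntegral_apply h hf hC, scalarIntegral_apply h hg hC',
    scalarIntegral_apply h (f := fun z => f z - g z) (hf.sub hg) (C := C + C)
      fun x => (abs_sub _ _).trans (add_le_add (hC x) (hC' x)),
    ← integral_sub (integrable_mul_density ν lam hf hC i j)
      (integrable_mul_density ν lam hg hC' i j)]
  simp only [sub_mul]

theorem scalarIntegral_const_mul (h : ν.AC lam) {f : α → ℝ} (hf : Measurable f)
    {C : ℝ} (hC : ∀ x, |f x| ≤ C) (a : ℝ) :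
    ν.scalarIntegral (fun z => a * f z) = a • ν.scalarIntegral f := by
  ext i j
  rw [Matrix.smul_apply, scalarIntegral_apply h hf hC,
    scalarIntegral_apply h (hf.const_mul a) (C := |a| * C)
      fun x => by rw [abs_mul]; exact mul_le_mul_of_nonneg_left (hC x) (abs_nonneg a),
    smul_eq_mul, ← integral_const_mul]
  simp only [mul_assoc]

/-- Test fields of product type have images under `D*` that are finite sums of scalar functions
times constant matrices; pairing with them reduces to scalar integrals. -/
theorem pair_sum_smul (h : ν.AC lam) {ι : Type*} [Fintype ι] {f : ι → α → ℝ}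
    (hf : ∀ a, Measurable (f a)) {C : ℝ} (hC : ∀ a x, |f a x| ≤ C) (A : ι → Mat n m) :
    ν.pair (fun z => ∑ a, f a z • A a) = ∑ a, dot (ν.scalarIntegral (f a)) (A a) := by
  have h1 : ∀ i j, (ν.entry i j).integral (fun z => (∑ a, f a z • A a) i j)
      (ContinuousLinearMap.lsmul ℝ ℝ).flip = ∑ a, ν.scalarIntegral (f a) i j * A a i j := by
    intro i j
    have h2 : (fun z => (∑ a, f a z • A a) i j) = fun z => ∑ a, f a z * A a i j := by
      funext z
      rw [Matrix.sum_apply]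
      rfl
    rw [h2, signedMeasure_integral_eq _ lam (h i j)
      (Finset.measurable_fun_sum _ fun a _ => (hf a).mul_const _) (C := ∑ a, C * |A a i j|)]
    · have h3 : (fun z => (∑ a, f a z * A a i j) * (ν.entry i j).rnDeriv lam z) =
          fun z => ∑ a, A a i j * (f a z * ν.density lam z i j) := by
        funext z
        rw [Finset.sum_mul]
        refine Finset.sum_congr rfl fun a _ => ?_
        simp only [density, Matrix.of_apply]
        ring
      rw [h3, integral_finsetSum _ fun a _ =>
        (integrable_mul_density ν lam (hf a) (hC a) i j).const_mul _]
      refine Finset.sum_congr rfl fun a _ => ?_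
      rw [integral_const_mul, scalarIntegral_apply h (hf a) (hC a), mul_comm]
    · intro x
      refine (Finset.abs_sum_le_sum_abs _ _).trans (Finset.sum_le_sum fun a _ => ?_)
      rw [abs_mul]
      exact mul_le_mul_of_nonneg_right (hC a x) (abs_nonneg _)
  simp only [pair, h1, dot_eq_sum]
  simp_rw [Finset.sum_comm (s := (Finset.univ : Finset (Fin m))) (t := (Finset.univ : Finset ι))]
  rw [Finset.sum_comm]

theorem pair_smul (h : ν.AC lam) {f : α → ℝ} (hf : Measurable f) {C : ℝ} (hC : ∀ x, |f x| ≤ C)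
    (A : Mat n m) : ν.pair (fun z => f z • A) = dot (ν.scalarIntegral f) A := by
  have := pair_sum_smul h (ι := Unit) (f := fun _ => f) (fun _ => hf) (fun _ => hC) fun _ => A
  simpa using this

end MatMeasure

namespace MatMeasure

variable {ν : MatMeasure α n n} {lam : Measure α}

theorem IsPosSemidef.isSymm (h : ν.IsPosSemidef) : ν.IsSymm := fun E hE =>
  transpose_of_isHermitian (h E hE).1

theorem IsSymm.entry_comm (h : ν.IsSymm) (i j : Fin n) : ν.entry i j = ν.entry j i := by
  ext E hE
  exact congrFun (congrFun (h E hE) j) i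

theorem IsSymm.scalarIntegral_transpose (h : ν.IsSymm) (f : α → ℝ) :
    (ν.scalarIntegral f)ᵀ = ν.scalarIntegral f := by
  ext i j
  simp only [scalarIntegral, Matrix.transpose_apply, Matrix.of_apply]
  rw [h.entry_comm]

/-- The exceptional null set may depend on `v`, because the quadratic form of the integral is
computed for one `v` at a time. -/
theorem IsSymm.posSemidef_scalarIntegral [IsFiniteMeasure lam] (h : ν.IsSymm) (hac : ν.AC lam)
    (hpos : ∀ v : Fin n → ℝ, ∀ᵐ z ∂lam, 0 ≤ v ⬝ᵥ (ν.density lam z *ᵥ v))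
    {f : α → ℝ} (hf : Measurable f) {C : ℝ} (hC : ∀ x, |f x| ≤ C) (hf0 : ∀ x, 0 ≤ f x) :
    (ν.scalarIntegral f).PosSemidef := by
  refine posSemidef_iff.2 ⟨h.scalarIntegral_transpose f, fun v => ?_⟩
  rw [dotProduct_mulVec_eq_sum, sum_mul_scalarIntegral hac hf hC fun i j => v i * v j]
  refine integral_nonneg_of_ae ?_
  filter_upwards [hpos v] with z hz
  rw [dotProduct_mulVec_eq_sum] at hz
  exact mul_nonneg (hf0 z) hz

/-- The integral over `E` of the quadratic form of the density is `v ⬝ᵥ (ν E) v ≥ 0`. As `E` is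
arbitrary, the form is nonnegative almost everywhere. -/
theorem IsPosSemidef.posSemidef_scalarIntegral (h : ν.IsPosSemidef)
    {f : α → ℝ} (hf : Measurable f) {C : ℝ} (hC : ∀ x, |f x| ≤ C) (hf0 : ∀ x, 0 ≤ f x) :
    (ν.scalarIntegral f).PosSemidef := by
  have hac : ν.AC ν.dom := ac_of_dom_le le_rfl
  refine h.isSymm.posSemidef_scalarIntegral hac (fun v => ?_) hf hC hf0
  have hi : ∀ i j, Integrable (fun z => v i * v j * ν.density ν.dom z i j) ν.dom :=
    fun i j => (ν.integrable_density ν.dom i j).const_mul _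
  simp only [dotProduct_mulVec_eq_sum]
  refine ae_nonneg_of_forall_setIntegral_nonneg
    (integrable_finsetSum _ fun i _ => integrable_finsetSum _ fun j _ => hi i j) fun E hE _ => ?_
  rw [integral_finsetSum _ fun i _ => (integrable_finsetSum _ fun j _ => hi i j).integrableOn]
  have h1 : ∀ i, ∫ z in E, ∑ j, v i * v j * ν.density ν.dom z i j ∂ν.dom =
      ∑ j, v i * v j * (ν E) i j := by
    intro i
    rw [integral_finsetSum _ fun j _ => (hi i j).integrableOn]
    refine Finset.sum_congr rfl fun j _ => ?_
    rw [integral_const_mul]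
    congr 1
    exact (signedMeasure_apply_eq (ν.entry i j) ν.dom (hac i j) hE).symm
  simp only [h1]
  rw [← dotProduct_mulVec_eq_sum]
  exact (posSemidef_iff.1 (h E hE)).2 v

end MatMeasure

/-- Jensen's inequality for the infinitesimal cost: the affine minorants of the cost of an average
are bounded by the average of the cost. -/
theorem ofReal_lin_scalarIntegral_le {g : MatMeasure α n n} {q : MatMeasure α n k}
    {r : MatMeasure α n n} {lam : Measure α} [IsFiniteMeasure lam] (hg : g.AC lam) (hq : q.AC lam)
    (hr : r.AC lam) {f : α → ℝ} (hf : Measurable f) {C : ℝ} (hC : ∀ x, |f x| ≤ C)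
    (hf0 : ∀ x, 0 ≤ f x) (B : Mat n k) (D : Mat n n) :
    ENNReal.ofReal
        (lin B D (g.scalarIntegral f) (q.scalarIntegral f) (r.scalarIntegral f)) ≤
      ∫⁻ z, ENNReal.ofReal (f z) *
        costReg (g.density lam z) (q.density lam z) (r.density lam z) ∂lam := by
  have h1 : lin B D (g.scalarIntegral f) (q.scalarIntegral f) (r.scalarIntegral f) =
      ∫ z, f z * lin B D (g.density lam z) (q.density lam z) (r.density lam z) ∂lam := by
    simp only [lin_eq_sum, mul_add (f _)]
    rw [MatMeasure.sum_mul_scalarIntegral hg hf hC, MatMeasure.sum_mul_scalarIntegral hq hf hC fun i j => B i j,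
      MatMeasure.sum_mul_scalarIntegral hr hf hC fun i j => D i j, ← integral_add, ← integral_add]
    · exact (MatMeasure.integrable_mul_sum_density q lam hf hC _).add
        (MatMeasure.integrable_mul_sum_density r lam hf hC _)
    · exact MatMeasure.integrable_mul_sum_density g lam hf hC _
    · exact MatMeasure.integrable_mul_sum_density q lam hf hC _
    · exact MatMeasure.integrable_mul_sum_density r lam hf hC _
  have hint : Integrable (fun z => f z *
      lin B D (g.density lam z) (q.density lam z) (r.density lam z)) lam := by
    simp only [lin_eq_sum, mul_add (f _)]
    exact ((MatMeasure.integrable_mul_sum_density q lam hf hC _).add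
        (MatMeasure.integrable_mul_sum_density r lam hf hC _)).add
          (MatMeasure.integrable_mul_sum_density g lam hf hC _)
  rw [h1]
  -- The minorant may be negative at some points, so the passage to the extended nonnegative
  -- integral goes through its positive part.
  calc _ ≤ ENNReal.ofReal (∫ z, max (f z *
        lin B D (g.density lam z) (q.density lam z) (r.density lam z)) 0 ∂lam) :=
        ENNReal.ofReal_le_ofReal (integral_mono hint hint.pos_part fun z => le_max_left _ _)
    _ = ∫⁻ z, ENNReal.ofReal (max (f z *
        lin B D (g.density lam z) (q.density lam z) (r.density lam z)) 0) ∂lam :=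
        ofReal_integral_eq_lintegral_ofReal hint.pos_part
          (Eventually.of_forall fun z => le_max_right _ _)
    _ ≤ _ := by
        refine lintegral_mono fun z => ?_
        rw [ENNReal.ofReal_max, ENNReal.ofReal_zero, max_eq_left zero_le,
          ENNReal.ofReal_mul (hf0 z)]
        gcongr
        exact lin_le_costReg _ _ _ _ _

end Measures

/-! ### Curves of finite action. -/

namespace CurveMeasure

variable {Ω : Set (Eu d)} (μ : CurveMeasure Ω n k)

instance : IsFiniteMeasure μ.dom := by
  unfold dom
  infer_instance

theorem ac_G : μ.G.AC μ.dom :=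
  MatMeasure.ac_of_dom_le (by
    unfold dom; exact (Measure.le_add_right le_rfl).trans (Measure.le_add_right le_rfl))

theorem ac_q : μ.q.AC μ.dom :=
  MatMeasure.ac_of_dom_le (by
    unfold dom; exact (Measure.le_add_left le_rfl).trans (Measure.le_add_right le_rfl))

theorem ac_R : μ.R.AC μ.dom :=
  MatMeasure.ac_of_dom_le (by unfold dom; exact Measure.le_add_left le_rfl)

/-- The measurable density of (a minorant of) the action. -/
def actionDensity (z : TimeSpace Ω) : ℝ≥0∞ :=
  costReg (μ.G.density μ.dom z) (μ.q.density μ.dom z) (μ.R.density μ.dom z)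

theorem measurable_actionDensity : Measurable μ.actionDensity :=
  measurable_costReg (μ.G.measurable_density _) (μ.q.measurable_density _)
    (μ.R.measurable_density _)

theorem lintegral_actionDensity_le : ∫⁻ z, μ.actionDensity z ∂μ.dom ≤ μ.action :=
  lintegral_mono fun _ => costReg_le_cost _ _ _

/-- Positivity of `G` is not part of a `CurveMeasure`; it follows from the finite action, which
makes `costReg` finite almost everywhere. -/
theorem posSemidef_scalarIntegral (hμ : μ.action < ⊤) {f : TimeSpace Ω → ℝ}
    (hf : Measurable f) {C : ℝ} (hC : ∀ x, |f x| ≤ C) (hf0 : ∀ x, 0 ≤ f x) :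
    (μ.G.scalarIntegral f).PosSemidef := by
  refine μ.symm.posSemidef_scalarIntegral μ.ac_G (fun v => ?_) hf hC hf0
  filter_upwards [ae_lt_top μ.measurable_actionDensity
    (μ.lintegral_actionDensity_le.trans_lt hμ).ne] with z hz
  exact quadratic_nonneg_of_costReg_lt_top hz v

end CurveMeasure

/-! ### Mollifiers -/

namespace IsMollifier

section General

variable {F : Type*} [NormedAddCommGroup F] [NormedSpace ℝ F] [MeasureSpace F] {θ : F → ℝ}

/-- The unit sphere is included by continuity along the ray `t • x`, `t ↓ 1`. It is needed because
dilated boundary points are only known to have distance at least `ε` from `Ω`, possibly equal to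
`ε`. -/
theorem eq_zero_of_one_le (h : IsMollifier θ) {x : F} (hx : 1 ≤ ‖x‖) : θ x = 0 := by
  have h1 : Tendsto (fun t : ℝ => θ (t • x)) (𝓝[>] 1) (𝓝 (θ x)) := by
    have : Continuous fun t : ℝ => θ (t • x) :=
      h.smooth.continuous.comp (continuous_id.smul continuous_const)
    have := (this.tendsto 1).mono_left (nhdsWithin_le_nhds (s := Ioi 1))
    rwa [one_smul] at this
  have h2 : Tendsto (fun t : ℝ => θ (t • x)) (𝓝[>] 1) (𝓝 0) := by
    refine tendsto_const_nhds.congr' ?_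
    filter_upwards [self_mem_nhdsWithin] with t ht
    refine (h.support _ ?_).symm
    have ht' : (1 : ℝ) < t := ht
    rw [norm_smul, Real.norm_eq_abs, abs_of_pos (by linarith)]
    nlinarith
  exact tendsto_nhds_unique h1 h2

theorem rescale_eq_zero (h : IsMollifier θ) {ε : ℝ} (hε : 0 < ε) {x : F} (hx : ε ≤ ‖x‖) :
    rescale θ ε x = 0 := by
  rw [rescale, h.eq_zero_of_one_le, mul_zero]
  rw [norm_smul, norm_inv, Real.norm_eq_abs, abs_of_pos hε]
  rwa [le_inv_mul_iff₀ hε, mul_one]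

theorem rescale_nonneg (h : IsMollifier θ) {ε : ℝ} (hε : 0 < ε) (x : F) : 0 ≤ rescale θ ε x :=
  mul_nonneg (by positivity) (h.nonneg _)

theorem contDiff_rescale (h : IsMollifier θ) (ε : ℝ) : ContDiff ℝ ∞ (rescale θ ε) := by
  have h1 : ContDiff ℝ ∞ fun x : F => ε⁻¹ • x := contDiff_id.const_smul ε⁻¹
  exact contDiff_const.mul (h.smooth.comp h1)

variable [FiniteDimensional ℝ F]

theorem hasCompactSupport_rescale (h : IsMollifier θ) {ε : ℝ} (hε : 0 < ε) :
    HasCompactSupport (rescale θ ε) := by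
  have := FiniteDimensional.proper_real F
  refine HasCompactSupport.intro (isCompact_closedBall 0 ε) fun x hx => ?_
  rw [mem_closedBall_zero_iff, not_le] at hx
  exact h.rescale_eq_zero hε hx.le

theorem integral_rescale [BorelSpace F] [(volume : Measure F).IsAddHaarMeasure]
    (h : IsMollifier θ) {ε : ℝ} (hε : 0 < ε) : ∫ x, rescale θ ε x = 1 := by
  unfold rescale
  rw [integral_const_mul, Measure.integral_comp_inv_smul, h.integral_eq_one,
    abs_of_pos (by positivity), smul_eq_mul, mul_one, inv_mul_cancel₀ (by positivity)]

theorem exists_bound_rescale (h : IsMollifier θ) {ε : ℝ} (hε : 0 < ε) :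
    ∃ K, 0 ≤ K ∧ ∀ x, |rescale θ ε x| ≤ K := by
  obtain ⟨K, hK⟩ := (h.contDiff_rescale ε).continuous.bounded_above_of_compact_support
    (h.hasCompactSupport_rescale hε)
  exact ⟨K, (norm_nonneg _).trans (hK 0), hK⟩

end General

/-- The change of variables produces `(a ^ d)⁻¹`, which will cancel the prefactor `(1 + Lε) ^ d` of
the regularized densities. -/
theorem lintegral_affine {θ : Eu d → ℝ} (h : IsMollifier θ) {ε : ℝ} (hε : 0 < ε) {a : ℝ}
    (ha : 0 < a) (c p : Eu d) :
    ∫⁻ x, ENNReal.ofReal (rescale θ ε (c + a • (x - c) - p)) = ENNReal.ofReal ((a ^ d)⁻¹) := by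
  have h1 : ∫ x, rescale θ ε (c + a • (x - c) - p) = (a ^ d)⁻¹ := by
    have h2 : (fun x => rescale θ ε (c + a • (x - c) - p)) =
        fun x => (fun y => rescale θ ε (y + (c - a • c - p))) (a • x) := by
      funext x
      congr 1
      rw [smul_sub]
      abel
    rw [h2, Measure.integral_comp_smul volume (fun y => rescale θ ε (y + (c - a • c - p))) a,
      integral_add_right_eq_self (fun y => rescale θ ε y), h.integral_rescale hε,
      finrank_euclideanSpace_fin, abs_of_pos (by positivity), smul_eq_mul, mul_one]
  rw [← h1, ofReal_integral_eq_lintegral_ofReal]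
  -- The Bochner integral of a nonintegrable function is `0` by convention, so a nonzero integral
  -- implies integrability.
  · refine not_imp_comm.1 integral_undef ?_
    rw [h1]
    positivity
  · exact Eventually.of_forall fun x => h.rescale_nonneg hε _

end IsMollifier

/-! ### Averages of the time kernel -/

/-- The average over `t ∈ [a, b]` of the translates `s ↦ θ(t - s)`. -/
def avgKernel (θ : ℝ → ℝ) (a b s : ℝ) : ℝ := (b - a)⁻¹ * ∫ t in a..b, θ (t - s)

section AvgKernel

variable {θ : ℝ → ℝ} {a b : ℝ}

/-- Averaging in time turns the time derivative into a difference quotient. Tested with this kernel,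
the weak equation becomes an exact equation between two discrete times. -/
theorem hasDerivAt_avgKernel (hθ : Continuous θ) (a b s : ℝ) :
    HasDerivAt (avgKernel θ a b) ((b - a)⁻¹ * (θ (a - s) - θ (b - s))) s := by
  have hi : ∀ x y, IntervalIntegrable θ volume x y := fun x y => hθ.intervalIntegrable x y
  have h1 : avgKernel θ a b = fun s => (b - a)⁻¹ *
      ((∫ t in (0:ℝ)..(b - s), θ t) - ∫ t in (0:ℝ)..(a - s), θ t) := by
    funext s
    rw [avgKernel, intervalIntegral.integral_comp_sub_right,
      intervalIntegral.integral_interval_sub_left (hi _ _) (hi _ _)]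
  have h2 : ∀ c : ℝ, HasDerivAt (fun s => ∫ t in (0:ℝ)..(c - s), θ t) (-θ (c - s)) s := by
    intro c
    have h3 := (intervalIntegral.integral_hasDerivAt_right (hi 0 (c - s))
      (hθ.stronglyMeasurableAtFilter _ _) hθ.continuousAt).comp s
      ((hasDerivAt_id s).const_sub c)
    rw [mul_neg_one] at h3
    exact h3
  rw [h1]
  have h4 := ((h2 b).sub (h2 a)).const_mul (b - a)⁻¹
  rwa [show -θ (b - s) - -θ (a - s) = θ (a - s) - θ (b - s) by ring] at h4

theorem continuous_avgKernel (hθ : Continuous θ) (a b : ℝ) : Continuous (avgKernel θ a b) :=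
  continuous_iff_continuousAt.2 fun s => (hasDerivAt_avgKernel hθ a b s).continuousAt

theorem contDiff_avgKernel (hθ : Continuous θ) (a b : ℝ) : ContDiff ℝ 1 (avgKernel θ a b) := by
  rw [contDiff_one_iff_deriv]
  refine ⟨fun s => (hasDerivAt_avgKernel hθ a b s).differentiableAt, ?_⟩
  rw [show deriv (avgKernel θ a b) = fun s => (b - a)⁻¹ * (θ (a - s) - θ (b - s)) from
    funext fun s => (hasDerivAt_avgKernel hθ a b s).deriv]
  fun_prop

theorem avgKernel_nonneg (h0 : ∀ x, 0 ≤ θ x) (hab : a < b) (s : ℝ) : 0 ≤ avgKernel θ a b s :=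
  mul_nonneg (inv_nonneg.2 (sub_pos.2 hab).le)
    (intervalIntegral.integral_nonneg hab.le fun _ _ => h0 _)

theorem abs_sub_avgKernel_le (hθ : Continuous θ) (hab : a < b) (s c K : ℝ)
    (h : ∀ t ∈ Icc a b, |c - θ (t - s)| ≤ K) : |c - avgKernel θ a b s| ≤ K := by
  have hi : IntervalIntegrable (fun t => θ (t - s)) volume a b :=
    Continuous.intervalIntegrable (by fun_prop) _ _
  have hba : 0 < b - a := sub_pos.2 hab
  have h1 : c - avgKernel θ a b s = (b - a)⁻¹ * ∫ t in a..b, (c - θ (t - s)) := by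
    rw [intervalIntegral.integral_sub (by simp) hi, intervalIntegral.integral_const, mul_sub,
      smul_eq_mul, ← mul_assoc, inv_mul_cancel₀ hba.ne', one_mul, avgKernel]
  have h2 := intervalIntegral.norm_integral_le_of_norm_le_const (a := a) (b := b) (C := K)
    (f := fun t => c - θ (t - s)) fun t ht => h t (by
      rw [uIoc_of_le hab.le] at ht
      exact ⟨ht.1.le, ht.2⟩)
  rw [Real.norm_eq_abs, abs_of_pos hba] at h2
  rw [h1, abs_mul, abs_of_pos (inv_pos.2 hba), inv_mul_le_iff₀ hba, mul_comm]
  exact h2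

theorem abs_avgKernel_le (hθ : Continuous θ) (hab : a < b) {K : ℝ} (hK : ∀ x, |θ x| ≤ K) (s : ℝ) :
    |avgKernel θ a b s| ≤ K := by
  have := abs_sub_avgKernel_le hθ hab s 0 K fun t _ => by simpa using hK (t - s)
  simpa using this

/-- Compares the two-point mean that enters the discrete action with the time average that Jensen's
inequality requires; the error is linear in the length of the step. -/
theorem abs_mean_sub_avgKernel_le {Lc : ℝ≥0} (hθ : LipschitzWith Lc θ) (hab : a < b) (s : ℝ) :
    |(θ (a - s) + θ (b - s)) / 2 - avgKernel θ a b s| ≤ Lc * (b - a) := by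
  refine abs_sub_avgKernel_le hθ.continuous hab s _ _ fun t ht => ?_
  have h1 := hθ.dist_le_mul (a - s) (t - s)
  have h2 := hθ.dist_le_mul (b - s) (t - s)
  rw [Real.dist_eq, Real.dist_eq, show a - s - (t - s) = -(t - a) by ring, abs_neg,
    abs_of_nonneg (sub_nonneg.2 ht.1)] at h1
  rw [Real.dist_eq, Real.dist_eq, show b - s - (t - s) = b - t by ring,
    abs_of_nonneg (sub_nonneg.2 ht.2)] at h2
  have hL : (0 : ℝ) ≤ Lc := Lc.2
  rw [abs_le] at h1 h2 ⊢
  constructor <;> nlinarith [ht.1, ht.2]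

theorem setIntegral_Iio_sub {θ : ℝ → ℝ} (t c : ℝ) :
    ∫ s in Iio c, θ (t - s) = ∫ u in Ioi (t - c), θ u := by
  have h := ((volume : Measure ℝ).measurePreserving_sub_left t).setIntegral_preimage_emb
    (MeasurableEquiv.subLeft t).measurableEmbedding θ (Ioi (t - c))
  rw [← h]
  congr 2
  ext s
  simp

theorem setIntegral_Ioi_sub {θ : ℝ → ℝ} (t c : ℝ) :
    ∫ s in Ioi c, θ (t - s) = ∫ u in Iio (t - c), θ u := by
  have h := ((volume : Measure ℝ).measurePreserving_sub_left t).setIntegral_preimage_emb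
    (MeasurableEquiv.subLeft t).measurableEmbedding θ (Iio (t - c))
  rw [← h]
  congr 2
  ext s
  simp

/-- Past and future weights are tail masses of `θ`. Their increments over a step reproduce the
boundary terms `κ(0)` and `κ(1)` of the weak continuity equation, so the extension by the endpoint
measures compensates these terms. -/
theorem weight_past_sub (hi : Integrable θ) (hab : a < b) :
    (∫ s in Iio (0 : ℝ), θ (b - s)) - ∫ s in Iio (0 : ℝ), θ (a - s) =
      -((b - a) * avgKernel θ a b 0) := by
  rw [setIntegral_Iio_sub, setIntegral_Iio_sub, sub_zero, sub_zero, avgKernel, ← mul_assoc,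
    mul_inv_cancel₀ (sub_pos.2 hab).ne', one_mul]
  simp only [sub_zero]
  have := intervalIntegral.integral_interval_add_Ioi (a := a) (b := b) (f := θ) (μ := volume)
    hi.integrableOn hi.integrableOn
  linarith

theorem weight_future_sub (hi : Integrable θ) (hab : a < b) :
    (∫ s in Ioi (1 : ℝ), θ (b - s)) - ∫ s in Ioi (1 : ℝ), θ (a - s) =
      (b - a) * avgKernel θ a b 1 := by
  rw [setIntegral_Ioi_sub, setIntegral_Ioi_sub, avgKernel, ← mul_assoc,
    mul_inv_cancel₀ (sub_pos.2 hab).ne', one_mul, intervalIntegral.integral_comp_sub_right,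
    ← integral_Iic_eq_integral_Iio, ← integral_Iic_eq_integral_Iio]
  exact intervalIntegral.integral_Iic_sub_Iic hi.integrableOn hi.integrableOn

theorem weight_mem (h0 : ∀ x, 0 ≤ θ x) (hi : Integrable θ) (h1 : ∫ x, θ x = 1) (E : Set ℝ)
    (t : ℝ) : 0 ≤ ∫ s in E, θ (t - s) ∧ ∫ s in E, θ (t - s) ≤ 1 := by
  refine ⟨integral_nonneg fun _ => h0 _, ?_⟩
  rw [← h1, ← integral_sub_left_eq_self θ volume t]
  exact setIntegral_le_integral (hi.comp_sub_left t) (Eventually.of_forall fun _ => h0 _)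

theorem intervalIntegral_translate_le_one (h0 : ∀ x, 0 ≤ θ x) (hi : Integrable θ)
    (h1 : ∫ x, θ x = 1) (hab : a ≤ b) (s : ℝ) : ∫ t in a..b, θ (t - s) ≤ 1 := by
  rw [intervalIntegral.integral_of_le hab, ← h1, ← integral_sub_right_eq_self θ s]
  exact setIntegral_le_integral (hi.comp_sub_right s) (Eventually.of_forall fun _ => h0 _)

end AvgKernel

/-! ### Geometry of the contraction -/

namespace RegularizationData

variable {Ω : Set (Eu d)} (reg : RegularizationData Ω n)

theorem center_mem_interior (hne : Ω.Nonempty) : reg.center ∈ interior Ω := by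
  refine interior_mono (fun x hx => ?_) reg.center_mem
  obtain ⟨z, hz⟩ := hne
  have := hx hz zero_le_one le_rfl (add_zero (1 : ℝ))
  simpa using this

/-- The set where the gauge is less than one is open, because the gauge is Lipschitz, and lies in
`Ω`, because `Ω` is star-shaped. It therefore contains no boundary point. -/
theorem one_le_gauge_of_mem_frontier (hne : Ω.Nonempty) {x : Eu d}
    (hx : x ∈ frontier Ω) : 1 ≤ gauge ((fun x => x - reg.center) '' Ω) (x - reg.center) := by
  set c := reg.center with hc
  set K := (fun x => x - c) '' Ω with hK
  by_contra! hlt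
  have hstar : StarConvex ℝ c Ω := interior_subset reg.center_mem
  have habs : Absorbent ℝ K := by
    refine absorbent_nhds_zero ?_
    have h1 : Ω ∈ 𝓝 c := mem_interior_iff_mem_nhds.1 (reg.center_mem_interior hne)
    have h2 : Tendsto (fun y => y + c) (𝓝 0) (𝓝 c) := by
      have : Continuous fun y : Eu d => y + c := by fun_prop
      simpa using this.tendsto 0
    filter_upwards [h2 h1] with y hy
    exact ⟨y + c, hy, by simp⟩
  have hsub : ∀ y, gauge K (y - c) < 1 → y ∈ Ω := by
    intro y hy
    obtain ⟨b, hb0, hb1, hb⟩ := exists_lt_of_gauge_lt habs hy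
    obtain ⟨w, ⟨z, hz, rfl⟩, hw⟩ := hb
    have h3 := hstar hz (sub_nonneg.2 hb1.le) hb0.le (by ring)
    have h4 : (1 - b) • c + b • z = y := by
      have : y = c + b • (z - c) := by
        have hw' : b • (z - c) = y - c := hw
        rw [hw']
        abel
      rw [this, sub_smul, smul_sub, one_smul]
      abel
    rwa [h4] at h3
  have hopen : IsOpen {y | gauge K (y - c) < 1} :=
    isOpen_lt (reg.lipschitz.continuous.comp (by fun_prop)) continuous_const
  have hint : x ∈ interior Ω := interior_maximal (fun y hy => hsub y hy) hopen hlt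
  exact hx.2 hint

/-- The dilated boundary point has gauge at least `1 + Lε`, a point of `Ω` has gauge at most `1`,
and the gauge is `L`-Lipschitz. -/
theorem le_norm_expand_sub (hne : Ω.Nonempty) {ε : ℝ} (hε : 0 < ε)
    {x z : Eu d} (hx : x ∈ frontier Ω) (hz : z ∈ Ω) : ε ≤ ‖reg.expand ε x - z‖ := by
  have h1 := reg.one_le_gauge_of_mem_frontier hne hx
  set c := reg.center with hc
  set K := (fun x => x - c) '' Ω with hK
  have hL : (0 : ℝ) ≤ reg.L := reg.L.2
  have h2 : gauge K (z - c) ≤ 1 := gauge_le_one_of_mem ⟨z, hz, rfl⟩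
  have h3 : gauge K (reg.expand ε x - c) = (1 + reg.L * ε) * gauge K (x - c) := by
    rw [expand, add_sub_cancel_left, gauge_smul_of_nonneg (by positivity), smul_eq_mul]
  have h4 := reg.lipschitz.dist_le_mul (reg.expand ε x - c) (z - c)
  rw [Real.dist_eq, dist_eq_norm, sub_sub_sub_cancel_right, ← hc, ← hK, h3] at h4
  have h5 := (le_abs_self _).trans h4
  -- The gauge is `0` at the origin and at least `1` at a boundary point, so it is not constant.
  have hLpos : (0 : ℝ) < reg.L := by
    refine lt_of_le_of_ne hL fun h0 => ?_
    have h6 := reg.lipschitz.dist_le_mul (x - c) 0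
    rw [← h0, zero_mul, gauge_zero, Real.dist_eq, sub_zero] at h6
    have := (le_abs_self _).trans h6
    linarith
  have h7 : (reg.L : ℝ) * ε ≤ reg.L * ‖reg.expand ε x - z‖ := by
    have : (reg.L : ℝ) * ε * 1 ≤ reg.L * ε * gauge K (x - c) :=
      mul_le_mul_of_nonneg_left h1 (by positivity)
    nlinarith
  exact le_of_mul_le_mul_left h7 hLpos

theorem infDist_expand_le {R : ℝ} (hR : ∀ x ∈ Ω, ‖x - reg.center‖ ≤ R) {ε : ℝ} (hε : 0 < ε)
    {x : Eu d} (hx : x ∈ Ω) : Metric.infDist (reg.expand ε x) Ω ≤ reg.L * ε * R := by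
  refine (Metric.infDist_le_dist_of_mem hx).trans ?_
  have h1 : reg.expand ε x - x = (reg.L * ε : ℝ) • (x - reg.center) := by
    rw [expand, add_smul, one_smul]
    abel
  have hL : (0 : ℝ) ≤ reg.L := reg.L.2
  rw [dist_eq_norm, h1, norm_smul, Real.norm_eq_abs, abs_of_nonneg (by positivity)]
  exact mul_le_mul_of_nonneg_left (hR x hx) (by positivity)

/-- The mollification of `lift`. -/
def mollLift (ε : ℝ) (y : Eu d) : Mat n n :=
  Matrix.of fun i j => ∫ z, rescale reg.molX ε (y - z) * reg.lift z i j

theorem integrable_lift (hne : Ω.Nonempty) (hΩ : IsCompact Ω) (i j : Fin n) :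
    Integrable fun z => reg.lift z i j := by
  obtain ⟨R, hR⟩ := hΩ.isBounded.subset_closedBall (0 : Eu d)
  refine (reg.lift_smooth i j).continuous.integrable_of_hasCompactSupport
    (HasCompactSupport.intro (isCompact_closedBall 0 (R + 1)) fun x hx => ?_)
  rw [reg.lift_support x, Matrix.zero_apply]
  by_contra! hle
  obtain ⟨z, hz, hz'⟩ := hΩ.exists_infDist_eq_dist hne x
  have h1 := hR hz
  rw [Metric.mem_closedBall] at h1 hx
  linarith [dist_triangle x z 0]

theorem mollLift_apply (ε : ℝ) (y : Eu d) (i j : Fin n) :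
    reg.mollLift ε y i j = smooth volume (fun z => reg.lift z i j) id (rescale reg.molX ε) y := by
  simp only [mollLift, smooth, Matrix.of_apply, smul_eq_mul, id]
  exact integral_congr_ae (Eventually.of_forall fun z => mul_comm _ _)

theorem integrable_mollLift (hne : Ω.Nonempty) (hΩ : IsCompact Ω) {ε : ℝ} (hε : 0 < ε)
    (y : Eu d) (i j : Fin n) :
    Integrable fun z => rescale reg.molX ε (y - z) * reg.lift z i j := by
  have := integrable_smooth (p := id) (reg.integrable_lift hne hΩ i j) measurable_id
    (reg.molX_spec.contDiff_rescale ε).continuous (reg.molX_spec.hasCompactSupport_rescale hε) y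
  simpa [mul_comm] using this

theorem transpose_lift (z : Eu d) (i j : Fin n) : reg.lift z j i = reg.lift z i j :=
  congrFun (congrFun (transpose_of_isHermitian (reg.lift_posSemidef z).1) i) j

/-- The mollifier has mass one and is supported in a ball of radius `ε` around `y`, where the lift
dominates the identity. -/
theorem posSemidef_mollLift_sub_one (hne : Ω.Nonempty) (hΩ : IsCompact Ω) {ε : ℝ} (hε : 0 < ε)
    {y : Eu d} (hy : Metric.infDist y Ω + ε ≤ 1 / 2) :
    (reg.mollLift ε y - 1).PosSemidef := by
  refine posSemidef_iff.2 ⟨?_, fun v => ?_⟩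
  · rw [Matrix.transpose_sub, Matrix.transpose_one]
    congr 1
    ext i j
    simp only [mollLift, Matrix.transpose_apply, Matrix.of_apply, reg.transpose_lift]
  · have hi := reg.integrable_mollLift hne hΩ hε y
    have hθ : Integrable fun z => rescale reg.molX ε (y - z) := by
      refine Integrable.comp_sub_left (f := rescale reg.molX ε) ?_ y
      exact (reg.molX_spec.contDiff_rescale ε).continuous.integrable_of_hasCompactSupport
        (reg.molX_spec.hasCompactSupport_rescale hε)
    have h1 : v ⬝ᵥ (reg.mollLift ε y *ᵥ v) =
        ∫ z, rescale reg.molX ε (y - z) * (v ⬝ᵥ (reg.lift z *ᵥ v)) := by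
      have h2 : (fun z => rescale reg.molX ε (y - z) * (v ⬝ᵥ (reg.lift z *ᵥ v))) = fun z =>
          ∑ i, ∑ j, v i * v j * (rescale reg.molX ε (y - z) * reg.lift z i j) := by
        funext z
        rw [dotProduct_mulVec_eq_sum, Finset.mul_sum]
        refine Finset.sum_congr rfl fun i _ => ?_
        rw [Finset.mul_sum]
        refine Finset.sum_congr rfl fun j _ => ?_
        ring
      rw [h2, integral_finsetSum _ fun i _ => integrable_finsetSum _ fun j _ =>
        (hi i j).const_mul _, dotProduct_mulVec_eq_sum]
      refine Finset.sum_congr rfl fun i _ => ?_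
      rw [integral_finsetSum _ fun j _ => (hi i j).const_mul _]
      refine Finset.sum_congr rfl fun j _ => ?_
      rw [integral_const_mul]
      rfl
    have h3 : v ⬝ᵥ v = ∫ z, rescale reg.molX ε (y - z) * (v ⬝ᵥ v) := by
      rw [integral_mul_const, integral_sub_left_eq_self (rescale reg.molX ε),
        reg.molX_spec.integral_rescale hε, one_mul]
    rw [Matrix.sub_mulVec, dotProduct_sub, Matrix.one_mulVec, sub_nonneg, h1]
    conv_lhs => rw [h3]
    refine integral_mono (hθ.mul_const _) ?_ fun z => ?_
    · simp only [dotProduct_mulVec_eq_sum, Finset.mul_sum]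
      refine integrable_finsetSum _ fun i _ => integrable_finsetSum _ fun j _ => ?_
      refine ((hi i j).const_mul (v i * v j)).congr (Eventually.of_forall fun z => ?_)
      simp only
      ring
    · rcases le_or_gt ε ‖y - z‖ with h | h
      · simp [reg.molX_spec.rescale_eq_zero hε h]
      · refine mul_le_mul_of_nonneg_left ?_ (reg.molX_spec.rescale_nonneg hε _)
        have h4 : Metric.infDist z Ω ≤ 1 / 2 := by
          have h5 := Metric.infDist_le_infDist_add_dist (s := Ω) (x := z) (y := y)
          rw [dist_comm, dist_eq_norm] at h5
          linarith
        have h6 := (posSemidef_iff.1 (reg.lift_ge_one z h4)).2 v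
        rw [Matrix.sub_mulVec, dotProduct_sub, Matrix.one_mulVec] at h6
        linarith

end RegularizationData

/-! ### The regularized fields -/

/-- The sum of the masses of the entries of a matrix-valued measure. -/
def MatMeasure.mass {α : Type*} [MeasurableSpace α] {n m : ℕ} (ν : MatMeasure α n m)
    (lam : Measure α) : ℝ := ∑ i, ∑ j, ∫ z, |ν.density lam z i j| ∂lam

theorem MatMeasure.integral_abs_density_le {α : Type*} [MeasurableSpace α] {n m : ℕ}
    (ν : MatMeasure α n m) (lam : Measure α) (i : Fin n) (j : Fin m) :
    ∫ z, |ν.density lam z i j| ∂lam ≤ ν.mass lam := by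
  have h0 : ∀ i j, 0 ≤ ∫ z, |ν.density lam z i j| ∂lam := fun i j =>
    integral_nonneg fun _ => abs_nonneg _
  refine (Finset.single_le_sum (f := fun j => ∫ z, |ν.density lam z i j| ∂lam)
    (fun j _ => h0 i j) (Finset.mem_univ j)).trans ?_
  exact Finset.single_le_sum (f := fun i => ∑ j, ∫ z, |ν.density lam z i j| ∂lam)
    (fun i _ => Finset.sum_nonneg fun j _ => h0 i j) (Finset.mem_univ i)

theorem scalarIntegral_smooth {α : Type*} [MeasurableSpace α] {m : ℕ} {ν : MatMeasure α n m}
    {lam : Measure α} [IsFiniteMeasure lam] (hac : ν.AC lam) {w : α → ℝ} (hw : Measurable w)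
    {K : ℝ} (hK : ∀ z, |w z| ≤ K) {p : α → Eu d} (hp : Measurable p) {g : Eu d → ℝ} {B : ℝ}
    (hg : SmoothBdd g B) (y : Eu d) (i : Fin n) (j : Fin m) :
    ν.scalarIntegral (fun z => w z * g (y - p z)) i j =
      smooth lam (fun z => w z * ν.density lam z i j) p g y := by
  rw [MatMeasure.scalarIntegral_apply hac (f := fun z => w z * g (y - p z))
    (hw.mul (hg.smooth.continuous.measurable.comp (measurable_const.sub hp))) (C := K * B)]
  · unfold smooth
    refine integral_congr_ae (Eventually.of_forall fun z => ?_)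
    simp only [smul_eq_mul]
    ring
  · intro z
    rw [abs_mul]
    exact mul_le_mul (hK z) (hg.zero _) (abs_nonneg _) ((abs_nonneg _).trans (hK z))

theorem smoothBdd_scalarIntegral {α : Type*} [MeasurableSpace α] {m : ℕ} {ν : MatMeasure α n m}
    {lam : Measure α} [IsFiniteMeasure lam] (hac : ν.AC lam) {w : α → ℝ} (hw : Measurable w)
    {K : ℝ} (hK : ∀ z, |w z| ≤ K) (hK0 : 0 ≤ K) {p : α → Eu d} (hp : Measurable p)
    {g : Eu d → ℝ} {B : ℝ} (hg : SmoothBdd g B) (hgc : HasCompactSupport g)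
    (i : Fin n) (j : Fin m) :
    SmoothBdd (fun y => ν.scalarIntegral (fun z => w z * g (y - p z)) i j)
      (B * (K * ν.mass lam)) := by
  have hi := MatMeasure.integrable_mul_density ν lam hw hK i j
  rw [show (fun y => ν.scalarIntegral (fun z => w z * g (y - p z)) i j) =
    smooth lam (fun z => w z * ν.density lam z i j) p g from
    funext fun y => scalarIntegral_smooth hac hw hK hp hg y i j]
  refine (SmoothBdd.smoothing hi hp hg hgc).mono
    (mul_le_mul_of_nonneg_left ?_ hg.nonneg)
  refine le_trans ?_ (mul_le_mul_of_nonneg_left (ν.integral_abs_density_le lam i j) hK0)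
  rw [← integral_const_mul]
  refine integral_mono hi.norm ((ν.integrable_density lam i j).abs.const_mul K) fun z => ?_
  simp only [abs_mul]
  exact mul_le_mul_of_nonneg_right (hK z) (abs_nonneg _)

theorem dd_scalarIntegral {α : Type*} [MeasurableSpace α] {m : ℕ} {ν : MatMeasure α n m}
    {lam : Measure α} [IsFiniteMeasure lam] (hac : ν.AC lam) {w : α → ℝ} (hw : Measurable w)
    {K : ℝ} (hK : ∀ z, |w z| ≤ K) {p : α → Eu d} (hp : Measurable p)
    {g : Eu d → ℝ} (hg : ContDiff ℝ ∞ g) (hgc : HasCompactSupport g)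
    (i : Fin n) (j : Fin m) (c : Fin d) :
    dd c (fun y => ν.scalarIntegral (fun z => w z * g (y - p z)) i j) =
      fun y => ν.scalarIntegral (fun z => w z * dd c g (y - p z)) i j := by
  obtain ⟨B, hB⟩ := SmoothBdd.of_compactSupport hg hgc
  obtain ⟨B', hB'⟩ := SmoothBdd.of_compactSupport (contDiff_dd hg c) (hasCompactSupport_dd hgc c)
  rw [show (fun y => ν.scalarIntegral (fun z => w z * g (y - p z)) i j) =
    smooth lam (fun z => w z * ν.density lam z i j) p g from
    funext fun y => scalarIntegral_smooth hac hw hK hp hB y i j,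
    dd_smooth (MatMeasure.integrable_mul_density ν lam hw hK i j) hp hg hgc]
  exact funext fun y => (scalarIntegral_smooth hac hw hK hp hB' y i j).symm

namespace RegularizationData

variable {Ω : Set (Eu d)} (reg : RegularizationData Ω n)

/-- The integral of a measure on `Q` against the kernel `κ(t) g(y - x)`. -/
def smear {m : ℕ} (κ : ℝ → ℝ) (g : Eu d → ℝ) (ν : MatMeasure (TimeSpace Ω) n m) (y : Eu d) :
    Mat n m :=
  ν.scalarIntegral fun z => κ z.1 * g (y - z.2)

/-- The flux of the regularized curve for a general time kernel. -/
def kerq (k₁ : ℕ) (ε : ℝ) (κ : ℝ → ℝ) (μ : CurveMeasure Ω n k) (x : Eu d) : Mat n k :=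
  Matrix.of fun i j => (1 + reg.L * ε) ^ d * (1 + 2 * ε) * (1 - ε) *
    (if (j : ℕ) < k₁ then 1 else (1 + reg.L * ε)⁻¹) *
      smear κ (rescale reg.molX ε) μ.q (reg.expand ε x) i j

/-- The reaction term of the regularized curve for a general time kernel. -/
def kerR (ε : ℝ) (κ : ℝ → ℝ) (μ : CurveMeasure Ω n k) (x : Eu d) : Mat n n :=
  ((1 + reg.L * ε) ^ d * (1 + 2 * ε) * (1 - ε)) •
    smear κ (rescale reg.molX ε) μ.R (reg.expand ε x)

theorem measurable_time {κ : ℝ → ℝ} (hκ : Continuous κ) :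
    Measurable fun z : TimeSpace Ω => κ z.1 :=
  hκ.measurable.comp (measurable_subtype_coe.comp measurable_fst)

theorem measurable_space : Measurable fun z : TimeSpace Ω => (z.2 : Eu d) :=
  measurable_subtype_coe.comp measurable_snd

theorem measurable_kernel {κ : ℝ → ℝ} (hκ : Continuous κ) {g : Eu d → ℝ} (hg : Continuous g)
    (y : Eu d) : Measurable fun z : TimeSpace Ω => κ z.1 * g (y - z.2) :=
  (measurable_time hκ).mul (hg.measurable.comp (measurable_const.sub measurable_space))

theorem abs_kernel_le {κ : ℝ → ℝ} {g : Eu d → ℝ} {K K' : ℝ} (hK : ∀ t, |κ t| ≤ K)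
    (hK' : ∀ x, |g x| ≤ K') (y : Eu d) (z : TimeSpace Ω) : |κ z.1 * g (y - z.2)| ≤ K * K' := by
  rw [abs_mul]
  exact mul_le_mul (hK _) (hK' _) (abs_nonneg _) ((abs_nonneg _).trans (hK 0))

theorem one_le_factor {ε : ℝ} (hε : 0 < ε) : 1 ≤ 1 + reg.L * ε := by
  have : (0 : ℝ) ≤ reg.L := reg.L.2
  nlinarith [mul_nonneg this hε.le]

theorem smoothBdd_smear {m : ℕ} {ν : MatMeasure (TimeSpace Ω) n m} {lam : Measure (TimeSpace Ω)}
    [IsFiniteMeasure lam] (hac : ν.AC lam) {κ : ℝ → ℝ} (hκ : Continuous κ) {K : ℝ}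
    (hK : ∀ t, |κ t| ≤ K) {g : Eu d → ℝ} {B : ℝ} (hg : SmoothBdd g B) (hgc : HasCompactSupport g)
    (i : Fin n) (j : Fin m) :
    SmoothBdd (fun y => smear κ g ν y i j) (B * (K * ν.mass lam)) :=
  smoothBdd_scalarIntegral hac (measurable_time hκ) (fun _ => hK _)
    ((abs_nonneg _).trans (hK 0)) measurable_space hg hgc i j

/-- The bound depends on the time kernel only through `K`. One constant serves all time steps and
all `N`, as the consistency of the sampled action requires. -/
theorem exists_smoothBdd_kerq (k₁ : ℕ) {ε : ℝ} (hε : 0 < ε) (K : ℝ) (μ : CurveMeasure Ω n k) :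
    ∃ E, ∀ κ : ℝ → ℝ, Continuous κ → (∀ t, |κ t| ≤ K) → ∀ i j,
      SmoothBdd (fun x => reg.kerq k₁ ε κ μ x i j) E := by
  obtain ⟨B, hB⟩ := SmoothBdd.of_compactSupport (reg.molX_spec.contDiff_rescale ε)
    (reg.molX_spec.hasCompactSupport_rescale hε)
  have ha := reg.one_le_factor hε
  set a := 1 + reg.L * ε with hadef
  refine ⟨|a ^ d * (1 + 2 * ε) * (1 - ε)| * (a ^ 2 * (B * (K * μ.q.mass μ.dom))),
    fun κ hκ hK i j => ?_⟩
  have h1 := ((smoothBdd_smear μ.ac_q hκ hK hB (reg.molX_spec.hasCompactSupport_rescale hε)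
    i j).comp_affine reg.center ha)
  refine (h1.const_mul (a ^ d * (1 + 2 * ε) * (1 - ε) *
    (if (j : ℕ) < k₁ then 1 else a⁻¹))).mono (mul_le_mul_of_nonneg_right ?_ h1.nonneg)
  rw [abs_mul]
  refine mul_le_of_le_one_right (abs_nonneg _) ?_
  split_ifs
  · simp
  · rw [abs_inv, abs_of_pos (by linarith)]
    exact inv_le_one_of_one_le₀ ha

theorem exists_smoothBdd_kerR {ε : ℝ} (hε : 0 < ε) (K : ℝ) (μ : CurveMeasure Ω n k) :
    ∃ E, ∀ κ : ℝ → ℝ, Continuous κ → (∀ t, |κ t| ≤ K) → ∀ i j,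
      SmoothBdd (fun x => reg.kerR ε κ μ x i j) E := by
  obtain ⟨B, hB⟩ := SmoothBdd.of_compactSupport (reg.molX_spec.contDiff_rescale ε)
    (reg.molX_spec.hasCompactSupport_rescale hε)
  have ha := reg.one_le_factor hε
  exact ⟨_, fun κ hκ hK i j => ((smoothBdd_smear μ.ac_R hκ hK hB
    (reg.molX_spec.hasCompactSupport_rescale hε) i j).comp_affine reg.center ha).const_mul _⟩

theorem integrable_molT {ε : ℝ} (hε : 0 < ε) : Integrable (rescale reg.molT ε) :=
  (reg.molT_spec.contDiff_rescale ε).continuous.integrable_of_hasCompactSupport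
    (reg.molT_spec.hasCompactSupport_rescale hε)

theorem preG_eq (ε : ℝ) (G : Fin 2 → MatMeasure Ω n n) (μ : CurveMeasure Ω n k) (t : ℝ)
    (y : Eu d) : reg.preG ε G μ t y =
      (1 - ε) • (smear (fun s => rescale reg.molT ε (t - s)) (rescale reg.molX ε) μ.G y
      + (∫ s in Iio (0 : ℝ), rescale reg.molT ε (t - s)) • reg.mollΩ ε (G 0) y
      + (∫ s in Ioi (1 : ℝ), rescale reg.molT ε (t - s)) • reg.mollΩ ε (G 1) y)
    + ε • reg.mollLift ε y := rfl

theorem smoothBdd_mollΩ {ν : MatMeasure Ω n n} {ε B : ℝ} (hε : 0 < ε)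
    (hB : SmoothBdd (rescale reg.molX ε) B) (i j : Fin n) :
    SmoothBdd (fun y => reg.mollΩ ε ν y i j) (B * (1 * ν.mass ν.dom)) := by
  have := smoothBdd_scalarIntegral (ν := ν) (MatMeasure.ac_of_dom_le le_rfl)
    (measurable_const (a := (1 : ℝ)))
    (K := 1) (by simp) zero_le_one (measurable_subtype_coe (p := fun x => x ∈ Ω)) hB
    (reg.molX_spec.hasCompactSupport_rescale hε) i j
  simpa only [one_mul, mollΩ] using this

/-- Uniformity in `s` holds because the time mollifier is bounded and the past and future weights
lie in `[0, 1]`. -/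
theorem exists_smoothBdd_regG (hne : Ω.Nonempty) (hΩ : IsCompact Ω) {ε : ℝ} (hε : 0 < ε)
    (G : Fin 2 → MatMeasure Ω n n) (μ : CurveMeasure Ω n k) :
    ∃ E, ∀ s i j, SmoothBdd (fun x => reg.regG ε G μ s x i j) E := by
  have hc := reg.molX_spec.hasCompactSupport_rescale hε
  obtain ⟨B, hB⟩ := SmoothBdd.of_compactSupport (reg.molX_spec.contDiff_rescale ε) hc
  obtain ⟨K, hK0, hK⟩ := reg.molT_spec.exists_bound_rescale hε
  have ha := reg.one_le_factor hε
  have hl : ∀ i j : Fin n, ∃ E, SmoothBdd (fun y => reg.mollLift ε y i j) E := fun i j => by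
    simp only [mollLift_apply]
    exact ⟨_, SmoothBdd.smoothing (reg.integrable_lift hne hΩ i j) measurable_id hB hc⟩
  choose E hE using hl
  have hE0 : ∀ i j, 0 ≤ E i j := fun i j => (hE i j).nonneg
  have hw := fun (A : Set ℝ) t => weight_mem (θ := rescale reg.molT ε)
    (reg.molT_spec.rescale_nonneg hε) (reg.integrable_molT hε)
    (reg.molT_spec.integral_rescale hε) A t
  refine ⟨|(1 + reg.L * ε) ^ d| * ((1 + reg.L * ε) ^ 2 * (|1 - ε| * (B * (K * μ.G.mass μ.dom) +
    B * (1 * (G 0).mass (G 0).dom) + B * (1 * (G 1).mass (G 1).dom)) +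
      |ε| * ∑ i, ∑ j, E i j)), fun s i j => ?_⟩
  have h1 := smoothBdd_smear μ.ac_G (κ := fun r => rescale reg.molT ε (time ε s - r))
    ((reg.molT_spec.contDiff_rescale ε).continuous.comp (by fun_prop)) (fun t => hK _) hB hc i j
  have h2 : ∀ (A : Set ℝ) (l : Fin 2), SmoothBdd
      (fun y => (∫ r in A, rescale reg.molT ε (time ε s - r)) * reg.mollΩ ε (G l) y i j)
      (B * (1 * (G l).mass (G l).dom)) := fun A l => by
    have h3 := reg.smoothBdd_mollΩ (ν := G l) hε hB i j
    refine (h3.const_mul _).mono (mul_le_of_le_one_left h3.nonneg ?_)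
    rw [abs_of_nonneg (hw A _).1]
    exact (hw A _).2
  have h4 : E i j ≤ ∑ i, ∑ j, E i j :=
    (Finset.single_le_sum (fun j _ => hE0 i j) (Finset.mem_univ j)).trans
      (Finset.single_le_sum (f := fun i => ∑ j, E i j)
        (fun i _ => Finset.sum_nonneg fun j _ => hE0 i j) (Finset.mem_univ i))
  exact ((((((h1.add (h2 (Iio 0) 0)).add (h2 (Ioi 1) 1)).const_mul (1 - ε)).add
    (((hE i j).mono h4).const_mul ε)).comp_affine reg.center ha).const_mul
      ((1 + reg.L * ε) ^ d))

/-- The regularized flux vanishes on the boundary. -/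
theorem kerq_eq_zero (hne : Ω.Nonempty) (k₁ : ℕ) {ε : ℝ} (hε : 0 < ε) (κ : ℝ → ℝ)
    (μ : CurveMeasure Ω n k) {x : Eu d} (hx : x ∈ frontier Ω) : reg.kerq k₁ ε κ μ x = 0 := by
  have h1 : (fun z : TimeSpace Ω => κ z.1 * rescale reg.molX ε (reg.expand ε x - z.2)) =
      fun _ => 0 := by
    funext z
    rw [reg.molX_spec.rescale_eq_zero hε (reg.le_norm_expand_sub hne hε hx z.2.2), mul_zero]
  ext i j
  simp only [kerq, smear, h1, Matrix.of_apply, MatMeasure.scalarIntegral, Matrix.zero_apply]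
  rw [VectorMeasure.integral_zero, mul_zero]

theorem boundaryCondition_kerq (hne : Ω.Nonempty) (P : DiffOp d n k) (k₁ : ℕ) {ε : ℝ} (hε : 0 < ε)
    (κ : ℝ → ℝ) (μ : CurveMeasure Ω n k) : P.BoundaryCondition Ω (reg.kerq k₁ ε κ μ) := by
  intro x hx ν _
  refine Finset.sum_eq_zero fun c _ => ?_
  rw [reg.kerq_eq_zero hne k₁ hε κ μ hx]
  ext i j
  simp [adj, dot]

end RegularizationData

/-! ### The time-discrete continuity equation of the regularized curve -/

theorem adj_transpose {L : Mat n n →ₗ[ℝ] Mat n k} (hL : ∀ A, L Aᵀ = L A) (q : Mat n k) :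
    (adj L q)ᵀ = adj L q := by
  ext i j
  simp only [adj, Matrix.transpose_apply, Matrix.of_apply]
  rw [← hL, Matrix.transpose_single]

theorem DiffOp.D_transpose (P : DiffOp d n k) (q : Eu d → Mat n k) (x : Eu d) :
    (P.D q x)ᵀ = P.D q x := by
  simp only [DiffOp.D, Matrix.transpose_add, Matrix.transpose_neg, Matrix.transpose_sum,
    adj_transpose P.zeroth_transpose, adj_transpose (P.first_transpose _)]

theorem DiffOp.dot_D (P : DiffOp d n k) (q : Eu d → Mat n k) (x : Eu d) (A : Mat n n) :
    dot (P.D q x) A = -dot (q x) (P.zeroth A) + ∑ c, dot (pd c q x) (P.first c A) := by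
  rw [DiffOp.D, dot_add_left, dot_neg_left, dot_sum_left, dot_adj]
  simp only [dot_adj]

theorem dot_symmPart {R A : Mat n n} (hA : Aᵀ = A) :
    dot ((1 / 2 : ℝ) • (R + Rᵀ)) A = dot R A := by
  have h : dot Rᵀ A = dot R A := by
    conv_lhs => rw [← hA]
    exact dot_transpose _ _
  rw [dot_smul_left, dot_add_left, h]
  ring

namespace RegularizationData

variable {Ω : Set (Eu d)} (reg : RegularizationData Ω n)

theorem smear_neg_right {m : ℕ} {ν : MatMeasure (TimeSpace Ω) n m} {lam : Measure (TimeSpace Ω)}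
    [IsFiniteMeasure lam] (hac : ν.AC lam) {κ : ℝ → ℝ} (hκ : Continuous κ) {K K' : ℝ}
    (hK : ∀ t, |κ t| ≤ K) {g : Eu d → ℝ} (hg : Continuous g) (hK' : ∀ x, |g x| ≤ K') (y : Eu d) :
    smear κ (fun x => -g x) ν y = -smear κ g ν y := by
  have := MatMeasure.scalarIntegral_const_mul hac (measurable_kernel hκ hg y)
    (abs_kernel_le hK hK' y) (-1)
  rw [neg_one_smul] at this
  rw [smear, smear, ← this]
  congr 1
  funext z
  ring

/-- The continuity equation tested with `κ(t) g(y - x) A`. -/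
theorem continuityEquation_kernel {P : DiffOp d n k} {G : Fin 2 → MatMeasure Ω n n}
    {μ : CurveMeasure Ω n k} (hμ : μ.ContinuityEquation P G) {κ κ' : ℝ → ℝ}
    (hκ : ContDiff ℝ 1 κ) (hκ' : ∀ t, HasDerivAt κ (κ' t) t) (hc' : Continuous κ') {K K' : ℝ}
    (hK : ∀ t, |κ t| ≤ K) (hK' : ∀ t, |κ' t| ≤ K') {g : Eu d → ℝ} (hg : ContDiff ℝ ∞ g)
    (hgc : HasCompactSupport g) (y : Eu d) {A : Mat n n} (hA : Aᵀ = A) :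
    dot (smear κ' g μ.G y) A + (dot (smear κ g μ.q y) (P.zeroth A) -
        ∑ c, dot (smear κ (dd c g) μ.q y) (P.first c A)) + dot (smear κ g μ.R y) A =
      κ 1 * dot ((G 1).scalarIntegral fun x => g (y - x)) A -
        κ 0 * dot ((G 0).scalarIntegral fun x => g (y - x)) A := by
  obtain ⟨B, hB⟩ := SmoothBdd.of_compactSupport hg hgc
  have hgy : ContDiff ℝ ∞ fun x => g (y - x) := hg.comp (contDiff_const.sub contDiff_id)
  have h := hμ (fun t x => (κ t * g (y - x)) • A)
    (fun t x => by rw [Matrix.transpose_smul, hA]) (fun i j => by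
      have h1 : ContDiff ℝ 1 fun z : ℝ × Eu d => κ z.1 := hκ.comp contDiff_fst
      have h2 : ContDiff ℝ 1 fun z : ℝ × Eu d => g (y - z.2) :=
        (hgy.of_le (by exact_mod_cast le_top)).comp contDiff_snd
      exact (h1.mul h2).mul contDiff_const)
  have e1 : (fun z : TimeSpace Ω => Matrix.of fun i j =>
      deriv (fun s => ((κ s * g (y - (z.2 : Eu d))) • A) i j) (z.1 : ℝ)) =
      fun z => (κ' z.1 * g (y - z.2)) • A := by
    funext z
    ext i j
    exact (((hκ' z.1).mul_const (g (y - z.2))).mul_const (A i j)).deriv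
  -- The index `none` carries the zeroth-order part of `D*` and `some c` the derivative in direction
  -- `c`; the minus sign comes from differentiating `g (y - x)` in `x`.
  have e2 : (fun z : TimeSpace Ω => P.star (fun x => (κ (z.1 : ℝ) * g (y - x)) • A) z.2) =
      fun z => ∑ o : Option (Fin d), (Option.elim o (κ z.1 * g (y - z.2))
        fun c => κ z.1 * (fun x => -dd c g x) (y - z.2)) •
          (Option.elim o (P.zeroth A) fun c => P.first c A) := by
    funext z
    rw [Fintype.sum_option, DiffOp.star, map_smul]
    congr 1
    refine Finset.sum_congr rfl fun c _ => ?_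
    have h3 : pd c (fun x => (κ (z.1 : ℝ) * g (y - x)) • A) z.2 =
        (κ z.1 * -dd c g (y - z.2)) • A := by
      ext i j
      have h4 : (fun x => ((κ (z.1 : ℝ) * g (y - x)) • A) i j) =
          fun x => (κ z.1 * A i j) * g (y - x) := by
        funext x
        simp only [Matrix.smul_apply, smul_eq_mul]
        ring
      have h5 := congrFun (dd_const_mul hgy (κ z.1 * A i j) c) z.2
      beta_reduce at h5
      rw [pd_apply, h4, h5, dd_comp_sub hg, Matrix.smul_apply, smul_eq_mul]
      ring
    rw [h3, map_smul]
    rfl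
  have hm : ∀ {h : Eu d → ℝ}, Continuous h → Measurable fun x : Ω => h (y - x) := fun hh =>
    hh.measurable.comp (measurable_const.sub measurable_subtype_coe)
  have e3 : ∀ (i : Fin 2) (t : ℝ), (G i).pair (fun x : Ω => (κ t * g (y - x)) • A) =
      κ t * dot ((G i).scalarIntegral fun x => g (y - x)) A := by
    intro i t
    have hac : (G i).AC (G i).dom := MatMeasure.ac_of_dom_le le_rfl
    rw [MatMeasure.pair_smul hac (f := fun x : Ω => κ t * g (y - x))
      ((hm hg.continuous).const_mul _) (C := |κ t| * B)
      (fun x => by rw [abs_mul]; exact mul_le_mul_of_nonneg_left (hB.zero _) (abs_nonneg _)),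
      MatMeasure.scalarIntegral_const_mul hac (hm hg.continuous) (fun x => hB.zero _),
      dot_smul_left]
  have hbd : ∀ (o : Option (Fin d)) (z : TimeSpace Ω), |Option.elim o (κ z.1 * g (y - z.2))
        fun c => κ z.1 * (fun x => -dd c g x) (y - z.2)| ≤ K * B := by
    intro o z
    rcases o with _ | c
    · exact abs_kernel_le hK hB.zero y z
    · exact abs_kernel_le (g := fun x => -dd c g x) (K' := B) hK (fun x => by rw [abs_neg]; exact hB.one c x) y z
  have hme : ∀ o : Option (Fin d), Measurable fun z : TimeSpace Ω =>
      (Option.elim o (κ z.1 * g (y - z.2)) fun c => κ z.1 * (fun x => -dd c g x) (y - z.2)) := by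
    intro o
    rcases o with _ | c
    · exact measurable_kernel hκ.continuous hg.continuous y
    · exact measurable_kernel (g := fun x => -dd c g x) hκ.continuous
        (contDiff_dd hg c).continuous.neg y
  have e4 := MatMeasure.pair_sum_smul μ.ac_q hme hbd
    (fun o => Option.elim o (P.zeroth A) fun c => P.first c A)
  rw [e1, e2, e3 1 1, e3 0 0, e4, MatMeasure.pair_smul μ.ac_G
    (f := fun z : TimeSpace Ω => κ' z.1 * g (y - z.2)) (measurable_kernel hc' hg.continuous y)
    (abs_kernel_le hK' hB.zero y), MatMeasure.pair_smul μ.ac_R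
    (f := fun z : TimeSpace Ω => κ z.1 * g (y - z.2))
    (measurable_kernel hκ.continuous hg.continuous y) (abs_kernel_le hK hB.zero y),
    Fintype.sum_option] at h
  rw [← h]
  congr 2
  rw [sub_eq_add_neg, ← Finset.sum_neg_distrib]
  congr 1
  refine Finset.sum_congr rfl fun c _ => ?_
  have h5 := smear_neg_right μ.ac_q hκ.continuous hK (contDiff_dd hg c).continuous (hB.one c) y
  rw [← dot_neg_left, ← h5]
  rfl

theorem regG_transpose {G : Fin 2 → MatMeasure Ω n n} (hG : ∀ i, (G i).IsSymm)
    (μ : CurveMeasure Ω n k) (ε s : ℝ) (x : Eu d) :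
    (reg.regG ε G μ s x)ᵀ = reg.regG ε G μ s x := by
  have h1 : ∀ y, (reg.mollLift ε y)ᵀ = reg.mollLift ε y := fun y => by
    ext i j
    simp only [mollLift, Matrix.transpose_apply, Matrix.of_apply, reg.transpose_lift]
  simp only [regG, preG_eq, Matrix.transpose_smul, Matrix.transpose_add, h1, smear, mollΩ,
    μ.symm.scalarIntegral_transpose, (hG 0).scalarIntegral_transpose,
    (hG 1).scalarIntegral_transpose]

/-- The chain rule gives a factor `1 + Lε`. It cancels the factor `(1 + Lε)⁻¹` on the columns `j ≥
k₁` and survives on the others. -/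
theorem pd_kerq (k₁ : ℕ) {ε : ℝ} (hε : 0 < ε) {κ : ℝ → ℝ} (hκ : Continuous κ) {K : ℝ}
    (hK : ∀ t, |κ t| ≤ K) (μ : CurveMeasure Ω n k) (c : Fin d) (x : Eu d) (i : Fin n)
    (j : Fin k) : pd c (reg.kerq k₁ ε κ μ) x i j =
      (1 + reg.L * ε) ^ d * (1 + 2 * ε) * (1 - ε) *
      (if (j : ℕ) < k₁ then 1 + reg.L * ε else 1) *
        smear κ (dd c (rescale reg.molX ε)) μ.q (reg.expand ε x) i j := by
  have hg := reg.molX_spec.contDiff_rescale ε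
  have hgc := reg.molX_spec.hasCompactSupport_rescale hε
  obtain ⟨B, hB⟩ := SmoothBdd.of_compactSupport hg hgc
  have hs := (smoothBdd_smear μ.ac_q hκ hK hB hgc i j)
  have ha := reg.one_le_factor hε
  have hs' := (hs.comp_affine reg.center ha).smooth
  have h1 := dd_comp_affine hs.smooth reg.center (1 + reg.L * ε) c
  have h2 := dd_scalarIntegral (ν := μ.q) μ.ac_q (measurable_time hκ) (fun _ => hK _)
    measurable_space hg hgc i j c
  have h3 := congrFun (dd_const_mul hs' ((1 + reg.L * ε) ^ d * (1 + 2 * ε) * (1 - ε) *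
    (if (j : ℕ) < k₁ then 1 else (1 + reg.L * ε)⁻¹)) c) x
  rw [pd_apply]
  refine h3.trans ?_
  rw [h1]
  beta_reduce
  have h4 : dd c (fun y => smear κ (rescale reg.molX ε) μ.q y i j)
      (reg.center + (1 + reg.L * ε) • (x - reg.center)) =
      smear κ (dd c (rescale reg.molX ε)) μ.q (reg.expand ε x) i j := congrFun h2 _
  rw [h4]
  split_ifs
  · ring
  · have : 1 + (reg.L : ℝ) * ε ≠ 0 := by linarith
    field_simp

/-- Here the splitting (C.2) acts: the zeroth-order part only sees columns without correction, the
first-order part only columns where the chain-rule factor has been cancelled. Both carry the same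
constant, so the equation is preserved. -/
theorem dot_D_kerq {P : DiffOp d n k} {k₁ : ℕ} (hP : P.SplitsAt k₁) {ε : ℝ} (hε : 0 < ε)
    {κ : ℝ → ℝ} (hκ : Continuous κ) {K : ℝ} (hK : ∀ t, |κ t| ≤ K) (μ : CurveMeasure Ω n k)
    (x : Eu d) (A : Mat n n) :
    dot (P.D (reg.kerq k₁ ε κ μ) x) A = ((1 + reg.L * ε) ^ d * (1 + 2 * ε) * (1 - ε)) *
      (-dot (smear κ (rescale reg.molX ε) μ.q (reg.expand ε x)) (P.zeroth A) +
        ∑ c, dot (smear κ (dd c (rescale reg.molX ε)) μ.q (reg.expand ε x)) (P.first c A)) := by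
  set W := (1 + reg.L * ε) ^ d * (1 + 2 * ε) * (1 - ε) with hW
  have h1 : dot (reg.kerq k₁ ε κ μ x) (P.zeroth A) =
      W * dot (smear κ (rescale reg.molX ε) μ.q (reg.expand ε x)) (P.zeroth A) := by
    simp only [dot_eq_sum, Finset.mul_sum]
    refine Finset.sum_congr rfl fun i _ => Finset.sum_congr rfl fun j _ => ?_
    simp only [kerq, Matrix.of_apply]
    split_ifs with hj
    · rw [← hW]
      ring
    · rw [hP.2.1 A i j (not_lt.1 hj)]
      ring
  have h2 : ∀ c, dot (pd c (reg.kerq k₁ ε κ μ) x) (P.first c A) =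
      W * dot (smear κ (dd c (rescale reg.molX ε)) μ.q (reg.expand ε x)) (P.first c A) := by
    intro c
    simp only [dot_eq_sum, Finset.mul_sum]
    refine Finset.sum_congr rfl fun i _ => Finset.sum_congr rfl fun j _ => ?_
    rw [reg.pd_kerq k₁ hε hκ hK]
    split_ifs with hj
    · rw [hP.2.2 c A i j hj]
      ring
    · rw [← hW]
      ring
  rw [DiffOp.dot_D, h1, mul_add, Finset.mul_sum]
  simp only [h2]
  ring

/-- The exact time-discrete continuity equation of the regularized curve. -/
theorem regG_sub_regG {P : DiffOp d n k} {k₁ : ℕ} (hP : P.SplitsAt k₁)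
    {G : Fin 2 → MatMeasure Ω n n} (hG : ∀ i, (G i).IsSymm) {μ : CurveMeasure Ω n k}
    (hμ : μ.ContinuityEquation P G) {ε : ℝ} (hε : 0 < ε) {s s' : ℝ} (hs : s < s') (x : Eu d) :
    reg.regG ε G μ s' x - reg.regG ε G μ s x = (s' - s) •
      (-P.D (reg.kerq k₁ ε (avgKernel (rescale reg.molT ε) (time ε s) (time ε s')) μ) x +
        (1 / 2 : ℝ) • (reg.kerR ε (avgKernel (rescale reg.molT ε) (time ε s) (time ε s')) μ x +
          (reg.kerR ε (avgKernel (rescale reg.molT ε) (time ε s) (time ε s')) μ x)ᵀ)) := by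
  set θ := rescale reg.molT ε with hθ
  set a := time ε s with ha
  set b := time ε s' with hb
  set κ := avgKernel θ a b with hκd
  set g := rescale reg.molX ε with hg
  set y := reg.expand ε x with hy
  have hba : b - a = (1 + 2 * ε) * (s' - s) := by
    rw [ha, hb, time, time]
    ring
  have hba0 : 0 < b - a := by
    rw [hba]
    have := sub_pos.2 hs
    positivity
  have hab : a < b := sub_pos.1 hba0
  have hθc : Continuous θ := (reg.molT_spec.contDiff_rescale ε).continuous
  obtain ⟨K, hK0, hK⟩ := reg.molT_spec.exists_bound_rescale hε
  have hκK : ∀ t, |κ t| ≤ K := abs_avgKernel_le hθc hab hK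
  have hgs : ContDiff ℝ ∞ g := reg.molX_spec.contDiff_rescale ε
  have hgc : HasCompactSupport g := reg.molX_spec.hasCompactSupport_rescale hε
  obtain ⟨B, hB⟩ := SmoothBdd.of_compactSupport hgs hgc
  have hsub : ∀ t, |θ (a - t) - θ (b - t)| ≤ K + K := fun t =>
    (abs_sub _ _).trans (add_le_add (hK _) (hK _))
  have hκ' : ∀ t, |(b - a)⁻¹ * (θ (a - t) - θ (b - t))| ≤ |(b - a)⁻¹| * (K + K) := fun t => by
    rw [abs_mul]
    exact mul_le_mul_of_nonneg_left (hsub t) (abs_nonneg _)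
  -- Both sides are symmetric, so it suffices to pair with a constant symmetric `A`, to which the
  -- weak equation for the averaged kernel applies.
  refine eq_of_dot_symm ?_ ?_ fun A hA => ?_
  · rw [Matrix.transpose_sub, reg.regG_transpose hG, reg.regG_transpose hG]
  · rw [Matrix.transpose_smul, Matrix.transpose_add, Matrix.transpose_neg, P.D_transpose,
      Matrix.transpose_smul, Matrix.transpose_add, Matrix.transpose_transpose, add_comm (_ᵀ)]
  have hCE := continuityEquation_kernel hμ (contDiff_avgKernel hθc a b)
    (hasDerivAt_avgKernel hθc a b) (by fun_prop) hκK hκ' hgs hgc y hA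
  have hsm : smear (fun t => (b - a)⁻¹ * (θ (a - t) - θ (b - t))) g μ.G y = (b - a)⁻¹ •
      (smear (fun t => θ (a - t)) g μ.G y - smear (fun t => θ (b - t)) g μ.G y) := by
    have m1 := measurable_kernel (Ω := Ω) (κ := fun t => θ (a - t)) (hθc.comp (by fun_prop))
      hgs.continuous y
    have m2 := measurable_kernel (Ω := Ω) (κ := fun t => θ (b - t)) (hθc.comp (by fun_prop))
      hgs.continuous y
    have b1 := abs_kernel_le (Ω := Ω) (κ := fun t => θ (a - t)) (fun t => hK _) hB.zero y
    have b2 := abs_kernel_le (Ω := Ω) (κ := fun t => θ (b - t)) (fun t => hK _) hB.zero y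
    unfold smear
    rw [← MatMeasure.scalarIntegral_sub μ.ac_G m1 m2 b1 b2,
      ← MatMeasure.scalarIntegral_const_mul μ.ac_G
        (f := fun z => θ (a - z.1) * g (y - z.2) - θ (b - z.1) * g (y - z.2))
        (m1.sub m2) (C := K * B + K * B)
        fun z => (abs_sub _ _).trans (add_le_add (b1 z) (b2 z))]
    congr 1
    funext z
    ring
  have hw0 := weight_past_sub (reg.integrable_molT hε) hab
  have hw1 := weight_future_sub (reg.integrable_molT hε) hab
  rw [← hθ, ← hκd] at hw0 hw1
  rw [hsm, dot_smul_left, dot_sub_left] at hCE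
  rw [dot_smul_left, dot_add_left, dot_neg_left, reg.dot_D_kerq hP hε
    (continuous_avgKernel hθc a b) hκK, dot_symmPart hA, kerR, dot_smul_left, ← hg, ← hy]
  simp only [regG, preG_eq, dot_sub_left, dot_smul_left, dot_add_left]
  rw [← ha, ← hb, ← hg, ← hy, ← hθ]
  simp only [mollΩ, ← hg]
  generalize dot (smear (fun t => θ (a - t)) g μ.G y) A = Ga at *
  generalize dot (smear (fun t => θ (b - t)) g μ.G y) A = Gb at *
  generalize dot (smear κ g μ.q y) (P.zeroth A) = q0 at *
  generalize ∑ c, dot (smear κ (dd c g) μ.q y) (P.first c A) = q1 at *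
  generalize dot (smear κ g μ.R y) A = r at *
  generalize dot ((G 1).scalarIntegral fun x => g (y - x)) A = G1 at *
  generalize dot ((G 0).scalarIntegral fun x => g (y - x)) A = G0 at *
  generalize ∫ r in Iio (0 : ℝ), θ (b - r) = p0 at *
  generalize ∫ r in Iio (0 : ℝ), θ (a - r) = p1 at *
  generalize ∫ r in Ioi (1 : ℝ), θ (b - r) = f0 at *
  generalize ∫ r in Ioi (1 : ℝ), θ (a - r) = f1 at *
  generalize dot (reg.mollLift ε y) A = l at *
  -- The increments of the past and future weights cancel the endpoint terms of the weak equation.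
  -- The lift is independent of time and drops out of the difference.
  have e1 : p0 = p1 - (b - a) * κ 0 := by linarith
  have e2 : f0 = f1 + (b - a) * κ 1 := by linarith
  have e3 : (b - a) * ((b - a)⁻¹ * (Ga - Gb)) = Ga - Gb := by
    rw [← mul_assoc, mul_inv_cancel₀ hba0.ne', one_mul]
  have e4 : Ga - Gb + (b - a) * (q0 - q1 + r) = (b - a) * (κ 1 * G1 - κ 0 * G0) := by
    linear_combination (b - a) * hCE - e3
  rw [e1, e2]
  have e6 : Gb = Ga + ((b - a) * (q0 - q1 + r) - (b - a) * (κ 1 * G1 - κ 0 * G0)) := by linarith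
  rw [e6, hba]
  ring

end RegularizationData

/-! ### The action of the regularized curve -/

theorem quad_add (X Y : Mat n n) (v : Fin n → ℝ) :
    v ⬝ᵥ ((X + Y) *ᵥ v) = v ⬝ᵥ (X *ᵥ v) + v ⬝ᵥ (Y *ᵥ v) := by
  rw [Matrix.add_mulVec, dotProduct_add]

theorem quad_sub (X Y : Mat n n) (v : Fin n → ℝ) :
    v ⬝ᵥ ((X - Y) *ᵥ v) = v ⬝ᵥ (X *ᵥ v) - v ⬝ᵥ (Y *ᵥ v) := by
  rw [Matrix.sub_mulVec, dotProduct_sub]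

theorem quad_smul (a : ℝ) (X : Mat n n) (v : Fin n → ℝ) :
    v ⬝ᵥ ((a • X) *ᵥ v) = a * (v ⬝ᵥ (X *ᵥ v)) := by
  rw [Matrix.smul_mulVec, dotProduct_smul, smul_eq_mul]

theorem quad_self_nonneg (v : Fin n → ℝ) : 0 ≤ v ⬝ᵥ v :=
  Finset.sum_nonneg fun i _ => mul_self_nonneg (v i)

theorem mul_dot_mul_le {m : ℕ} {X X' : Mat n n} {w : ℝ}
    (h : ∀ v, w * (v ⬝ᵥ (X' *ᵥ v)) ≤ v ⬝ᵥ (X *ᵥ v)) (B : Mat n m) :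
    w * dot B (X' * B) ≤ dot B (X * B) := by
  rw [dot_mul_eq_sum_cols, dot_mul_eq_sum_cols, Finset.mul_sum]
  exact Finset.sum_le_sum fun j _ => h _

/-- Take the dual variables attaining the cost at `X`. Replacing `X` by the smaller `w X'` only
increases the minorant, moving the column factors onto `B` does so again, and rescaling the dual
variables by `u⁻¹` pulls out `w u ^ 2`. -/
theorem cost_le_lin {X X' : Mat n n} (hX : X.PosDef) (hX' : X'.PosSemidef) {w u : ℝ} (hw : 0 ≤ w)
    (hu : 0 < u) (h : ∀ v, w * (v ⬝ᵥ (X' *ᵥ v)) ≤ v ⬝ᵥ (X *ᵥ v)) {c : Fin k → ℝ}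
    (hc : ∀ j, |c j| ≤ 1) (q : Mat n k) (R : Mat n n) :
    ∃ B C, cost X ((w * u) • scaleCols c q) ((w * u) • R) ≤
      ENNReal.ofReal (w * u ^ 2) * ENNReal.ofReal (lin B C X' q R) := by
  obtain ⟨B, C, hBC⟩ := exists_cost_eq_lin hX ((w * u) • scaleCols c q) ((w * u) • R)
  refine ⟨u⁻¹ • scaleCols c B, u⁻¹ • C, ?_⟩
  rw [hBC, ← ENNReal.ofReal_mul (by positivity)]
  apply ENNReal.ofReal_le_ofReal
  have h1 := mul_dot_mul_le h B
  have h2 := mul_dot_mul_le h C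
  have h3 := mul_le_mul_of_nonneg_left (dot_mul_scaleCols_le hX' hc B) hw
  simp only [lin, dot_smul_right, dot_smul_left, Matrix.mul_smul, dot_scaleCols]
  have hu' : u * u⁻¹ = 1 := mul_inv_cancel₀ hu.ne'
  generalize dot (scaleCols c B) q = q0
  generalize dot C R = r0
  generalize dot (scaleCols c B) (X' * scaleCols c B) = b0 at *
  generalize dot C (X' * C) = c0 at *
  have e : w * u ^ 2 * (u⁻¹ * q0 + u⁻¹ * r0 - 1 / 2 * (u⁻¹ * (u⁻¹ * b0) + u⁻¹ * (u⁻¹ * c0))) =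
      w * u * q0 + w * u * r0 - 1 / 2 * (w * b0 + w * c0) := by
    field_simp
  rw [e]
  linarith

namespace RegularizationData

variable {Ω : Set (Eu d)} (reg : RegularizationData Ω n)

/-- The smallness condition on `ε` that makes the lifting effective on the contracted domain. -/
structure Small (ε : ℝ) : Prop where
  pos : 0 < ε
  le_one : ε ≤ 1
  infDist_le : ∀ x ∈ Ω, Metric.infDist (reg.expand ε x) Ω + ε ≤ 1 / 2

theorem eventually_small (hΩ : IsCompact Ω) : ∃ ε₀ > 0, ∀ ε ∈ Ioo 0 ε₀, reg.Small ε := by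
  obtain ⟨R, hR⟩ := hΩ.isBounded.subset_closedBall reg.center
  have hR' : ∀ x ∈ Ω, ‖x - reg.center‖ ≤ |R| := fun x hx => by
    have := hR hx
    rw [Metric.mem_closedBall, dist_eq_norm] at this
    exact this.trans (le_abs_self R)
  have hL : (0 : ℝ) ≤ reg.L := reg.L.2
  have hpos : 0 < reg.L * |R| + 1 := by positivity
  refine ⟨min 1 (1 / 2 / (reg.L * |R| + 1)), by positivity, fun ε hε => ⟨hε.1, ?_, fun x hx => ?_⟩⟩
  · exact (hε.2.le.trans (min_le_left _ _))
  · have h1 := reg.infDist_expand_le hR' hε.1 hx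
    have h2 := hε.2.le.trans (min_le_right _ _)
    rw [le_div_iff₀ hpos] at h2
    linarith

section Bounds

variable {reg} {ε : ℝ} {G : Fin 2 → MatMeasure Ω n n} {μ : CurveMeasure Ω n k}

theorem continuous_molT (ε : ℝ) : Continuous (rescale reg.molT ε) :=
  (reg.molT_spec.contDiff_rescale ε).continuous

theorem continuous_molX (ε : ℝ) : Continuous (rescale reg.molX ε) :=
  (reg.molX_spec.contDiff_rescale ε).continuous

theorem posSemidef_smear (hε : 0 < ε) (hμ : μ.action < ⊤) {κ : ℝ → ℝ} (hκ : Continuous κ)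
    {K : ℝ} (hK : ∀ t, |κ t| ≤ K) (h0 : ∀ t, 0 ≤ κ t) (y : Eu d) :
    (smear κ (rescale reg.molX ε) μ.G y).PosSemidef := by
  obtain ⟨K', -, hK'⟩ := reg.molX_spec.exists_bound_rescale hε
  exact μ.posSemidef_scalarIntegral hμ (measurable_kernel hκ (continuous_molX ε) y)
    (abs_kernel_le hK hK' y) fun z => mul_nonneg (h0 _) (reg.molX_spec.rescale_nonneg hε _)

/-- The extensions by `G 0` and `G 1` contribute positive semidefinite terms and are dropped; at the
dilated points the mollified lift is at least the identity. -/
theorem quad_regG_ge (hsm : reg.Small ε) (hΩ : IsCompact Ω) (hG : ∀ i, (G i).IsPosSemidef)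
    (s : ℝ) {x : Eu d} (hx : x ∈ Ω) (v : Fin n → ℝ) :
    (1 + reg.L * ε) ^ d * ((1 - ε) * (v ⬝ᵥ (smear (fun r => rescale reg.molT ε (time ε s - r))
      (rescale reg.molX ε) μ.G (reg.expand ε x) *ᵥ v)) + ε * (v ⬝ᵥ v)) ≤
      v ⬝ᵥ (reg.regG ε G μ s x *ᵥ v) := by
  have hε := hsm.pos
  have hε1 := hsm.le_one
  obtain ⟨K', -, hK'⟩ := reg.molX_spec.exists_bound_rescale hε
  have hm : ∀ i, 0 ≤ v ⬝ᵥ (reg.mollΩ ε (G i) (reg.expand ε x) *ᵥ v) := fun i =>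
    (posSemidef_iff.1 ((hG i).posSemidef_scalarIntegral
      ((continuous_molX ε).measurable.comp (measurable_const.sub measurable_subtype_coe))
      (fun z => hK' _) fun z => reg.molX_spec.rescale_nonneg hε _)).2 v
  have hl := (posSemidef_iff.1 (reg.posSemidef_mollLift_sub_one ⟨x, hx⟩ hΩ hε
    (hsm.infDist_le x hx))).2 v
  rw [quad_sub, Matrix.one_mulVec] at hl
  have hw := fun (A : Set ℝ) t => (weight_mem (θ := rescale reg.molT ε)
    (reg.molT_spec.rescale_nonneg hε) (reg.integrable_molT hε)
    (reg.molT_spec.integral_rescale hε) A t).1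
  have ha : 0 ≤ (1 + reg.L * ε) ^ d := pow_nonneg (zero_le_one.trans (reg.one_le_factor hε)) d
  rw [regG, preG_eq]
  simp only [quad_add, quad_smul]
  refine mul_le_mul_of_nonneg_left ?_ ha
  have h1 := mul_nonneg (hw (Iio 0) (time ε s)) (hm 0)
  have h2 := mul_nonneg (hw (Ioi 1) (time ε s)) (hm 1)
  have h3 := mul_nonneg hε.le hl
  have h4 := mul_nonneg (sub_nonneg.2 hε1) (add_nonneg h1 h2)
  linarith

theorem quad_regG_ge_self (hsm : reg.Small ε) (hΩ : IsCompact Ω) (hG : ∀ i, (G i).IsPosSemidef)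
    (hμ : μ.action < ⊤) (s : ℝ) {x : Eu d} (hx : x ∈ Ω) (v : Fin n → ℝ) :
    ε * (v ⬝ᵥ v) ≤ v ⬝ᵥ (reg.regG ε G μ s x *ᵥ v) := by
  have hε := hsm.pos
  obtain ⟨K, -, hK⟩ := reg.molT_spec.exists_bound_rescale hε
  refine le_trans ?_ (quad_regG_ge hsm hΩ hG s hx v)
  have h1 := (posSemidef_iff.1 (posSemidef_smear (reg := reg) hε hμ
    (κ := fun r => rescale reg.molT ε (time ε s - r)) ((continuous_molT ε).comp (by fun_prop))
    (fun t => hK _) (fun t => reg.molT_spec.rescale_nonneg hε _) (reg.expand ε x))).2 v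
  have h2 := mul_nonneg (sub_nonneg.2 hsm.le_one) h1
  have h3 := mul_nonneg hε.le (quad_self_nonneg v)
  have ha := one_le_pow₀ (n := d) (reg.one_le_factor hε)
  nlinarith

theorem posSemidef_regG_sub (hsm : reg.Small ε) (hΩ : IsCompact Ω)
    (hG : ∀ i, (G i).IsPosSemidef) (hμ : μ.action < ⊤) (s : ℝ) {x : Eu d} (hx : x ∈ Ω) :
    (reg.regG ε G μ s x - ε • (1 : Mat n n)).PosSemidef := by
  refine posSemidef_iff.2 ⟨?_, fun v => ?_⟩
  · rw [Matrix.transpose_sub, Matrix.transpose_smul, Matrix.transpose_one,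
      reg.regG_transpose fun i => (hG i).isSymm]
  · rw [quad_sub, quad_smul, Matrix.one_mulVec, sub_nonneg]
    exact quad_regG_ge_self hsm hΩ hG hμ s hx v

/-- The two-point mean of the mollified `G` and its time average differ by a multiple of the step
length. By `hN` this error is at most `ε I`, which is what the lift provides. -/
theorem quad_midpoint_ge (hsm : reg.Small ε) (hΩ : IsCompact Ω) (hG : ∀ i, (G i).IsPosSemidef)
    {s s' : ℝ} (hs : s < s') {Lc : ℝ≥0} (hLc : LipschitzWith Lc (rescale reg.molT ε)) {K' : ℝ}
    (hK' : ∀ x, |rescale reg.molX ε x| ≤ K')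
    (hN : n * (Lc * ((1 + 2 * ε) * (s' - s)) * K' * μ.G.mass μ.dom) ≤ ε)
    {x : Eu d} (hx : x ∈ Ω) (v : Fin n → ℝ) :
    ((1 + reg.L * ε) ^ d * (1 - ε)) * (v ⬝ᵥ (smear
      (avgKernel (rescale reg.molT ε) (time ε s) (time ε s')) (rescale reg.molX ε) μ.G
        (reg.expand ε x) *ᵥ v)) ≤
      v ⬝ᵥ (((1 / 2 : ℝ) • (reg.regG ε G μ s x + reg.regG ε G μ s' x)) *ᵥ v) := by
  have hε := hsm.pos
  set θ := rescale reg.molT ε with hθ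
  set a := time ε s with ha
  set b := time ε s' with hb
  set κ := avgKernel θ a b with hκd
  set g := rescale reg.molX ε with hg
  set y := reg.expand ε x with hy
  have hba : b - a = (1 + 2 * ε) * (s' - s) := by
    rw [ha, hb, time, time]
    ring
  have hba0 : 0 < b - a := by
    rw [hba]
    have := sub_pos.2 hs
    positivity
  have hab : a < b := sub_pos.1 hba0
  have hθc : Continuous θ := continuous_molT ε
  have hgc : Continuous g := continuous_molX ε
  obtain ⟨K, hK0, hK⟩ := reg.molT_spec.exists_bound_rescale hε
  have hκK : ∀ t, |κ t| ≤ K := abs_avgKernel_le hθc hab hK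
  have h1 := quad_regG_ge (μ := μ) hsm hΩ hG s hx v
  have h2 := quad_regG_ge (μ := μ) hsm hΩ hG s' hx v
  rw [← ha, ← hg, ← hy, ← hθ] at h1
  rw [← hb, ← hg, ← hy, ← hθ] at h2
  have hcm : Continuous fun t => (θ (a - t) + θ (b - t)) / 2 := by fun_prop
  have hmK : ∀ t, |(θ (a - t) + θ (b - t)) / 2| ≤ K := fun t => by
    have e1 := abs_le.1 (hK (a - t))
    have e2 := abs_le.1 (hK (b - t))
    rw [← hθ] at e1 e2
    rw [abs_le]
    constructor <;> linarith
  have hK'0 : 0 ≤ K' := (abs_nonneg _).trans (hK' 0)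
  have hdiff : ∀ z : TimeSpace Ω, |((θ (a - z.1) + θ (b - z.1)) / 2 - κ z.1) * g (y - z.2)| ≤
      Lc * (b - a) * K' := fun z => by
    rw [abs_mul]
    exact mul_le_mul (abs_mean_sub_avgKernel_le hLc hab _) (hK' _) (abs_nonneg _)
      (mul_nonneg Lc.2 hba0.le)
  have hcκ : Continuous κ := continuous_avgKernel hθc a b
  have e1 : smear (fun t => (θ (a - t) + θ (b - t)) / 2) g μ.G y - smear κ g μ.G y =
      μ.G.scalarIntegral fun z => ((θ (a - z.1) + θ (b - z.1)) / 2 - κ z.1) * g (y - z.2) := by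
    unfold smear
    rw [← MatMeasure.scalarIntegral_sub μ.ac_G (measurable_kernel hcm hgc y)
      (measurable_kernel hcκ hgc y) (abs_kernel_le hmK hK' y) (abs_kernel_le hκK hK' y)]
    congr 1
    funext z
    ring
  have e2 : smear (fun t => (θ (a - t) + θ (b - t)) / 2) g μ.G y =
      (1 / 2 : ℝ) • (smear (fun t => θ (a - t)) g μ.G y + smear (fun t => θ (b - t)) g μ.G y) := by
    have m1 := measurable_kernel (Ω := Ω) (κ := fun t => θ (a - t)) (hθc.comp (by fun_prop)) hgc y
    have m2 := measurable_kernel (Ω := Ω) (κ := fun t => θ (b - t)) (hθc.comp (by fun_prop)) hgc y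
    have b1 := abs_kernel_le (Ω := Ω) (κ := fun t => θ (a - t)) (fun t => hK _) hK' y
    have b2 := abs_kernel_le (Ω := Ω) (κ := fun t => θ (b - t)) (fun t => hK _) hK' y
    have e3 := MatMeasure.scalarIntegral_const_mul μ.ac_G m2 b2 (-1)
    have e4 := MatMeasure.scalarIntegral_sub μ.ac_G m1 (m2.const_mul (-1)) b1
      (C := K * K') fun z => by rw [neg_one_mul, abs_neg]; exact b2 z
    have e5 := MatMeasure.scalarIntegral_const_mul μ.ac_G (m1.sub (m2.const_mul (-1)))
      (C := K * K' + K * K') (fun z => (abs_sub _ _).trans (add_le_add (b1 z) (by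
        beta_reduce; rw [neg_one_mul, abs_neg]; exact b2 z))) (1 / 2)
    have e6 : smear (fun t => θ (a - t)) g μ.G y + smear (fun t => θ (b - t)) g μ.G y =
        μ.G.scalarIntegral ((fun z => θ (a - z.1) * g (y - z.2)) -
          fun z => -1 * (θ (b - z.1) * g (y - z.2))) := by
      refine Eq.trans ?_ e4.symm
      rw [e3, neg_one_smul, sub_neg_eq_add]
      rfl
    rw [e6, ← e5]
    unfold smear
    congr 1
    funext z
    simp only [Pi.sub_apply]
    ring
  have e7 : |v ⬝ᵥ ((smear (fun t => (θ (a - t) + θ (b - t)) / 2) g μ.G y - smear κ g μ.G y) *ᵥ v)|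
      ≤ n * (Lc * (b - a) * K' * μ.G.mass μ.dom) * (v ⬝ᵥ v) := by
    refine abs_dotProduct_mulVec_le (fun i j => ?_) v
    rw [e1]
    refine (MatMeasure.abs_scalarIntegral_le μ.ac_G
      (measurable_kernel (κ := fun t => (θ (a - t) + θ (b - t)) / 2 - κ t) (hcm.sub hcκ) hgc y)
      hdiff i j).trans ?_
    exact mul_le_mul_of_nonneg_left (μ.G.integral_abs_density_le μ.dom i j)
      (mul_nonneg (mul_nonneg Lc.2 hba0.le) hK'0)
  rw [quad_sub, e2, quad_smul, quad_add, hba] at e7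
  have e8 := (abs_le.1 e7).1
  have e9 : n * (Lc * ((1 + 2 * ε) * (s' - s)) * K' * μ.G.mass μ.dom) * (v ⬝ᵥ v) ≤ ε * (v ⬝ᵥ v) :=
    mul_le_mul_of_nonneg_right hN (quad_self_nonneg v)
  rw [quad_smul, quad_add]
  generalize v ⬝ᵥ (smear (fun t => θ (a - t)) g μ.G y *ᵥ v) = Sa at *
  generalize v ⬝ᵥ (smear (fun t => θ (b - t)) g μ.G y *ᵥ v) = Sb at *
  generalize v ⬝ᵥ (smear κ g μ.G y *ᵥ v) = Sk at *
  have hA : 0 ≤ (1 + reg.L * ε) ^ d := pow_nonneg (zero_le_one.trans (reg.one_le_factor hε)) d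
  have e10 : Sk ≤ 1 / 2 * (Sa + Sb) + ε * (v ⬝ᵥ v) := by linarith
  -- The error is multiplied by `1 - ε ≤ 1`, so the full `ε` of the lift still covers it.
  have e11 : (1 - ε) * Sk ≤ (1 - ε) * (1 / 2 * (Sa + Sb)) + ε * (v ⬝ᵥ v) := by
    have h3 := mul_le_mul_of_nonneg_left e10 (sub_nonneg.2 hsm.le_one)
    have h4 := mul_nonneg hε.le (mul_nonneg hε.le (quad_self_nonneg v))
    linarith
  have e12 := mul_le_mul_of_nonneg_left e11 hA
  linarith

/-- Pointwise bound of the cost of the regularized curve. -/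
theorem cost_regularized_le (hsm : reg.Small ε) (hΩ : IsCompact Ω) (hG : ∀ i, (G i).IsPosSemidef)
    (hμ : μ.action < ⊤) (k₁ : ℕ) {s s' : ℝ} (hs : s < s') {Lc : ℝ≥0}
    (hLc : LipschitzWith Lc (rescale reg.molT ε)) {K' : ℝ}
    (hK' : ∀ x, |rescale reg.molX ε x| ≤ K')
    (hN : n * (Lc * ((1 + 2 * ε) * (s' - s)) * K' * μ.G.mass μ.dom) ≤ ε)
    {x : Eu d} (hx : x ∈ Ω) :
    cost ((1 / 2 : ℝ) • (reg.regG ε G μ s x + reg.regG ε G μ s' x))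
      (reg.kerq k₁ ε (avgKernel (rescale reg.molT ε) (time ε s) (time ε s')) μ x)
      (reg.kerR ε (avgKernel (rescale reg.molT ε) (time ε s) (time ε s')) μ x) ≤
      ENNReal.ofReal ((1 + reg.L * ε) ^ d * (1 - ε) * (1 + 2 * ε) ^ 2) *
        ∫⁻ z, ENNReal.ofReal (avgKernel (rescale reg.molT ε) (time ε s) (time ε s') z.1 *
          rescale reg.molX ε (reg.expand ε x - z.2)) * μ.actionDensity z ∂μ.dom := by
  have hε := hsm.pos
  have hab : time ε s < time ε s' := by
    unfold time
    have : (1 + 2 * ε) * s < (1 + 2 * ε) * s' := mul_lt_mul_of_pos_left hs (by linarith)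
    linarith
  have hquad := quad_midpoint_ge hsm hΩ hG hs hLc hK' hN hx
  set κ := avgKernel (rescale reg.molT ε) (time ε s) (time ε s') with hκd
  obtain ⟨K, hK0, hK⟩ := reg.molT_spec.exists_bound_rescale hε
  have hκK : ∀ t, |κ t| ≤ K := abs_avgKernel_le (continuous_molT ε) hab hK
  have hκ0 : ∀ t, 0 ≤ κ t := avgKernel_nonneg (reg.molT_spec.rescale_nonneg hε) hab
  have hκc : Continuous κ := continuous_avgKernel (continuous_molT ε) _ _
  have hsymm : ((1 / 2 : ℝ) • (reg.regG ε G μ s x + reg.regG ε G μ s' x)).IsHermitian := by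
    rw [Matrix.IsHermitian, Matrix.conjTranspose_eq_transpose_of_trivial, Matrix.transpose_smul,
      Matrix.transpose_add, reg.regG_transpose fun i => (hG i).isSymm,
      reg.regG_transpose fun i => (hG i).isSymm]
  have hpd : ((1 / 2 : ℝ) • (reg.regG ε G μ s x + reg.regG ε G μ s' x)).PosDef := by
    refine Matrix.PosDef.of_dotProduct_mulVec_pos hsymm fun v hv => ?_
    rw [star_trivial, quad_smul, quad_add]
    have h1 := quad_regG_ge_self hsm hΩ hG hμ s hx v
    have h2 := quad_regG_ge_self hsm hΩ hG hμ s' hx v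
    have h3 : 0 < v ⬝ᵥ v :=
      lt_of_le_of_ne (quad_self_nonneg v) fun h => hv (dotProduct_self_eq_zero.1 h.symm)
    have h4 := mul_pos hε h3
    linarith
  have ha := reg.one_le_factor hε
  -- Here `w = (1 + Lε) ^ d (1 - ε)` is the factor already present in `G`, `u = 1 + 2ε` the
  -- additional time factor of `q` and `R`, and `c` the column correction of the flux.
  obtain ⟨B, C, hBC⟩ := cost_le_lin (k := k) hpd (posSemidef_smear hε hμ hκc hκK hκ0 _)
    (mul_nonneg (pow_nonneg (zero_le_one.trans ha) d) (sub_nonneg.2 hsm.le_one))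
    (u := 1 + 2 * ε) (by linarith) hquad
    (c := fun j => if (j : ℕ) < k₁ then 1 else (1 + reg.L * ε)⁻¹) (fun j => by
      split_ifs
      · simp
      · rw [abs_inv, abs_of_pos (by linarith)]
        exact inv_le_one_of_one_le₀ ha)
    (smear κ (rescale reg.molX ε) μ.q (reg.expand ε x))
    (smear κ (rescale reg.molX ε) μ.R (reg.expand ε x))
  have eq : reg.kerq k₁ ε κ μ x = ((1 + reg.L * ε) ^ d * (1 - ε) * (1 + 2 * ε)) •
      scaleCols (fun j : Fin k => if (j : ℕ) < k₁ then 1 else (1 + reg.L * ε)⁻¹)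
        (smear κ (rescale reg.molX ε) μ.q (reg.expand ε x)) := by
    ext i j
    simp only [kerq, scaleCols, Matrix.smul_apply, Matrix.of_apply, smul_eq_mul]
    ring
  have eR : reg.kerR ε κ μ x = ((1 + reg.L * ε) ^ d * (1 - ε) * (1 + 2 * ε)) •
        smear κ (rescale reg.molX ε) μ.R (reg.expand ε x) := by
    rw [kerR]
    congr 1
    ring
  rw [eq, eR]
  refine hBC.trans (mul_le_mul_right ?_ _)
  exact ofReal_lin_scalarIntegral_le μ.ac_G μ.ac_q μ.ac_R
    (measurable_kernel hκc (continuous_molX ε) _) (abs_kernel_le hκK hK' _)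
    (fun z => mul_nonneg (hκ0 _) (reg.molX_spec.rescale_nonneg hε _)) B C

/-- By Tonelli the spatial mollifier is integrated in `x` first. Its integral over `Ω` is at most
`((1 + Lε) ^ d)⁻¹`, which removes the spatial prefactor of the pointwise bound. -/
theorem spatialAction_regularized_le (hsm : reg.Small ε) (hΩ : IsCompact Ω)
    (hG : ∀ i, (G i).IsPosSemidef)
    (hμ : μ.action < ⊤) (k₁ : ℕ) {s s' : ℝ} (hs : s < s') {Lc : ℝ≥0}
    (hLc : LipschitzWith Lc (rescale reg.molT ε)) {K' : ℝ}
    (hK' : ∀ x, |rescale reg.molX ε x| ≤ K')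
    (hN : n * (Lc * ((1 + 2 * ε) * (s' - s)) * K' * μ.G.mass μ.dom) ≤ ε) :
    spatialAction Ω (fun x => (1 / 2 : ℝ) • (reg.regG ε G μ s x + reg.regG ε G μ s' x))
      (reg.kerq k₁ ε (avgKernel (rescale reg.molT ε) (time ε s) (time ε s')) μ)
      (reg.kerR ε (avgKernel (rescale reg.molT ε) (time ε s) (time ε s')) μ) ≤
      ENNReal.ofReal ((1 - ε) * (1 + 2 * ε) ^ 2) *
        ∫⁻ z, ENNReal.ofReal (avgKernel (rescale reg.molT ε) (time ε s) (time ε s') z.1) *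
          μ.actionDensity z ∂μ.dom := by
  have hε := hsm.pos
  have hab : time ε s < time ε s' := by
    unfold time
    have : (1 + 2 * ε) * s < (1 + 2 * ε) * s' := mul_lt_mul_of_pos_left hs (by linarith)
    linarith
  have hpt := fun x (hx : x ∈ Ω) => cost_regularized_le hsm hΩ hG hμ k₁ hs hLc hK' hN hx
  set κ := avgKernel (rescale reg.molT ε) (time ε s) (time ε s') with hκd
  have hκ0 : ∀ t, 0 ≤ κ t := avgKernel_nonneg (reg.molT_spec.rescale_nonneg hε) hab
  have hκc : Continuous κ := continuous_avgKernel (continuous_molT ε) _ _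
  set A := (1 + reg.L * ε) ^ d with hA
  have ha := reg.one_le_factor hε
  have hA0 : 0 < A := pow_pos (by linarith) d
  have hexp : Continuous (reg.expand ε) := by
    unfold expand
    fun_prop
  have hmeas : Measurable fun p : Eu d × TimeSpace Ω =>
      ENNReal.ofReal (κ p.2.1 * rescale reg.molX ε (reg.expand ε p.1 - p.2.2)) *
        μ.actionDensity p.2 := by
    refine Measurable.mul (Measurable.ennreal_ofReal (Measurable.mul ?_ ?_))
      (μ.measurable_actionDensity.comp measurable_snd)
    · exact (measurable_time hκc).comp measurable_snd
    · exact (continuous_molX ε).measurable.comp ((hexp.measurable.comp measurable_fst).sub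
        (measurable_space.comp measurable_snd))
  calc _ ≤ ∫⁻ x in Ω, ENNReal.ofReal (A * (1 - ε) * (1 + 2 * ε) ^ 2) *
        ∫⁻ z, ENNReal.ofReal (κ z.1 * rescale reg.molX ε (reg.expand ε x - z.2)) *
          μ.actionDensity z ∂μ.dom :=
        setLIntegral_mono' hΩ.isClosed.measurableSet fun x hx => hpt x hx
    _ = ENNReal.ofReal (A * (1 - ε) * (1 + 2 * ε) ^ 2) * ∫⁻ x in Ω, ∫⁻ z,
        ENNReal.ofReal (κ z.1 * rescale reg.molX ε (reg.expand ε x - z.2)) *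
          μ.actionDensity z ∂μ.dom := lintegral_const_mul _ hmeas.lintegral_prod_right'
    _ = ENNReal.ofReal (A * (1 - ε) * (1 + 2 * ε) ^ 2) * ∫⁻ z, (∫⁻ x : Eu d in Ω,
        ENNReal.ofReal (κ z.1 * rescale reg.molX ε (reg.expand ε x - z.2)) *
          μ.actionDensity z) ∂μ.dom := by
        rw [lintegral_lintegral_swap hmeas.aemeasurable]
    _ ≤ ENNReal.ofReal (A * (1 - ε) * (1 + 2 * ε) ^ 2) * ∫⁻ z,
        ENNReal.ofReal A⁻¹ * (ENNReal.ofReal (κ z.1) * μ.actionDensity z) ∂μ.dom := by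
        refine mul_le_mul_right (lintegral_mono fun z => ?_) _
        have hmz : Measurable fun x => ENNReal.ofReal
            (rescale reg.molX ε (reg.expand ε x - z.2)) :=
          ((continuous_molX ε).measurable.comp (hexp.measurable.sub_const _)).ennreal_ofReal
        calc _ = ∫⁻ x in Ω, (ENNReal.ofReal (κ z.1) * μ.actionDensity z) *
              ENNReal.ofReal (rescale reg.molX ε (reg.expand ε x - z.2)) := by
              refine lintegral_congr fun x => ?_
              rw [ENNReal.ofReal_mul (hκ0 _)]
              ring
          _ = (ENNReal.ofReal (κ z.1) * μ.actionDensity z) *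
              ∫⁻ x in Ω, ENNReal.ofReal (rescale reg.molX ε (reg.expand ε x - z.2)) :=
              lintegral_const_mul _ hmz
          _ ≤ (ENNReal.ofReal (κ z.1) * μ.actionDensity z) * ENNReal.ofReal A⁻¹ := by
              refine mul_le_mul_right ((setLIntegral_le_lintegral _ _).trans ?_) _
              exact (reg.molX_spec.lintegral_affine hε (by linarith) reg.center z.2).le
          _ = _ := mul_comm _ _
    _ = _ := by
        rw [lintegral_const_mul
          (f := fun z => ENNReal.ofReal (κ z.1) * μ.actionDensity z) _ (((measurable_time hκc).ennreal_ofReal).mul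
          μ.measurable_actionDensity), ← mul_assoc, ← ENNReal.ofReal_mul
          (mul_nonneg (mul_nonneg hA0.le (sub_nonneg.2 hsm.le_one)) (by positivity))]
        congr 2
        field_simp

end Bounds

end RegularizationData

/-! ### Summation over the time steps. -/

namespace RegularizationData

variable {Ω : Set (Eu d)} {reg : RegularizationData Ω n} {ε : ℝ} {G : Fin 2 → MatMeasure Ω n n}
  {μ : CurveMeasure Ω n k}

/-- The average of the temporal mollifier over the (rescaled) `j`-th time step of length `1/N`. -/
def stepKernel (reg : RegularizationData Ω n) (ε : ℝ) (N j : ℕ) : ℝ → ℝ :=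
  avgKernel (rescale reg.molT ε) (time ε (j / N)) (time ε ((j + 1 : ℕ) / N))

theorem step_lt {N : ℕ} (hN : 0 < N) (j : ℕ) : (j / N : ℝ) < (j + 1 : ℕ) / N :=
  div_lt_div_of_pos_right (by exact_mod_cast Nat.lt_succ_self j) (by exact_mod_cast hN)

theorem step_sub (N j : ℕ) : ((j + 1 : ℕ) / N : ℝ) - j / N = (N : ℝ)⁻¹ := by
  rw [← sub_div]
  push_cast
  rw [add_sub_cancel_left, one_div]

theorem time_sub (ε s s' : ℝ) : time ε s' - time ε s = (1 + 2 * ε) * (s' - s) := by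
  unfold time
  ring

theorem time_lt (hε : 0 < ε) {s s' : ℝ} (h : s < s') : time ε s < time ε s' := by
  rw [← sub_pos, time_sub]
  exact mul_pos (by linarith) (sub_pos.2 h)

theorem continuous_stepKernel (N j : ℕ) : Continuous (reg.stepKernel ε N j) :=
  continuous_avgKernel (continuous_molT ε) _ _

theorem stepKernel_nonneg (hε : 0 < ε) {N : ℕ} (hN : 0 < N) (j : ℕ) (t : ℝ) :
    0 ≤ reg.stepKernel ε N j t :=
  avgKernel_nonneg (reg.molT_spec.rescale_nonneg hε) (time_lt hε (step_lt hN j)) t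

theorem exists_abs_stepKernel_le (hε : 0 < ε) :
    ∃ K, ∀ N, 0 < N → ∀ j t, |reg.stepKernel ε N j t| ≤ K := by
  obtain ⟨K, -, hK⟩ := reg.molT_spec.exists_bound_rescale hε
  exact ⟨K, fun N hN j => abs_avgKernel_le (continuous_molT ε) (time_lt hε (step_lt hN j)) hK⟩

/-- A rescaled step has length `(1 + 2ε) / N`, so `N⁻¹` times its kernel is `(1 + 2ε)⁻¹` times the
integral of the mollifier over the step. The steps are adjacent and the mollifier has mass one. -/
theorem sum_stepKernel_le (hε : 0 < ε) {N : ℕ} (hN : 0 < N) (t : ℝ) :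
    (N : ℝ)⁻¹ * ∑ j ∈ Finset.range N, reg.stepKernel ε N j t ≤ (1 + 2 * ε)⁻¹ := by
  have hN' : (0 : ℝ) < N := by exact_mod_cast hN
  have hk : ∀ j, reg.stepKernel ε N j t = N * (1 + 2 * ε)⁻¹ *
      ∫ s in (time ε (j / N))..(time ε ((j + 1 : ℕ) / N)), rescale reg.molT ε (s - t) := fun j => by
    rw [stepKernel, avgKernel, time_sub, step_sub, mul_inv, inv_inv]
    ring
  have hc : Continuous fun s => rescale reg.molT ε (s - t) :=
    (continuous_molT ε).comp (by fun_prop)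
  simp_rw [hk]
  rw [← Finset.mul_sum,
    intervalIntegral.sum_integral_adjacent_intervals (a := fun j : ℕ => time ε (j / N))
      fun j _ => hc.intervalIntegrable _ _, ← mul_assoc, ← mul_assoc, inv_mul_cancel₀ hN'.ne',
    one_mul]
  refine mul_le_of_le_one_right (by positivity) ?_
  refine intervalIntegral_translate_le_one (reg.molT_spec.rescale_nonneg hε) ?_
    (reg.molT_spec.integral_rescale hε) ?_ t
  · exact (continuous_molT ε).integrable_of_hasCompactSupport
      (reg.molT_spec.hasCompactSupport_rescale hε)
  · refine (time_lt hε ?_).le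
    simp [hN.ne']

/-- The discrete time integral of the action of the regularized curve is almost bounded by the
action of the curve. -/
theorem eventually_sum_spatialAction_le (hsm : reg.Small ε) (hΩ : IsCompact Ω)
    (hG : ∀ i, (G i).IsPosSemidef) (hμ : μ.action < ⊤) (k₁ : ℕ) :
    ∀ᶠ N : ℕ in atTop, (N : ℝ≥0∞)⁻¹ * ∑ j ∈ Finset.range N, spatialAction Ω
      (fun x => (1 / 2 : ℝ) • (reg.regG ε G μ (j / N) x + reg.regG ε G μ ((j + 1 : ℕ) / N) x))
      (reg.kerq k₁ ε (reg.stepKernel ε N j) μ) (reg.kerR ε (reg.stepKernel ε N j) μ) ≤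
      ENNReal.ofReal (1 + 2 * ε) * μ.action := by
  have hε := hsm.pos
  obtain ⟨Lc, hLc⟩ := (reg.molT_spec.contDiff_rescale ε).lipschitzWith_of_hasCompactSupport
    (𝕂 := ℝ) (reg.molT_spec.hasCompactSupport_rescale hε) (by simp)
  obtain ⟨K', -, hK'⟩ := reg.molX_spec.exists_bound_rescale hε
  -- With `ε` fixed, the time-step error falls below the share `ε` of the lift once `N` is large.
  have hlim : Tendsto (fun N : ℕ => n * (Lc * ((1 + 2 * ε) * (N : ℝ)⁻¹) * K' * μ.G.mass μ.dom))
      atTop (𝓝 (n * (Lc * ((1 + 2 * ε) * 0) * K' * μ.G.mass μ.dom))) :=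
    ((((tendsto_inv_atTop_nhds_zero_nat (𝕜 := ℝ)).const_mul _).const_mul _).mul_const _
      |>.mul_const _).const_mul _
  rw [mul_zero, mul_zero, zero_mul, zero_mul, mul_zero] at hlim
  filter_upwards [hlim.eventually_le_const hε, eventually_gt_atTop 0] with N hN hN0
  have hN' : (0 : ℝ) < N := by exact_mod_cast hN0
  have hκm : ∀ j, Measurable fun z : TimeSpace Ω =>
      ENNReal.ofReal (reg.stepKernel ε N j z.1) * μ.actionDensity z := fun j =>
    ((measurable_time (continuous_stepKernel N j)).ennreal_ofReal).mul μ.measurable_actionDensity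
  calc _ ≤ (N : ℝ≥0∞)⁻¹ * ∑ j ∈ Finset.range N, ENNReal.ofReal ((1 - ε) * (1 + 2 * ε) ^ 2) *
        ∫⁻ z, ENNReal.ofReal (reg.stepKernel ε N j z.1) * μ.actionDensity z ∂μ.dom := by
        refine mul_le_mul_right (Finset.sum_le_sum fun j _ => ?_) _
        refine spatialAction_regularized_le hsm hΩ hG hμ k₁ (step_lt hN0 j) hLc hK' ?_
        rw [step_sub]
        exact hN
    _ = ENNReal.ofReal ((1 - ε) * (1 + 2 * ε) ^ 2) * ∫⁻ z,
        ENNReal.ofReal ((N : ℝ)⁻¹ * ∑ j ∈ Finset.range N, reg.stepKernel ε N j z.1) *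
          μ.actionDensity z ∂μ.dom := by
        rw [← Finset.mul_sum, ← lintegral_finsetSum _ fun j _ => hκm j, mul_left_comm,
          ← lintegral_const_mul _ (Finset.measurable_fun_sum _ fun j _ => hκm j)]
        congr 1
        refine lintegral_congr fun z => ?_
        rw [← Finset.sum_mul, ← mul_assoc, ENNReal.ofReal_mul (by positivity),
          ENNReal.ofReal_inv_of_pos hN', ENNReal.ofReal_natCast,
          ENNReal.ofReal_sum_of_nonneg fun j _ => stepKernel_nonneg hε hN0 j _]
    _ ≤ ENNReal.ofReal ((1 - ε) * (1 + 2 * ε) ^ 2) *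
        (ENNReal.ofReal (1 + 2 * ε)⁻¹ * μ.action) := by
        refine mul_le_mul_right ?_ _
        refine le_trans ?_ (mul_le_mul_right μ.lintegral_actionDensity_le _)
        rw [← lintegral_const_mul _ μ.measurable_actionDensity]
        exact lintegral_mono fun z => mul_le_mul_left
          (ENNReal.ofReal_le_ofReal (sum_stepKernel_le hε hN0 _)) _
    _ ≤ _ := by
        rw [← mul_assoc, ← ENNReal.ofReal_mul (mul_nonneg (sub_nonneg.2 hsm.le_one) (by positivity))]
        refine mul_le_mul_left (ENNReal.ofReal_le_ofReal ?_) _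
        have h1 : (1 - ε) * (1 + 2 * ε) ^ 2 * (1 + 2 * ε)⁻¹ = (1 - ε) * (1 + 2 * ε) := by
          field_simp
        rw [h1]
        nlinarith [hsm.le_one]

end RegularizationData

/-! ### Sampling of continuous fields -/

theorem SmoothField.continuous {m : ℕ} {f : Eu d → Mat n m} (hf : SmoothField f) : Continuous f :=
  continuous_matrix fun i j => (hf i j).continuous

theorem continuous_D (P : DiffOp d n k) {q : Eu d → Mat n k} (hq : SmoothField q) :
    Continuous (P.D q) := by
  refine continuous_matrix fun i j => ?_
  have h1 : ∀ i' j', Continuous fun x => q x i' j' := fun i' j' => (hq i' j').continuous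
  have h2 : ∀ c i' j', Continuous fun x => pd c q x i' j' := fun c i' j' =>
    (contDiff_dd (hq i' j') c).continuous
  simp only [DiffOp.D, adj, dot_eq_sum, Matrix.add_apply, Matrix.neg_apply, Matrix.of_apply,
    Matrix.sum_apply]
  fun_prop

section Sample

variable {m : ℕ} (Ω : Set (Eu d)) {f g : Eu d → Mat n m}

/-- Continuity is essential: for a discontinuous restriction `toC` takes the default value `0`. -/
theorem toC_apply (hf : Continuous f) (x : Ω) : toC Ω f x = f x :=
  ContinuousMap.mkD_apply_of_continuous (f := fun x : Ω => f x)
    (hf.comp continuous_subtype_val)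

theorem toC_linear (hf : Continuous f) (hg : Continuous g) (a b : ℝ) :
    toC Ω (fun x => a • f x + b • g x) = a • toC Ω f + b • toC Ω g := by
  ext1 x
  rw [toC_apply Ω (by fun_prop), ContinuousMap.add_apply, ContinuousMap.smul_apply,
    ContinuousMap.smul_apply, toC_apply Ω hf, toC_apply Ω hg]

end Sample

section Discrete

variable {Ω : Set (Eu d)} {Sg : Set ℝ} {Xb Y : Sg → Type*}
  [∀ σ, NormedAddCommGroup (Xb σ)] [∀ σ, NormedSpace ℝ (Xb σ)] [∀ σ, FiniteDimensional ℝ (Xb σ)]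
  [∀ σ, NormedAddCommGroup (Y σ)] [∀ σ, NormedSpace ℝ (Y σ)] [∀ σ, FiniteDimensional ℝ (Y σ)]
  {M : DiscreteModules Ω n k Sg Xb Y}

namespace Sampling

variable (S : Sampling M) (σ : Sg)

theorem SX_toC_mem {f : Eu d → Mat n n} (hf : Continuous f) (h : ∀ x, (f x)ᵀ = f x) :
    S.SX σ (toC Ω f) ∈ M.X σ :=
  S.SX_symm σ _ fun x => by rw [toC_apply Ω hf, h]

theorem err_mem (P : DiffOp d n k) {q : Eu d → Mat n k} (hq : SmoothField q) :
    S.err P σ q ∈ M.X σ :=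
  (M.X σ).sub_mem (M.D σ _).2 (S.SX_toC_mem σ (continuous_D P hq) fun x => P.D_transpose q x)

theorem proj_of_mem {x : Xb σ} (hx : x ∈ M.X σ) : (M.ipX σ).proj (M.X σ) x = ⟨x, hx⟩ :=
  Submodule.projectionOnto_apply_of_mem_left _ hx

theorem proj_of_mem_orth {x : Xb σ} (hx : x ∈ (M.ipX σ).orth (M.X σ)) :
    (M.ipX σ).proj (M.X σ) x = 0 :=
  Submodule.projectionOnto_apply_of_mem_right _ hx

/-- Split `R` into symmetric and antisymmetric parts: sampling sends them to `X_σ` and to its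
orthogonal complement. -/
theorem coe_proj_SX {R : Eu d → Mat n n} (hR : Continuous R) :
    ((M.ipX σ).proj (M.X σ) (S.SX σ (toC Ω R)) : Xb σ) =
      S.SX σ (toC Ω fun x => (1 / 2 : ℝ) • (R x + (R x)ᵀ)) := by
  have hT : Continuous fun x => (R x)ᵀ := hR.matrix_transpose
  have h1 : S.SX σ (toC Ω fun x => (1 / 2 : ℝ) • R x + (1 / 2 : ℝ) • (R x)ᵀ) ∈ M.X σ :=
    S.SX_toC_mem σ (by fun_prop) fun x => by
      rw [Matrix.transpose_add, Matrix.transpose_smul, Matrix.transpose_smul,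
        Matrix.transpose_transpose, add_comm]
  have h2 : S.SX σ (toC Ω fun x => (1 / 2 : ℝ) • R x + (-(1 / 2) : ℝ) • (R x)ᵀ) ∈
      (M.ipX σ).orth (M.X σ) :=
    S.SX_antisymm σ _ fun x => by
      rw [toC_apply Ω (by fun_prop), Matrix.transpose_add, Matrix.transpose_smul,
        Matrix.transpose_smul, Matrix.transpose_transpose]
      module
  have h3 : S.SX σ (toC Ω R) =
      S.SX σ (toC Ω fun x => (1 / 2 : ℝ) • R x + (1 / 2 : ℝ) • (R x)ᵀ) +
        S.SX σ (toC Ω fun x => (1 / 2 : ℝ) • R x + (-(1 / 2) : ℝ) • (R x)ᵀ) := by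
    rw [toC_linear Ω hR hT, toC_linear Ω hR hT, ← map_add]
    congr 1
    module
  simp_rw [smul_add]
  rw [h3, map_add, proj_of_mem σ h1, proj_of_mem_orth σ h2, add_zero]

end Sampling

/-! ### The discrete curve sampled from the regularization. -/

open RegularizationData in
/-- The samples of the regularized curve at the discrete times are connected by a discrete curve
whose action is almost bounded by the action of `μ`. -/
theorem exists_discrete_regularized {P : DiffOp d n k} {S : Sampling M} (hS : S.Consistent P)
    (hΩ : IsCompact Ω) (hne : Ω.Nonempty) {G : Fin 2 → MatMeasure Ω n n}
    (hG : ∀ i, (G i).IsPosSemidef) {k₁ : ℕ} (hP : P.SplitsAt k₁) {reg : RegularizationData Ω n}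
    {μ : CurveMeasure Ω n k} (hμ : μ.MemCEInfty P G) {ε : ℝ} (hsm : reg.Small ε) :
    ∃ e : Sg → ℝ, Tendsto e (meshFilter Sg) (𝓝 0) ∧ ∃ N₀ : ℕ, ∀ N ≥ N₀, ∀ σ,
      ∃ c : DiscreteCurve M N σ, c.Connects (S.SX σ (toC Ω (reg.regG ε G μ 0)))
        (S.SX σ (toC Ω (reg.regG ε G μ 1))) ∧
        c.action ≤ ENNReal.ofReal (1 + 2 * ε) * μ.action + ENNReal.ofReal (e σ) := by
  have hε := hsm.pos
  obtain ⟨K, hK⟩ := reg.exists_abs_stepKernel_le hε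
  obtain ⟨EG, hEG⟩ := reg.exists_smoothBdd_regG hne hΩ hε G μ
  obtain ⟨Eq, hEq⟩ := reg.exists_smoothBdd_kerq k₁ hε K μ
  obtain ⟨ER, hER⟩ := reg.exists_smoothBdd_kerR hε K μ
  obtain ⟨N₀, hN₀⟩ := eventually_atTop.1
    (eventually_sum_spatialAction_le (k₁ := k₁) hsm hΩ hG hμ.2)
  set E := max EG (max Eq (max ER 1)) with hE
  have hE1 : 1 ≤ E := by simp [hE]
  -- The `C²` bound and the lower bound `ε` are fixed before `N` and the time step, so a single
  -- error `C * e σ` serves them all. The sum `n * n + n * k` covers both matrix shapes.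
  obtain ⟨C, e, -, -, he, hact⟩ := hS.action ((1 + d + d * d) * ((n * n + n * k + 1) * E)) ε
    (by positivity) hε
  refine ⟨fun σ => C * e σ, by simpa using he.const_mul C, max N₀ 1, fun N hN σ => ?_⟩
  have hN0 : 0 < N := (le_max_right N₀ 1).trans hN
  have hN' : (0 : ℝ) < N := by exact_mod_cast hN0
  have hGs : ∀ s, SmoothField (reg.regG ε G μ s) := fun s i j => (hEG s i j).smooth
  have bq : ∀ j i l, SmoothBdd (fun x => reg.kerq k₁ ε (reg.stepKernel ε N j) μ x i l) Eq :=
    fun j => hEq _ (continuous_stepKernel N j) (hK N hN0 j)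
  have bR : ∀ j i l, SmoothBdd (fun x => reg.kerR ε (reg.stepKernel ε N j) μ x i l) ER :=
    fun j => hER _ (continuous_stepKernel N j) (hK N hN0 j)
  have hqs : ∀ j, SmoothField (reg.kerq k₁ ε (reg.stepKernel ε N j) μ) :=
    fun j i l => (bq j i l).smooth
  have hRs : ∀ j, SmoothField (reg.kerR ε (reg.stepKernel ε N j) μ) :=
    fun j i l => (bR j i l).smooth
  have hpos : ∀ s, S.SX σ (toC Ω (reg.regG ε G μ s)) ∈ M.Xpos σ := fun s =>
    S.SX_pos σ _ (hGs s) ε hε fun x hx => posSemidef_regG_sub hsm hΩ hG hμ.2 s hx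
  -- The consistency error of the flux is added to the reaction. It lies in `X_σ`, is fixed by the
  -- projection, and replaces the sample of `D q` by `D_σ` of the sampled flux.
  let c : DiscreteCurve M N σ :=
    { G := fun i => ⟨S.SX σ (toC Ω (reg.regG ε G μ ((i : ℕ) / N))), M.Xpos_subset σ (hpos _)⟩
      q := fun j => S.SY σ (toC Ω (reg.kerq k₁ ε (reg.stepKernel ε N j) μ))
      R := fun j => S.SX σ (toC Ω (reg.kerR ε (reg.stepKernel ε N j) μ)) +
        S.err P σ (reg.kerq k₁ ε (reg.stepKernel ε N j) μ) }
  refine ⟨c, ⟨fun j => ?_, ?_, ?_, fun i => hpos _⟩, ?_⟩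
  · have hGc : ∀ s, Continuous (reg.regG ε G μ s) := fun s => (hGs s).continuous
    have hqc : Continuous (P.D (reg.kerq k₁ ε (reg.stepKernel ε N j) μ)) := continuous_D P (hqs j)
    have hRc : Continuous (reg.kerR ε (reg.stepKernel ε N j) μ) := (hRs j).continuous
    have hRc' : Continuous fun x => (1 / 2 : ℝ) • (reg.kerR ε (reg.stepKernel ε N j) μ x +
        (reg.kerR ε (reg.stepKernel ε N j) μ x)ᵀ) := by
      have hT := hRc.matrix_transpose
      fun_prop
    -- The exact time-discrete equation multiplied by `N`, written as linear combinations to which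
    -- the linear sampling operator is applied.
    have h1 : (fun x => (N : ℝ) • reg.regG ε G μ ((j + 1 : ℕ) / N) x +
        (-(N : ℝ)) • reg.regG ε G μ ((j : ℕ) / N) x) = fun x =>
        (-1 : ℝ) • P.D (reg.kerq k₁ ε (reg.stepKernel ε N j) μ) x +
        (1 : ℝ) • ((1 / 2 : ℝ) • (reg.kerR ε (reg.stepKernel ε N j) μ x +
          (reg.kerR ε (reg.stepKernel ε N j) μ x)ᵀ)) := by
      funext x
      have h2 := reg.regG_sub_regG hP (fun i => (hG i).isSymm) hμ.1 hε (step_lt hN0 j) x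
      rw [step_sub] at h2
      rw [neg_smul, ← sub_eq_add_neg, ← smul_sub, h2, smul_smul, mul_inv_cancel₀ hN'.ne', one_smul,
        neg_one_smul, one_smul]
      rfl
    have h3 := congrArg (fun f => S.SX σ (toC Ω f)) h1
    beta_reduce at h3
    rw [toC_linear Ω (hGc _) (hGc _), toC_linear Ω hqc hRc', map_add, map_add, map_smul, map_smul,
      map_smul, map_smul, ← S.coe_proj_SX σ hRc] at h3
    apply Subtype.ext
    rw [map_add, Sampling.proj_of_mem σ (S.err_mem σ P (hqs j))]
    simp only [c, Submodule.coe_smul, Submodule.coe_sub, Submodule.coe_add, Submodule.coe_neg,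
      Fin.val_succ, Fin.val_castSucc, Sampling.err]
    rw [smul_sub, sub_eq_add_neg, ← neg_smul, h3]
    module
  · simp [c]
  · simp [c, hN0.ne']
  -- By linearity the midpoint of two samples is the sample of the midpoint field, which inherits
  -- the `C²` bound and the lower bound `ε`; consistency of the action then applies.
  · have key : ∀ j : Fin N, M.J σ ((1 / 2 : ℝ) • (c.G j.castSucc + c.G j.succ), c.q j, c.R j) ≤
        spatialAction Ω (fun x => (1 / 2 : ℝ) • (reg.regG ε G μ ((j : ℕ) / N) x +
          reg.regG ε G μ (((j : ℕ) + 1 : ℕ) / N) x)) (reg.kerq k₁ ε (reg.stepKernel ε N j) μ)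
          (reg.kerR ε (reg.stepKernel ε N j) μ) + ENNReal.ofReal (C * e σ) := fun j => by
      have bm : ∀ i l, SmoothBdd (fun x => ((1 / 2 : ℝ) • (reg.regG ε G μ ((j : ℕ) / N) x +
          reg.regG ε G μ (((j : ℕ) + 1 : ℕ) / N) x)) i l) E := fun i l => by
        have h := ((hEG ((j : ℕ) / N) i l).add (hEG (((j : ℕ) + 1 : ℕ) / N) i l)).const_mul (1 / 2)
        refine SmoothBdd.mono (by simpa only [Matrix.smul_apply, Matrix.add_apply, smul_eq_mul]
          using h) ?_
        rw [abs_of_pos (by norm_num)]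
        linarith [le_max_left EG (max Eq (max ER 1))]
      have h0 : (0 : ℝ) ≤ E := zero_le_one.trans hE1
      have hnn : (0 : ℝ) ≤ n * n := by positivity
      have hnk : (0 : ℝ) ≤ n * k := by positivity
      have hd : (0 : ℝ) ≤ 1 + d + d * d := by positivity
      have hle1 : (1 + d + d * d) * ((n * n + 1) * E) ≤
          (1 + d + d * d : ℝ) * ((n * n + n * k + 1) * E) :=
        mul_le_mul_of_nonneg_left (mul_le_mul_of_nonneg_right (by linarith) h0) hd
      have hle2 : (1 + d + d * d) * ((n * k + 1) * E) ≤
          (1 + d + d * d : ℝ) * ((n * n + n * k + 1) * E) :=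
        mul_le_mul_of_nonneg_left (mul_le_mul_of_nonneg_right (by linarith) h0) hd
      refine hact _ _ _ (fun i l => (bm i l).smooth) (hqs j) (hRs j)
        ((norm2_le Ω _ h0 bm).trans hle1)
        ((norm2_le Ω _ h0 fun i l => (bq j i l).mono (by simp [hE])).trans hle2)
        ((norm2_le Ω _ h0 fun i l => (bR j i l).mono (by simp [hE])).trans hle1)
        (fun x hx => ?_) (reg.boundaryCondition_kerq hne P k₁ hε _ μ) σ _ ?_
      · have p1 := posSemidef_regG_sub hsm hΩ hG hμ.2 ((j : ℕ) / N) hx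
        have p2 := posSemidef_regG_sub hsm hΩ hG hμ.2 (((j : ℕ) + 1 : ℕ) / N) hx
        have p3 := (p1.add p2).smul (show (0 : ℝ) ≤ 1 / 2 by norm_num)
        convert p3 using 1
        module
      · have hGc : ∀ s, Continuous (reg.regG ε G μ s) := fun s => (hGs s).continuous
        simp_rw [smul_add]
        rw [toC_linear Ω (hGc _) (hGc _), map_add, map_smul, map_smul]
        simp [c]
    refine le_trans ?_ (add_le_add_left (hN₀ N ((le_max_left _ _).trans hN)) _)
    rw [DiscreteCurve.action]
    refine (mul_le_mul_right (Finset.sum_le_sum fun j _ => key j) _).trans ?_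
    rw [Finset.sum_add_distrib, mul_add, Finset.sum_range]
    refine add_le_add le_rfl ?_
    rw [Finset.sum_const, Finset.card_univ, Fintype.card_fin, nsmul_eq_mul, ← mul_assoc,
      ENNReal.inv_mul_cancel (by exact_mod_cast hN0.ne') (by simp), one_mul]

end Discrete

/-! ### Operations on discrete curves -/

section Discrete

variable {Ω : Set (Eu d)} {Sg : Set ℝ} {Xb Y : Sg → Type*}
  [∀ σ, NormedAddCommGroup (Xb σ)] [∀ σ, NormedSpace ℝ (Xb σ)] [∀ σ, FiniteDimensional ℝ (Xb σ)]
  [∀ σ, NormedAddCommGroup (Y σ)] [∀ σ, NormedSpace ℝ (Y σ)] [∀ σ, FiniteDimensional ℝ (Y σ)]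
  {M : DiscreteModules Ω n k Sg Xb Y} {N N₁ N₂ : ℕ} {σ : Sg} {a b b' : Xb σ}

namespace DiscreteCurve

/-- The time reversal of a discrete curve. -/
def reverse (c : DiscreteCurve M N σ) : DiscreteCurve M N σ where
  G i := c.G i.rev
  q j := (-1 : ℝ) • c.q j.rev
  R j := (-1 : ℝ) • c.R j.rev

theorem Connects.reverse {c : DiscreteCurve M N σ} (h : c.Connects a b) :
    c.reverse.Connects b a where
  equation j := by
    have h1 := h.equation j.rev
    simp only [DiscreteCurve.reverse, Fin.rev_castSucc, Fin.rev_succ, map_smul]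
    rw [← neg_sub, smul_neg, h1]
    module
  start := by simpa [DiscreteCurve.reverse] using h.finish
  finish := by simpa [DiscreteCurve.reverse] using h.start
  pos i := h.pos _

/-- Homogeneity with factor `-1` makes `J` even in `(q, R)`, and the midpoint of two consecutive
values is symmetric in them. -/
theorem action_reverse (c : DiscreteCurve M N σ) : c.reverse.action = c.action := by
  unfold action reverse
  congr 1
  rw [← Equiv.sum_comp Fin.revPerm]
  refine Finset.sum_congr rfl fun j _ => ?_
  rw [M.J_homog_second _ _ _ _ _ (by norm_num)]
  simp only [Fin.revPerm_apply, Fin.rev_rev, Fin.rev_castSucc, Fin.rev_succ]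
  rw [add_comm]
  norm_num

/-- The concatenation of two discrete curves, with the fluxes rescaled to the new time step. -/
def glue (c₁ : DiscreteCurve M N₁ σ) (c₂ : DiscreteCurve M N₂ σ) :
    DiscreteCurve M (N₁ + N₂) σ where
  G i := if h : (i : ℕ) ≤ N₁ then c₁.G ⟨i, by omega⟩ else c₂.G ⟨i - N₁, by omega⟩
  q := Fin.append (fun j => ((N₁ + N₂ : ℝ) / N₁) • c₁.q j) fun j => ((N₁ + N₂ : ℝ) / N₂) • c₂.q j
  R := Fin.append (fun j => ((N₁ + N₂ : ℝ) / N₁) • c₁.R j) fun j => ((N₁ + N₂ : ℝ) / N₂) • c₂.R j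

section Glue

variable {c₁ : DiscreteCurve M N₁ σ} {c₂ : DiscreteCurve M N₂ σ}

theorem glue_G_left {i : Fin (N₁ + N₂ + 1)} (i' : Fin (N₁ + 1)) (h : (i : ℕ) = i') :
    (c₁.glue c₂).G i = c₁.G i' := by
  have hi : (i : ℕ) ≤ N₁ := by omega
  simp only [glue, hi, dif_pos]
  congr 1
  exact Fin.ext h

/-- At the junction the definition of `glue` uses the first curve, hence the hypothesis that the two
curves agree there. -/
theorem glue_G_right (hG : c₁.G (Fin.last N₁) = c₂.G 0) {i : Fin (N₁ + N₂ + 1)}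
    (i' : Fin (N₂ + 1)) (h : (i : ℕ) = N₁ + i') : (c₁.glue c₂).G i = c₂.G i' := by
  by_cases h0 : (i' : ℕ) = 0
  · rw [glue_G_left (Fin.last N₁) (by simp [h, h0]), hG]
    congr 1
    exact Fin.ext h0.symm
  · have hi : ¬ (i : ℕ) ≤ N₁ := by omega
    simp only [glue, hi, dif_neg, not_false_eq_true]
    congr 1
    exact Fin.ext (by simp [h])

theorem Connects.endpoints_eq (h₁ : c₁.Connects a b) (h₂ : c₂.Connects b b') :
    c₁.G (Fin.last N₁) = c₂.G 0 :=
  Subtype.ext (h₁.finish.trans h₂.start.symm)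

theorem Connects.glue (h₁ : c₁.Connects a b) (h₂ : c₂.Connects b b') (hN₁ : 0 < N₁)
    (hN₂ : 0 < N₂) : (c₁.glue c₂).Connects a b' where
  equation j := by
    have e := h₁.endpoints_eq h₂
    have p₁ : (N₁ : ℝ) ≠ 0 := by exact_mod_cast hN₁.ne'
    have p₂ : (N₂ : ℝ) ≠ 0 := by exact_mod_cast hN₂.ne'
    refine Fin.addCases (fun j => ?_) (fun j => ?_) j
    · rw [glue_G_left (i := (Fin.castAdd N₂ j).succ) j.succ (by simp),
        glue_G_left (i := (Fin.castAdd N₂ j).castSucc) j.castSucc (by simp)]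
      simp only [DiscreteCurve.glue, Fin.append_left, map_smul]
      rw [← smul_neg, ← smul_add, ← h₁.equation j, smul_smul, div_mul_cancel₀ _ p₁, Nat.cast_add]
    · rw [glue_G_right e (i := (Fin.natAdd N₁ j).succ) j.succ (by simp [add_assoc]),
        glue_G_right e (i := (Fin.natAdd N₁ j).castSucc) j.castSucc (by simp)]
      simp only [DiscreteCurve.glue, Fin.append_right, map_smul]
      rw [← smul_neg, ← smul_add, ← h₂.equation j, smul_smul, div_mul_cancel₀ _ p₂, Nat.cast_add]
  start := by rw [glue_G_left 0 (by simp), h₁.start]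
  finish := by rw [glue_G_right (h₁.endpoints_eq h₂) (Fin.last N₂) (by simp), h₂.finish]
  pos i := by
    by_cases h : (i : ℕ) ≤ N₁
    · rw [glue_G_left ⟨i, by omega⟩ rfl]
      exact h₁.pos _
    · rw [glue_G_right (h₁.endpoints_eq h₂) ⟨i - N₁, by omega⟩ (by simp; omega)]
      exact h₂.pos _

/-- Traversing a curve faster by the factor `T / N₁` multiplies the cost of each step by its square,
while the step length shrinks from `1 / N₁` to `1 / T`; the net factor is `T / N₁`. -/
theorem inv_mul_sum_sq (hN₁ : 0 < N₁) {T : ℝ} (hT : 0 < T) (f : Fin N₁ → ℝ≥0∞) :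
    ENNReal.ofReal T⁻¹ * ∑ j, ENNReal.ofReal ((T / N₁) ^ 2) * f j =
      ENNReal.ofReal (T / N₁) * ((N₁ : ℝ≥0∞)⁻¹ * ∑ j, f j) := by
  have p₁ : (0 : ℝ) < N₁ := by exact_mod_cast hN₁
  rw [← Finset.mul_sum, ← mul_assoc, ← mul_assoc, ← ENNReal.ofReal_natCast N₁,
    ← ENNReal.ofReal_inv_of_pos p₁, ← ENNReal.ofReal_mul (by positivity),
    ← ENNReal.ofReal_mul (by positivity)]
  congr 2
  field_simp

theorem action_glue (h₁ : c₁.Connects a b) (h₂ : c₂.Connects b b') (hN₁ : 0 < N₁)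
    (hN₂ : 0 < N₂) : (c₁.glue c₂).action =
      ENNReal.ofReal ((N₁ + N₂ : ℝ) / N₁) * c₁.action +
        ENNReal.ofReal ((N₁ + N₂ : ℝ) / N₂) * c₂.action := by
  have e := h₁.endpoints_eq h₂
  have p₁ : (0 : ℝ) < N₁ := by exact_mod_cast hN₁
  have p₂ : (0 : ℝ) < N₂ := by exact_mod_cast hN₂
  have p : (0 : ℝ) < N₁ + N₂ := add_pos p₁ p₂
  have hT : ((N₁ + N₂ : ℕ) : ℝ≥0∞)⁻¹ = ENNReal.ofReal (N₁ + N₂ : ℝ)⁻¹ := by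
    rw [ENNReal.ofReal_inv_of_pos p, ← Nat.cast_add, ENNReal.ofReal_natCast]
  unfold action
  rw [← inv_mul_sum_sq hN₁ p, ← inv_mul_sum_sq hN₂ p, hT, ← mul_add, Fin.sum_univ_add]
  congr 2
  · refine Finset.sum_congr rfl fun j _ => ?_
    rw [glue_G_left (i := (Fin.castAdd N₂ j).succ) j.succ (by simp),
      glue_G_left (i := (Fin.castAdd N₂ j).castSucc) j.castSucc (by simp)]
    simp only [glue, Fin.append_left]
    exact M.J_homog_second _ _ _ _ _ (div_pos p p₁).ne'
  · refine Finset.sum_congr rfl fun j _ => ?_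
    rw [glue_G_right e (i := (Fin.natAdd N₁ j).succ) j.succ (by simp [add_assoc]),
      glue_G_right e (i := (Fin.natAdd N₁ j).castSucc) j.castSucc (by simp)]
    simp only [glue, Fin.append_right]
    exact M.J_homog_second _ _ _ _ _ (div_pos p p₂).ne'

end Glue

/-- Any two elements of the cone are connected by a discrete curve. -/
theorem exists_connects (hN : 0 < N) (ha : a ∈ M.Xpos σ) (hb : b ∈ M.Xpos σ) :
    ∃ c : DiscreteCurve M N σ, c.Connects a b := by
  -- The whole jump happens in the first step and is produced by the reaction alone. Its action may
  -- be infinite.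
  let g : Fin (N + 1) → M.X σ := fun i =>
    if i = 0 then ⟨a, M.Xpos_subset σ ha⟩ else ⟨b, M.Xpos_subset σ hb⟩
  refine ⟨⟨g, 0, fun j => ((N : ℝ) • (g j.succ - g j.castSucc) : M.X σ)⟩,
    ⟨fun j => ?_, by simp [g], ?_, fun i => ?_⟩⟩
  · rw [Sampling.proj_of_mem σ (Subtype.coe_prop _)]
    simp only [Pi.zero_apply, map_zero, neg_zero, zero_add, Subtype.coe_eta]
  · have : Fin.last N ≠ 0 := fun h => hN.ne' (by simpa using congrArg Fin.val h)
    simp [g, this]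
  · by_cases h : i = 0 <;> simp [g, h, ha, hb]

/-- Connecting two curves of short duration by a long curve. -/
theorem exists_glue_three {c₀ c₁ : DiscreteCurve M N₁ σ} {c : DiscreteCurve M N₂ σ} {x y : Xb σ}
    (h₀ : c₀.Connects a x) (h : c.Connects x y) (h₁ : c₁.Connects b y) (hN₁ : 0 < N₁)
    (hN₂ : 0 < N₂) (hN : N = N₁ + N₂ + N₁) :
    ∃ c' : DiscreteCurve M N σ, c'.Connects a b ∧ c'.action =
      ENNReal.ofReal (N / N₁) * c₀.action + ENNReal.ofReal (N / N₂) * c.action +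
        ENNReal.ofReal (N / N₁) * c₁.action := by
  subst hN
  have p₁ : (0 : ℝ) < N₁ := by exact_mod_cast hN₁
  have p₂ : (0 : ℝ) < N₂ := by exact_mod_cast hN₂
  have h3 := h₀.glue h hN₁ hN₂
  refine ⟨_, h3.glue h₁.reverse (by omega) hN₁, ?_⟩
  have e : ∀ t : ℝ, (N₁ + N₂ + N₁) / (N₁ + N₂) * ((N₁ + N₂) / t) = (N₁ + N₂ + N₁) / t := fun t => by
    rw [div_mul_div_cancel₀ (by positivity)]
  rw [action_glue h3 h₁.reverse (by omega) hN₁, action_glue h₀ h hN₁ hN₂, action_reverse, mul_add,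
    ← mul_assoc, ← mul_assoc, ← ENNReal.ofReal_mul (by positivity),
    ← ENNReal.ofReal_mul (by positivity)]
  push_cast
  rw [e, e]

end DiscreteCurve

/-- Gluing curves near the two endpoints to a curve in between, with a small share `1/m` of the time
for each of the former. -/
theorem exists_glued_family {x y : ∀ σ, Xb σ} {Gσ : Fin 2 → ∀ σ, Xb σ}
    (hGσ : ∀ i σ, Gσ i σ ∈ M.Xpos σ) {γ₀ γ₁ : ∀ (N : ℕ) (σ : Sg), DiscreteCurve M N σ}
    (h₀ : ∀ N ≥ 2, ∀ σ, (γ₀ N σ).Connects (Gσ 0 σ) (x σ))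
    (h₁ : ∀ N ≥ 2, ∀ σ, (γ₁ N σ).Connects (Gσ 1 σ) (y σ)) {B : Sg → ℝ≥0∞} {N₀ : ℕ}
    (hB : ∀ N ≥ N₀, ∀ σ, ∃ c : DiscreteCurve M N σ, c.Connects (x σ) (y σ) ∧ c.action ≤ B σ)
    {p : ℕ} (hp : 0 < p) :
    ∃ γ : ∀ (N : ℕ) (σ : Sg), DiscreteCurve M N σ,
      (∀ N ≥ 2, ∀ σ, (γ N σ).Connects (Gσ 0 σ) (Gσ 1 σ)) ∧
      ∀ N ≥ (p + 2) * (N₀ + 2), ∀ σ, (γ N σ).action ≤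
        ENNReal.ofReal (2 * (p + 2)) * (γ₀ (N / (p + 2)) σ).action +
          ENNReal.ofReal (1 + 2 / p) * B σ +
          ENNReal.ofReal (2 * (p + 2)) * (γ₁ (N / (p + 2)) σ).action := by
  have key : ∀ (N : ℕ) (σ : Sg), ∃ c : DiscreteCurve M N σ,
      (N ≥ 2 → c.Connects (Gσ 0 σ) (Gσ 1 σ)) ∧ (N ≥ (p + 2) * (N₀ + 2) → c.action ≤
        ENNReal.ofReal (2 * (p + 2)) * (γ₀ (N / (p + 2)) σ).action +
          ENNReal.ofReal (1 + 2 / p) * B σ +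
          ENNReal.ofReal (2 * (p + 2)) * (γ₁ (N / (p + 2)) σ).action) := fun N σ => by
    by_cases hN : N ≥ (p + 2) * (N₀ + 2)
    -- Each outer curve receives `N₁` steps and the middle one the remaining `N₂ = N - 2 N₁ ≥ p N₁`.
    -- The threshold on `N` ensures `N₁ ≥ N₀ + 2`, hence also `N₂ ≥ N₀`.
    · set N₁ := N / (p + 2) with hN₁
      have g1 : N₀ + 2 ≤ N₁ := (Nat.le_div_iff_mul_le (by omega)).2 (by rwa [mul_comm])
      have g2 : (p + 2) * N₁ ≤ N := Nat.mul_div_le N (p + 2)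
      have g3 : N < (p + 2) * (N₁ + 1) := Nat.lt_mul_div_succ N (by omega)
      have g4 : N₁ ≤ p * N₁ := Nat.le_mul_of_pos_left N₁ hp
      have g5 : (p + 2) * N₁ = p * N₁ + 2 * N₁ := by ring
      obtain ⟨N₂, hN₂⟩ : ∃ N₂, N = N₁ + N₂ + N₁ := ⟨N - 2 * N₁, by omega⟩
      have g6 : p * N₁ ≤ N₂ := by omega
      obtain ⟨c, hc, hcB⟩ := hB N₂ (by omega) σ
      obtain ⟨c', hc', hca⟩ := DiscreteCurve.exists_glue_three (h₀ N₁ (by omega) σ) hc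
        (h₁ N₁ (by omega) σ) (by omega) (by omega) hN₂
      have p1 : (0 : ℝ) < N₁ := by exact_mod_cast (by omega : 0 < N₁)
      have p2 : (0 : ℝ) < N₂ := by exact_mod_cast (by omega : 0 < N₂)
      have p3 : (0 : ℝ) < p := by exact_mod_cast hp
      -- From `N < (p + 2) (N₁ + 1)` and `N₁ ≥ 1`.
      have q1 : (N / N₁ : ℝ) ≤ 2 * (p + 2) := by
        rw [div_le_iff₀ p1]
        have : N ≤ 2 * (p + 2) * N₁ := g3.le.trans (by nlinarith)
        exact_mod_cast this
      -- From `N - N₂ = 2 N₁ ≤ (2 / p) N₂`.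
      have q2 : (N / N₂ : ℝ) ≤ 1 + 2 / p := by
        rw [div_le_iff₀ p2, ← sub_nonneg]
        have e1 : (N : ℝ) = N₁ + N₂ + N₁ := by exact_mod_cast hN₂
        have e2 : (p : ℝ) * N₁ ≤ N₂ := by exact_mod_cast g6
        have e3 : (1 + 2 / (p : ℝ)) * N₂ - N = 2 / p * (N₂ - p * N₁) := by
          rw [e1]
          field_simp
          ring
        rw [e3]
        exact mul_nonneg (by positivity) (sub_nonneg.2 e2)
      refine ⟨c', fun _ => hc', fun _ => hca.trans_le ?_⟩
      gcongr
    -- For each fixed `p` and `N₀` these are finitely many `N`, invisible to the limit superior;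
    -- only the endpoints matter, and for `N < 2` nothing is required.
    · by_cases h2 : N ≥ 2
      · obtain ⟨c, hc⟩ := DiscreteCurve.exists_connects (N := N) (by omega) (hGσ 0 σ) (hGσ 1 σ)
        exact ⟨c, fun _ => hc, fun h => absurd h hN⟩
      · exact ⟨⟨0, 0, 0⟩, fun h => absurd h h2, fun h => absurd h hN⟩
  choose γ hγ using key
  exact ⟨γ, fun N hN σ => (hγ N σ).1 hN, fun N hN σ => (hγ N σ).2 hN⟩

end Discrete

end WBScheme

end

/-! ### Choice of the parameters and conclusion. -/

theorem mainTheorem6 {d n k : ℕ} (hd : 0 < d) (hn : 0 < n) (hk : 0 < k)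
    {Ω : Set (Eu d)} (hΩ : IsSmoothCompact Ω) (P : DiffOp d n k)
    {Sg : Set ℝ} (hSg : Sg ⊆ Ioi 0) (hSg0 : (𝓝[Sg] (0 : ℝ)).NeBot)
    {Xb Y : Sg → Type*}
    [∀ σ, NormedAddCommGroup (Xb σ)] [∀ σ, NormedSpace ℝ (Xb σ)] [∀ σ, FiniteDimensional ℝ (Xb σ)]
    [∀ σ, NormedAddCommGroup (Y σ)] [∀ σ, NormedSpace ℝ (Y σ)] [∀ σ, FiniteDimensional ℝ (Y σ)]
    (M : DiscreteModules Ω n k Sg Xb Y)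
    (G : Fin 2 → MatMeasure Ω n n) (hG : ∀ i, (G i).IsPosSemidef)
    (Gσ : Fin 2 → ∀ σ, Xb σ) (hGσ : ∀ i σ, Gσ i σ ∈ M.Xpos σ)
    (hconv : ∀ (i : Fin 2) (Φ : C(Ω, Mat n n)), (∀ x, (Φ x)ᵀ = Φ x) →
      Tendsto (fun σ => (M.recX σ (Gσ i σ)).pair Φ) (meshFilter Sg) (𝓝 ((G i).pair Φ)))
    (S : Sampling M) (hS : S.Consistent P)
    (hC1 : IsStarShapedDomain Ω) (k₁ : ℕ) (hC2 : P.SplitsAt k₁)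
    (reg : RegularizationData Ω n) (hA : EndpointAssumption P M S G Gσ reg)
    (μ : CurveMeasure Ω n k) (hμ : μ.MemCEInfty P G) (η : ℝ) (hη : 0 < η) :
    ∃ γ : ∀ (N : ℕ) (σ : Sg), DiscreteCurve M N σ,
      (∀ N ≥ 2, ∀ σ, (γ N σ).Connects (Gσ 0 σ) (Gσ 1 σ)) ∧
        limsupAction γ ≤ μ.action + ENNReal.ofReal η := by
  have hΩne : Ω.Nonempty := hΩ.nonempty_interior.mono interior_subset
  obtain ⟨ε₁, hε₁, γ₀, hγ₀, hlim₀⟩ := hA μ hμ 0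
  obtain ⟨ε₂, hε₂, γ₁, hγ₁, hlim₁⟩ := hA μ hμ 1
  obtain ⟨ε₃, hε₃, hsmall⟩ := reg.eventually_small hΩ.isCompact
  set A := μ.action.toReal with hAdef
  have hAμ : μ.action = ENNReal.ofReal A := (ENNReal.ofReal_toReal hμ.2.ne).symm
  have hA0 : 0 ≤ A := ENNReal.toReal_nonneg
  -- `p` is fixed first: the middle curve is accelerated by at most `1 + 2 / p`, which may cost at
  -- most `η / 4`.
  obtain ⟨p, hpA, hp⟩ : ∃ p : ℕ, (1 + 2 / p) * A < A + η / 4 ∧ 0 < p := by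
    have h1 : Tendsto (fun p : ℕ => (1 + 2 / (p : ℝ)) * A) atTop (𝓝 ((1 + 0) * A)) :=
      ((tendsto_const_div_atTop_nhds_zero_nat 2).const_add 1).mul_const A
    rw [add_zero, one_mul] at h1
    exact ((h1.eventually_lt_const (by linarith)).and (eventually_gt_atTop 0)).exists
  have hp' : (0 : ℝ) < p := by exact_mod_cast hp
  -- The outer actions are amplified by `2 (p + 2)`, so each has to be below `δ` to contribute at
  -- most `η / 4`.
  set δ := η / 4 / (2 * (p + 2)) with hδ
  have hδ0 : 0 < δ := by positivity
  have hδ' : ENNReal.ofReal (2 * (p + 2)) * ENNReal.ofReal δ = ENNReal.ofReal (η / 4) := by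
    rw [← ENNReal.ofReal_mul (by positivity), hδ]
    congr 1
    field_simp
  -- Since `δ` depends on `p`, `ε` has to be chosen after `p`; (A*) then brings both outer limits
  -- below `δ`.
  obtain ⟨ε, ⟨⟨hε0, hε⟩, hεA⟩, hl₀, hl₁⟩ : ∃ ε, (ε ∈ Ioo 0 (min ε₁ (min ε₂ ε₃)) ∧
      (1 + 2 / p) * ((1 + 2 * ε) * A) < A + η / 4) ∧
      limsupAction (γ₀ ε) < ENNReal.ofReal δ ∧ limsupAction (γ₁ ε) < ENNReal.ofReal δ := by
    have h1 : Tendsto (fun ε : ℝ => (1 + 2 / (p : ℝ)) * ((1 + 2 * ε) * A)) (𝓝[>] 0)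
        (𝓝 ((1 + 2 / p) * ((1 + 2 * 0) * A))) :=
      (Continuous.tendsto (by fun_prop) 0).mono_left nhdsWithin_le_nhds
    rw [mul_zero, add_zero, one_mul] at h1
    have h2 : (0 : ℝ≥0∞) < ENNReal.ofReal δ := ENNReal.ofReal_pos.2 hδ0
    exact (((Filter.eventually_mem_set.2 (Ioo_mem_nhdsGT (lt_min hε₁ (lt_min hε₂ hε₃)))).and
      (h1.eventually_lt_const hpA)).and ((hlim₀.eventually_lt_const h2).and
        (hlim₁.eventually_lt_const h2))).exists
  rw [lt_min_iff, lt_min_iff] at hε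
  obtain ⟨e, he, N₀, hreg⟩ := exists_discrete_regularized hS hΩ.isCompact hΩne hG hC2 hμ
    (hsmall ε ⟨hε0, hε.2.2⟩)
  obtain ⟨γ, hγ, hγB⟩ := exists_glued_family hGσ
    (fun N hN σ => by simpa using hγ₀ ε ⟨hε0, hε.1⟩ N hN σ)
    (fun N hN σ => by simpa using hγ₁ ε ⟨hε0, hε.2.1⟩ N hN σ) hreg hp
  refine ⟨γ, hγ, limsup_le_of_le (by isBoundedDefault) ?_⟩
  -- The outer curves are taken with `N / (p + 2)` steps, which still tends to infinity, so their
  -- limits superior control them along this reindexing.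
  have hdiv : Tendsto (fun r : ℕ × Sg => (r.1 / (p + 2), r.2)) (atTop ×ˢ meshFilter Sg)
      (atTop ×ˢ meshFilter Sg) :=
    (Nat.tendsto_div_const_atTop (by omega)).prodMap tendsto_id
  have he' : Tendsto (fun r : ℕ × Sg => (1 + 2 / (p : ℝ)) * e r.2) (atTop ×ˢ meshFilter Sg)
      (𝓝 ((1 + 2 / (p : ℝ)) * 0)) := (he.comp tendsto_snd).const_mul _
  rw [mul_zero] at he'
  filter_upwards [hdiv.eventually (eventually_lt_of_limsup_lt hl₀),
    hdiv.eventually (eventually_lt_of_limsup_lt hl₁),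
    he'.eventually_lt_const (show 0 < η / 4 by positivity),
    tendsto_fst.eventually (eventually_ge_atTop ((p + 2) * (N₀ + 2)))] with r h0 h1 h2 h3
  calc (γ r.1 r.2).action ≤ _ := hγB r.1 h3 r.2
    -- The four quarters of `η` pay for the two outer curves, the factor `(1 + 2 / p) (1 + 2ε)` in
    -- the middle, and the sampling error `e`.
    _ ≤ ENNReal.ofReal (η / 4) + (ENNReal.ofReal (A + η / 4) + ENNReal.ofReal (η / 4)) +
        ENNReal.ofReal (η / 4) := by
        refine add_le_add (add_le_add ?_ ?_) ?_
        · exact (mul_le_mul_right h0.le _).trans hδ'.le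
        · rw [hAμ, ← ENNReal.ofReal_mul (by positivity), mul_add,
            ← ENNReal.ofReal_mul (by positivity), ← ENNReal.ofReal_mul (by positivity)]
          exact add_le_add (ENNReal.ofReal_le_ofReal hεA.le) (ENNReal.ofReal_le_ofReal h2.le)
        · exact (mul_le_mul_right h1.le _).trans hδ'.le
    _ = μ.action + ENNReal.ofReal η := by
        rw [hAμ, ← ENNReal.ofReal_add (by positivity) (by positivity),
          ← ENNReal.ofReal_add (by positivity) (by positivity),
          ← ENNReal.ofReal_add (by positivity) (by positivity), ← ENNReal.ofReal_add hA0 hη.le]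
        congr 1
        ring
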